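/- **Theorem.** A finite digraph is a pair $(V,E)$ with $V$ finite and $E$ a set of ordered pairs of distinct vertices. The class of *minimal series-parallel digraphs* is defined recursively: every digraph on a single vertex belongs to it, and if $G_1=(V_1,E_1)$ and $G_2=(V_2,E_2)$ are vertex-disjoint members, then so are the parallel composition $(V_1\cup V_2,\;E_1\cup E_2)$ and the series composition $(V_1\cup V_2,\;E_1\cup E_2\cup (O_1\times I_2))$, where $O_1$ is the set of sinks (vertices of outdegree $0$) of $G_1$ and $I_2$ is the set of sources (vertices of indegree $0$) of $G_2$. An instance of the *subset sum problem with digraph constraint* (SSG) consists of a digraph $G=(A,E)$ on a set $A=\{a_1,\dots,a_n\}$ of $n$ items, positive integer sizes $s_1,\dots,s_n$ and a positive integer capacity $c$. A set $A'\subseteq A$ is *feasible* if $s(A'):=\sum_{a_j\in A'}s_j\le c$ and every $y\in A$ that has a predecessor in $A'$ belongs to $A'$. The task is to find a feasible set $A'$ that maximizes $s(A')$. There is an algorithm that finds an optimal solution $A'$ for every instance of SSG whose digraph $G$ is minimal series-parallel, with $n$ vertices and $m$ arcs, in $\mathcal O(n\cdot c^2+m)$ time and $\mathcal O(n\cdot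 c)$ space. Here the digraph is given by the lists of successors of its vertices (in arbitrary order), and the algorithm is one fixed program of a random access machine with unit-cost instructions (copying, addition, subtraction, comparison, indirect memory access), a read-only input, and words of $\mathcal O(\log(n+c+\sum_j s_j))$ bits; space is the number of words of work memory, and the solution is output as its characteristic vector. -/

import Mathlib

/-- A finite digraph `(verts, arcs)` whose vertices are elements of `V`; arcs are ordered pairs of
distinct vertices. -/
@[ext]
structure FinDigraph (V : Type*) where
  verts : Finset V
  arcs : Finset (V × V)
  mem_verts : ∀ a ∈ arcs, a.1 ∈ verts ∧ a.2 ∈ verts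
  ne_of_mem : ∀ a ∈ arcs, a.1 ≠ a.2

namespace FinDigraph

variable {V : Type*} [DecidableEq V]

/-- The set of predecessors of `y`. -/
def preds (G : FinDigraph V) (y : V) : Finset V :=
  G.verts.filter fun x => (x, y) ∈ G.arcs

/-- The vertices of outdegree `0`. -/
def sinks (G : FinDigraph V) : Finset V :=
  G.verts.filter fun v => ∀ a ∈ G.arcs, a.1 ≠ v

/-- The vertices of indegree `0`. -/
def sources (G : FinDigraph V) : Finset V :=
  G.verts.filter fun v => ∀ a ∈ G.arcs, a.2 ≠ v

/-- The digraph on the single vertex `v`. -/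
def single (v : V) : FinDigraph V where
  verts := {v}
  arcs := ∅
  mem_verts := by simp
  ne_of_mem := by simp

/-- Parallel composition. -/
def parallel (G H : FinDigraph V) : FinDigraph V where
  verts := G.verts ∪ H.verts
  arcs := G.arcs ∪ H.arcs
  mem_verts := by
    intro a ha
    rcases Finset.mem_union.1 ha with h | h
    · exact ⟨Finset.mem_union_left _ (G.mem_verts a h).1,
        Finset.mem_union_left _ (G.mem_verts a h).2⟩
    · exact ⟨Finset.mem_union_right _ (H.mem_verts a h).1,
        Finset.mem_union_right _ (H.mem_verts a h).2⟩
  ne_of_mem := by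
    intro a ha
    rcases Finset.mem_union.1 ha with h | h
    · exact G.ne_of_mem a h
    · exact H.ne_of_mem a h

/-- Series composition of vertex-disjoint digraphs: all arcs from a sink of the first digraph to a
source of the second one are added. -/
def series (G H : FinDigraph V) (hd : Disjoint G.verts H.verts) : FinDigraph V where
  verts := G.verts ∪ H.verts
  arcs := G.arcs ∪ H.arcs ∪ G.sinks ×ˢ H.sources
  mem_verts := by
    intro a ha
    rcases Finset.mem_union.1 ha with h | h
    · exact (G.parallel H).mem_verts a h
    · rw [Finset.mem_product] at h
      exact ⟨Finset.mem_union_left _ (Finset.mem_filter.1 h.1).1,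
        Finset.mem_union_right _ (Finset.mem_filter.1 h.2).1⟩
  ne_of_mem := by
    intro a ha
    rcases Finset.mem_union.1 ha with h | h
    · exact (G.parallel H).ne_of_mem a h
    · rw [Finset.mem_product] at h
      exact Finset.disjoint_iff_ne.1 hd _ (Finset.mem_filter.1 h.1).1 _
        (Finset.mem_filter.1 h.2).1

/-- Minimal series-parallel digraphs. -/
inductive IsMSP : FinDigraph V → Prop
  | single (v : V) : IsMSP (single v)
  | parallel (G H : FinDigraph V) (hd : Disjoint G.verts H.verts) :
      IsMSP G → IsMSP H → IsMSP (parallel G H)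
  | series (G H : FinDigraph V) (hd : Disjoint G.verts H.verts) :
      IsMSP G → IsMSP H → IsMSP (series G H hd)

end FinDigraph

/-- An instance of the subset sum problem with digraph constraint on the items `0, …, n - 1`. -/
structure SSGInstance (n : ℕ) where
  graph : FinDigraph (Fin n)
  verts_eq : graph.verts = Finset.univ
  size : Fin n → ℕ
  size_pos : ∀ i, 0 < size i
  cap : ℕ
  cap_pos : 0 < cap

namespace SSGInstance

variable {n : ℕ}

/-- The total size of a set of items. -/
def weight (I : SSGInstance n) (B : Finset (Fin n)) : ℕ := ∑ i ∈ B, I.size i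

/-- The capacity constraint and the digraph constraint. -/
def Feasible (I : SSGInstance n) (B : Finset (Fin n)) : Prop :=
  I.weight B ≤ I.cap ∧ ∀ y : Fin n, (I.graph.preds y ∩ B).Nonempty → y ∈ B

/-- `B` is an optimal solution: a feasible set of maximum total size. -/
def IsOptimal (I : SSGInstance n) (B : Finset (Fin n)) : Prop :=
  I.Feasible B ∧ ∀ C, I.Feasible C → I.weight C ≤ I.weight B

/-- `adj` is an adjacency-list representation of the digraph: `adj v` lists the successors of `v`,
each of them once, in any order. -/
def IsAdjacencyList (I : SSGInstance n) (adj : Fin n → List (Fin n)) : Prop :=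
  ∀ v, (adj v).Nodup ∧ ∀ w, w ∈ adj v ↔ (v, w) ∈ I.graph.arcs

/-- The input array for an instance whose digraph is given by the successor lists `adj`. It holds
`n`, the capacity, the `n` sizes, then `n + 1` offsets and finally the concatenation of the
successor lists; the successors of `v` stand in the concatenation at the positions from offset
number `v` (inclusive) to offset number `v + 1` (exclusive). -/
def encode (I : SSGInstance n) (adj : Fin n → List (Fin n)) : List ℕ :=
  [n, I.cap] ++ List.ofFn I.size
    ++ (List.range (n + 1)).map
        (fun k => (((List.finRange n).take k).map fun v => (adj v).length).sum)
    ++ (List.finRange n).flatMap fun v => (adj v).map fun w => (w : ℕ)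

end SSGInstance

/-! Random access machines with structured control flow. A machine has a read-only input array,
registers (of which a program, being finite, uses a fixed number) and a work memory. It is
parametrized by the number `S` of its work memory cells and by the largest number `W` that fits
into a word. Every instruction and every evaluation of a test takes one unit of time. -/
namespace RAM

/-- The contents of the registers and of the work memory. -/
structure State where
  reg : ℕ → ℕ
  mem : ℕ → ℕ

/-- Initially all registers and memory cells hold `0`. -/
def State.init : State := ⟨fun _ => 0, fun _ => 0⟩

/-- The elementary instructions. The arguments are names of registers, except for the constant `k`
of `const`. -/
inductive Instr
  | const (r k : ℕ)
  | copy (r a : ℕ)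
  | add (r a b : ℕ)
  | sub (r a b : ℕ)
  | load (r a : ℕ)
  | store (a b : ℕ)
  | input (r a : ℕ)

/-- Write `x` to register `r`; this fails if `x` does not fit into a word. -/
def State.setReg (W : ℕ) (σ : State) (r x : ℕ) : Option State :=
  if x ≤ W then some { σ with reg := Function.update σ.reg r x } else none

/-- The effect of an elementary instruction. It fails on an overflow and on an access to a work
memory cell whose address is not below `S`. Subtraction is truncated at `0`, and reading beyond the
end of the input gives `0`. -/
def Instr.exec (inp : List ℕ) (S W : ℕ) (σ : State) : Instr → Option State
  | .const r k => σ.setReg W r k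
  | .copy r a => σ.setReg W r (σ.reg a)
  | .add r a b => σ.setReg W r (σ.reg a + σ.reg b)
  | .sub r a b => σ.setReg W r (σ.reg a - σ.reg b)
  | .load r a => if σ.reg a < S then σ.setReg W r (σ.mem (σ.reg a)) else none
  | .store a b =>
      if σ.reg a < S then some { σ with mem := Function.update σ.mem (σ.reg a) (σ.reg b) } else none
  | .input r a => σ.setReg W r (inp.getD (σ.reg a) 0)

/-- Programs. The tests of branches and loops ask whether the number in register `a` is smaller
than the number in register `b`. -/
inductive Prog
  | instr (i : Instr)
  | seq (p q : Prog)
  | ifLt (a b : ℕ) (p q : Prog)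
  | whileLt (a b : ℕ) (p : Prog)

/-- `Run inp S W p σ t τ`: on a machine with `S` work memory cells and words for the numbers
`0, …, W`, and on the input `inp`, the program `p` started in state `σ` stops without a failure
after exactly `t` time units in state `τ`. -/
inductive Run (inp : List ℕ) (S W : ℕ) : Prog → State → ℕ → State → Prop
  | instr {i : Instr} {σ τ : State} (h : i.exec inp S W σ = some τ) :
      Run inp S W (.instr i) σ 1 τ
  | seq {p q : Prog} {σ τ υ : State} {t u : ℕ} :
      Run inp S W p σ t τ → Run inp S W q τ u υ → Run inp S W (.seq p q) σ (t + u) υ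
  | ifTrue {a b : ℕ} {p q : Prog} {σ τ : State} {t : ℕ} (h : σ.reg a < σ.reg b) :
      Run inp S W p σ t τ → Run inp S W (.ifLt a b p q) σ (1 + t) τ
  | ifFalse {a b : ℕ} {p q : Prog} {σ τ : State} {t : ℕ} (h : ¬ σ.reg a < σ.reg b) :
      Run inp S W q σ t τ → Run inp S W (.ifLt a b p q) σ (1 + t) τ
  | whileFalse {a b : ℕ} {p : Prog} {σ : State} (h : ¬ σ.reg a < σ.reg b) :
      Run inp S W (.whileLt a b p) σ 1 σ
  | whileTrue {a b : ℕ} {p : Prog} {σ τ υ : State} {t u : ℕ} (h : σ.reg a < σ.reg b) :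
      Run inp S W p σ t τ → Run inp S W (.whileLt a b p) τ u υ →
        Run inp S W (.whileLt a b p) σ (1 + t + u) υ

end RAM

/-! ### Two-terminal series-parallel multidigraphs -/

/-! A minimal series-parallel digraph is the line digraph of a two-terminal series-parallel
multidigraph (`FinDigraph.IsMSP.exists_isLineOf`): the items are the arcs of the multidigraph, item
`v` leads from `tl v` to `hd v`, and `(u, v)` is an arc of the digraph exactly when `hd u = tl v`. A
parallel composition identifies both pairs of terminals. A series composition identifies the first
target with the second source, and the product of sinks and sources consists of the pairs that meet
there.

The program recovers such a multidigraph. A topological sort with a queue gives every item as its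
tail one plus its first predecessor in the queue, or `0` for a source, and as its head the tail of
any successor, or `n + 1` for a sink. These labels agree with `tl` and `hd` up to an injective
renaming (`Sorting.labelling`, `Labelling.ttsp`). Items enter the queue in the order of their last
predecessors, so items with equal tails stand together (`Sorting.itemOrder`).

The multidigraph is then shrunk to a single arc by parallel and series reductions, which keep it
series-parallel (`TTSP.erase_of_two_le_count`, `TTSP.contract`). Its arcs become blocks, each with a
decomposition tree. Items are taken up from the end of the queue. A block that is parallel to one
stored at its head is merged with it; a block that alone enters its head is merged with the unique
block leaving that vertex. The process cannot get stuck, because a vertex without parallel outgoing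
arcs whose out-neighbours other than the target all have indegree at least two has only one outgoing
arc (`TTSP.outdeg_le_one`).

Every block has a table of the sums up to `c` of the sets closed under successors inside it. In a
series node such a set either avoids the first part or contains the whole second part, since a
closed set that meets the first part contains one of its sinks, hence all sources of the second
part. As sizes are positive, this says that the first partial sum is `0` or the second one is the
full weight (`SPTree.TableOK.node`), so a table arises from those of the two parts in time O(c²).
There are `n - 1` merges, and the rest of the work is linear in `n + m + c`. A table entry records
one admissible split, so the largest attainable sum of the last block can be passed down to the
items (`Targets.step`, `Targets.optimal`).

The program is verified by a calculus of preconditions with step counts (`RAM.Layout.wp`) on an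
abstract store. There are `2n + 2` records of `c + 17` cells, which gives the space bound. -/

/-- `x` is an endpoint of an arc of `E`. -/
def IsEndpoint (E : Multiset (ℕ × ℕ)) (x : ℕ) : Prop := ∃ e ∈ E, e.1 = x ∨ e.2 = x

/-- Two-terminal series-parallel multidigraphs, given by the multiset of their arcs, with source `a`
and target `b`. -/
inductive TTSP : Multiset (ℕ × ℕ) → ℕ → ℕ → Prop
  | edge {a b : ℕ} : a ≠ b → TTSP {(a, b)} a b
  | par {E F : Multiset (ℕ × ℕ)} {a b : ℕ} : TTSP E a b → TTSP F a b →
      (∀ x, IsEndpoint E x → IsEndpoint F x → x = a ∨ x = b) → TTSP (E + F) a b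
  | ser {E F : Multiset (ℕ × ℕ)} {a m b : ℕ} : TTSP E a m → TTSP F m b →
      (∀ x, IsEndpoint E x → IsEndpoint F x → x = m) → TTSP (E + F) a b

def outdeg (E : Multiset (ℕ × ℕ)) (x : ℕ) : ℕ := E.countP fun e => e.1 = x

def indeg (E : Multiset (ℕ × ℕ)) (x : ℕ) : ℕ := E.countP fun e => e.2 = x

section Endpoints

variable {E F : Multiset (ℕ × ℕ)} {x : ℕ}

lemma isEndpoint_fst {e : ℕ × ℕ} (h : e ∈ E) : IsEndpoint E e.1 := ⟨e, h, Or.inl rfl⟩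

lemma isEndpoint_snd {e : ℕ × ℕ} (h : e ∈ E) : IsEndpoint E e.2 := ⟨e, h, Or.inr rfl⟩

lemma isEndpoint_add : IsEndpoint (E + F) x ↔ IsEndpoint E x ∨ IsEndpoint F x := by
  simp only [IsEndpoint, Multiset.mem_add, or_and_right, exists_or]

lemma IsEndpoint.mono (h : IsEndpoint E x) (hEF : E ≤ F) : IsEndpoint F x := by
  obtain ⟨e, he, h⟩ := h
  exact ⟨e, Multiset.mem_of_le hEF he, h⟩

lemma isEndpoint_cons {e : ℕ × ℕ} :
    IsEndpoint (e ::ₘ E) x ↔ (e.1 = x ∨ e.2 = x) ∨ IsEndpoint E x := by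
  simp [IsEndpoint]

lemma outdeg_add : outdeg (E + F) x = outdeg E x + outdeg F x := Multiset.countP_add _ _ _

lemma indeg_add : indeg (E + F) x = indeg E x + indeg F x := Multiset.countP_add _ _ _

lemma outdeg_eq_zero (h : ¬ IsEndpoint E x) : outdeg E x = 0 :=
  Multiset.countP_eq_zero.2 fun e he hx => h ⟨e, he, Or.inl hx⟩

lemma indeg_eq_zero (h : ¬ IsEndpoint E x) : indeg E x = 0 :=
  Multiset.countP_eq_zero.2 fun e he hx => h ⟨e, he, Or.inr hx⟩

lemma outdeg_pos {e : ℕ × ℕ} (h : e ∈ E) : 0 < outdeg E e.1 :=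
  Multiset.countP_pos.2 ⟨e, h, rfl⟩

lemma indeg_pos {e : ℕ × ℕ} (h : e ∈ E) : 0 < indeg E e.2 :=
  Multiset.countP_pos.2 ⟨e, h, rfl⟩

end Endpoints

/-! ### Reductions and local structure of series-parallel multidigraphs. -/

namespace TTSP

variable {E : Multiset (ℕ × ℕ)} {a b : ℕ}

lemma exists_out_in (h : TTSP E a b) : (∃ e ∈ E, e.1 = a) ∧ ∃ e ∈ E, e.2 = b := by
  induction h with
  | edge h => simp
  | par _ _ _ h1 h2 =>
    obtain ⟨⟨e, he, hea⟩, f, hf, hfb⟩ := h1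
    exact ⟨⟨e, Multiset.mem_add.2 (Or.inl he), hea⟩, f, Multiset.mem_add.2 (Or.inl hf), hfb⟩
  | ser _ _ _ h1 h2 =>
    obtain ⟨⟨e, he, hea⟩, -⟩ := h1
    obtain ⟨-, f, hf, hfb⟩ := h2
    exact ⟨⟨e, Multiset.mem_add.2 (Or.inl he), hea⟩, f, Multiset.mem_add.2 (Or.inr hf), hfb⟩

lemma isEndpoint_source (h : TTSP E a b) : IsEndpoint E a := by
  obtain ⟨e, he, hea⟩ := h.exists_out_in.1
  exact ⟨e, he, Or.inl hea⟩

lemma isEndpoint_target (h : TTSP E a b) : IsEndpoint E b := by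
  obtain ⟨e, he, hea⟩ := h.exists_out_in.2
  exact ⟨e, he, Or.inr hea⟩

lemma ne (h : TTSP E a b) : a ≠ b := by
  induction h with
  | edge h => exact h
  | par _ _ _ h1 _ => exact h1
  | ser h h' hd h1 h2 =>
    intro hab
    exact h1 (hd _ h.isEndpoint_source (hab ▸ h'.isEndpoint_target))

lemma snd_ne_source (h : TTSP E a b) : ∀ e ∈ E, e.2 ≠ a := by
  induction h with
  | edge h => simpa using h.symm
  | par _ _ _ h1 h2 =>
    intro e he
    rcases Multiset.mem_add.1 he with he | he
    exacts [h1 e he, h2 e he]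
  | ser h h' hd h1 h2 =>
    intro e he hea
    rcases Multiset.mem_add.1 he with he | he
    · exact h1 e he hea
    · exact h.ne (hd _ h.isEndpoint_source (hea ▸ isEndpoint_snd he))

lemma fst_ne_target (h : TTSP E a b) : ∀ e ∈ E, e.1 ≠ b := by
  induction h with
  | edge h => simpa using h
  | par _ _ _ h1 h2 =>
    intro e he
    rcases Multiset.mem_add.1 he with he | he
    exacts [h1 e he, h2 e he]
  | ser h h' hd h1 h2 =>
    intro e he hea
    rcases Multiset.mem_add.1 he with he | he
    · exact h'.ne (hd _ (hea ▸ isEndpoint_fst he) h'.isEndpoint_target).symm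
    · exact h2 e he hea

lemma fst_ne_snd (h : TTSP E a b) : ∀ e ∈ E, e.1 ≠ e.2 := by
  induction h with
  | edge h => simpa using h
  | par _ _ _ h1 h2 | ser _ _ _ h1 h2 =>
    intro e he
    rcases Multiset.mem_add.1 he with he | he
    exacts [h1 e he, h2 e he]

lemma exists_out (h : TTSP E a b) : ∀ x, IsEndpoint E x → x ≠ b → ∃ e ∈ E, e.1 = x := by
  induction h with
  | edge h =>
    rintro x ⟨e, he, hx⟩ hxb
    obtain rfl := Multiset.mem_singleton.1 he
    exact ⟨_, he, hx.resolve_right fun h => hxb h.symm⟩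
  | par h h' hd h1 h2 =>
    intro x hx hxb
    rcases isEndpoint_add.1 hx with hx | hx
    · obtain ⟨e, he, h⟩ := h1 x hx hxb
      exact ⟨e, Multiset.mem_add.2 (Or.inl he), h⟩
    · obtain ⟨e, he, h⟩ := h2 x hx hxb
      exact ⟨e, Multiset.mem_add.2 (Or.inr he), h⟩
  | @ser E F a m b h h' hd h1 h2 =>
    intro x hx hxb
    by_cases hF : IsEndpoint F x
    · obtain ⟨e, he, h⟩ := h2 x hF hxb
      exact ⟨e, Multiset.mem_add.2 (Or.inr he), h⟩
    · have hE := (isEndpoint_add.1 hx).resolve_right hF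
      obtain ⟨e, he, h⟩ := h1 x hE (fun hm => hF (hm ▸ h'.isEndpoint_source))
      exact ⟨e, Multiset.mem_add.2 (Or.inl he), h⟩

lemma exists_in (h : TTSP E a b) : ∀ x, IsEndpoint E x → x ≠ a → ∃ e ∈ E, e.2 = x := by
  induction h with
  | edge h =>
    rintro x ⟨e, he, hx⟩ hxb
    obtain rfl := Multiset.mem_singleton.1 he
    exact ⟨_, he, hx.resolve_left fun h => hxb h.symm⟩
  | par h h' hd h1 h2 =>
    intro x hx hxb
    rcases isEndpoint_add.1 hx with hx | hx
    · obtain ⟨e, he, h⟩ := h1 x hx hxb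
      exact ⟨e, Multiset.mem_add.2 (Or.inl he), h⟩
    · obtain ⟨e, he, h⟩ := h2 x hx hxb
      exact ⟨e, Multiset.mem_add.2 (Or.inr he), h⟩
  | @ser E F a m b h h' hd h1 h2 =>
    intro x hx hxb
    by_cases hE : IsEndpoint E x
    · obtain ⟨e, he, h⟩ := h1 x hE hxb
      exact ⟨e, Multiset.mem_add.2 (Or.inl he), h⟩
    · have hF := (isEndpoint_add.1 hx).resolve_left hE
      obtain ⟨e, he, h⟩ := h2 x hF (fun hm => hE (hm ▸ h.isEndpoint_target))
      exact ⟨e, Multiset.mem_add.2 (Or.inr he), h⟩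

/-- Renaming the vertices. -/
lemma map (h : TTSP E a b) : ∀ f : ℕ → ℕ,
    (∀ x y, IsEndpoint E x → IsEndpoint E y → f x = f y → x = y) →
    TTSP (E.map fun e => (f e.1, f e.2)) (f a) (f b) := by
  have key : ∀ (E : Multiset (ℕ × ℕ)) (f : ℕ → ℕ) x,
      IsEndpoint (E.map fun e => (f e.1, f e.2)) x → ∃ y, IsEndpoint E y ∧ f y = x := by
    rintro E f x ⟨e, he, hx⟩
    obtain ⟨e', he', rfl⟩ := Multiset.mem_map.1 he
    rcases hx with hx | hx
    exacts [⟨_, isEndpoint_fst he', hx⟩, ⟨_, isEndpoint_snd he', hx⟩]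
  induction h with
  | @edge a b h =>
    intro f hf
    simp only [Multiset.map_singleton]
    refine edge fun hab => h (hf _ _ ?_ ?_ hab) <;> simp [IsEndpoint]
  | par h h' hd h1 h2 =>
    intro f hf
    rw [Multiset.map_add]
    refine par (h1 f fun x y hx hy => hf x y (isEndpoint_add.2 (Or.inl hx))
      (isEndpoint_add.2 (Or.inl hy))) (h2 f fun x y hx hy => hf x y
      (isEndpoint_add.2 (Or.inr hx)) (isEndpoint_add.2 (Or.inr hy))) fun x hx hy => ?_
    obtain ⟨u, hu, rfl⟩ := key _ _ _ hx
    obtain ⟨v, hv, huv⟩ := key _ _ _ hy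
    obtain rfl := hf _ _ (isEndpoint_add.2 (Or.inr hv)) (isEndpoint_add.2 (Or.inl hu)) huv
    exact (hd _ hu hv).imp (congrArg f) (congrArg f)
  | ser h h' hd h1 h2 =>
    intro f hf
    rw [Multiset.map_add]
    refine ser (h1 f fun x y hx hy => hf x y (isEndpoint_add.2 (Or.inl hx))
      (isEndpoint_add.2 (Or.inl hy))) (h2 f fun x y hx hy => hf x y
      (isEndpoint_add.2 (Or.inr hx)) (isEndpoint_add.2 (Or.inr hy))) fun x hx hy => ?_
    obtain ⟨u, hu, rfl⟩ := key _ _ _ hx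
    obtain ⟨v, hv, huv⟩ := key _ _ _ hy
    obtain rfl := hf _ _ (isEndpoint_add.2 (Or.inr hv)) (isEndpoint_add.2 (Or.inl hu)) huv
    exact congrArg f (hd _ hu hv)

/-- In a series composition an arc from source to target would make a terminal equal to the
junction. So such an arc is either everything or a parallel branch somewhere, and a branch that
consists of it alone can be dropped. -/
lemma eq_singleton_or_erase (h : TTSP E a b) :
    (a, b) ∈ E → E = {(a, b)} ∨ TTSP (E.erase (a, b)) a b := by
  induction h with
  | edge h => simp
  | @par E F a b h h' hd h1 h2 =>
    intro he
    right
    rcases Multiset.mem_add.1 he with he | he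
    · rw [Multiset.erase_add_left_pos _ he]
      rcases h1 he with rfl | h3
      · simpa using h'
      · exact par h3 h' fun x hx => hd x (hx.mono (Multiset.erase_le _ _))
    · rw [Multiset.erase_add_right_pos _ he]
      rcases h2 he with rfl | h3
      · simpa using h
      · exact par h h3 fun x hx hy => hd x hx (hy.mono (Multiset.erase_le _ _))
  | ser h h' hd h1 h2 =>
    intro he
    exfalso
    rcases Multiset.mem_add.1 he with he | he
    · exact h'.ne (hd _ (isEndpoint_snd he) h'.isEndpoint_target).symm
    · exact h.ne (hd _ h.isEndpoint_source (isEndpoint_fst he))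

/-- Merging two parallel arcs. -/
lemma erase_of_two_le_count (h : TTSP E a b) : ∀ e, 2 ≤ E.count e → TTSP (E.erase e) a b := by
  induction h with
  | edge h =>
    intro e he
    have := he.trans (Multiset.count_le_card e _)
    rw [Multiset.card_singleton] at this
    omega
  | @par E F a b h h' hd h1 h2 =>
    intro e he
    rw [Multiset.count_add] at he
    by_cases hE : 2 ≤ E.count e
    · rw [Multiset.erase_add_left_pos _ (Multiset.count_pos.1 (by omega))]
      exact par (h1 e hE) h' fun x hx => hd x (hx.mono (Multiset.erase_le _ _))
    by_cases hF : 2 ≤ F.count e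
    · rw [Multiset.erase_add_right_pos _ (Multiset.count_pos.1 (by omega))]
      exact par h (h2 e hF) fun x hx hy => hd x hx (hy.mono (Multiset.erase_le _ _))
    -- Each part now holds exactly one copy, so both ends of `e` are shared by the parts. This
    -- forces `e = (a, b)`, and the previous lemma applies.
    have heE : e ∈ E := Multiset.count_pos.1 (by omega)
    have heF : e ∈ F := Multiset.count_pos.1 (by omega)
    have ha := (hd _ (isEndpoint_fst heE) (isEndpoint_fst heF)).resolve_right
      (h.fst_ne_target e heE)
    have hb := (hd _ (isEndpoint_snd heE) (isEndpoint_snd heF)).resolve_left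
      (h.snd_ne_source e heE)
    obtain rfl : e = (a, b) := Prod.ext ha hb
    exact ((par h h' hd).eq_singleton_or_erase (Multiset.mem_add.2 (Or.inl heE))).resolve_left
      fun hs => by
        have := congrArg (Multiset.count (a, b)) hs
        rw [Multiset.count_add, Multiset.count_singleton_self] at this
        omega
  | @ser E F a m b h h' hd h1 h2 =>
    intro e he
    rw [Multiset.count_add] at he
    by_cases hE : 2 ≤ E.count e
    · rw [Multiset.erase_add_left_pos _ (Multiset.count_pos.1 (by omega))]
      exact ser (h1 e hE) h' fun x hx => hd x (hx.mono (Multiset.erase_le _ _))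
    by_cases hF : 2 ≤ F.count e
    · rw [Multiset.erase_add_right_pos _ (Multiset.count_pos.1 (by omega))]
      exact ser h (h2 e hF) fun x hx hy => hd x hx (hy.mono (Multiset.erase_le _ _))
    have heE : e ∈ E := Multiset.count_pos.1 (by omega)
    have heF : e ∈ F := Multiset.count_pos.1 (by omega)
    -- Both ends of a common arc would equal the junction, and there are no loops.
    exact absurd ((hd _ (isEndpoint_fst heE) (isEndpoint_fst heF)).trans
      (hd _ (isEndpoint_snd heE) (isEndpoint_snd heF)).symm) (h.fst_ne_snd e heE)

/-- Removing the only arc into the target. -/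
lemma of_cons_target (h : TTSP E a b) : ∀ u R, E = (u, b) ::ₘ R → (∀ e ∈ R, e.2 ≠ b) →
    (R = 0 ∧ u = a) ∨ TTSP R a u := by
  induction h with
  | edge h =>
    intro u R hE hR
    rw [Multiset.singleton_eq_cons_iff] at hE
    exact Or.inl ⟨hE.2, (congrArg Prod.fst hE.1).symm⟩
  | @par E F a b h h' hd h1 h2 =>
    intro u R hE hR
    -- Both branches of a parallel composition contribute an arc into the target, but there is only
    -- one.
    exfalso
    obtain ⟨e, he, hb⟩ := h.exists_out_in.2
    obtain ⟨f, hf, hb'⟩ := h'.exists_out_in.2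
    have h3 : indeg (E + F) b = indeg ((u, b) ::ₘ R) b := by rw [hE]
    have h4 : indeg R b = 0 := Multiset.countP_eq_zero.2 hR
    have h5 := hb ▸ indeg_pos he
    have h6 := hb' ▸ indeg_pos hf
    have h7 : indeg ((u, b) ::ₘ R) b = indeg R b + 1 := Multiset.countP_cons_of_pos _ rfl
    rw [indeg_add] at h3
    omega
  | @ser E F a m b h h' hd h1 h2 =>
    intro u R hE hR
    right
    have hu : (u, b) ∈ E + F := hE ▸ Multiset.mem_cons_self _ _
    have huF : (u, b) ∈ F := (Multiset.mem_add.1 hu).resolve_left fun hu =>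
      h'.ne (hd _ (isEndpoint_snd hu) h'.isEndpoint_target).symm
    obtain ⟨R', rfl⟩ := Multiset.exists_cons_of_mem huF
    rw [Multiset.add_cons, Multiset.cons_inj_right] at hE
    subst hE
    rcases h2 u R' rfl fun e he => hR e (Multiset.mem_add.2 (Or.inr he)) with ⟨rfl, rfl⟩ | h3
    -- The second part is the single arc from the junction to the target; what remains is the first
    -- part.
    · simpa using h
    · exact ser h h3 fun x hx hy => hd x hx (hy.mono (Multiset.le_cons_self _ _))

/-- Contracting a vertex with one entering and one leaving arc. -/
lemma contract (h : TTSP E a b) : ∀ u x v R, E = (u, x) ::ₘ (x, v) ::ₘ R → ¬ IsEndpoint R x →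
    x ≠ a → x ≠ b → TTSP ((u, v) ::ₘ R) a b := by
  induction h with
  | edge h =>
    intro u x v R hE
    rw [Multiset.singleton_eq_cons_iff] at hE
    exact absurd hE.2 Multiset.cons_ne_zero
  | @par E F a b h h' hd h1 h2 =>
    intro u x v R hE hR hxa hxb
    -- The contracted vertex is no terminal, so it lies in only one branch. The claim is made for
    -- general `E` and `F` in order to serve both branches.
    have key : ∀ {E F : Multiset (ℕ × ℕ)}, TTSP E a b → TTSP F a b →
        (∀ u x v R, E = (u, x) ::ₘ (x, v) ::ₘ R → ¬ IsEndpoint R x →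
          x ≠ a → x ≠ b → TTSP ((u, v) ::ₘ R) a b) →
        (∀ x, IsEndpoint E x → IsEndpoint F x → x = a ∨ x = b) →
        E + F = (u, x) ::ₘ (x, v) ::ₘ R → IsEndpoint E x → TTSP ((u, v) ::ₘ R) a b := by
      intro E F h h' h1 hd hE hx
      have hxF : ¬ IsEndpoint F x := fun hF => (hd x hx hF).elim hxa hxb
      have hu : (u, x) ∈ E := (Multiset.mem_add.1 (hE ▸ Multiset.mem_cons_self _ _ :
        (u, x) ∈ E + F)).resolve_right fun h => hxF (isEndpoint_snd h)
      have hv : (x, v) ∈ E := (Multiset.mem_add.1 (hE ▸ Multiset.mem_cons_of_mem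
        (Multiset.mem_cons_self _ _) : (x, v) ∈ E + F)).resolve_right
        fun h => hxF (isEndpoint_fst h)
      have hux := h.fst_ne_snd _ hu
      obtain ⟨E', rfl⟩ := Multiset.exists_cons_of_mem hu
      have hv' : (x, v) ∈ E' := (Multiset.mem_cons.1 hv).resolve_left fun h =>
        hux (congrArg Prod.fst h).symm
      obtain ⟨E', rfl⟩ := Multiset.exists_cons_of_mem hv'
      rw [Multiset.cons_add, Multiset.cons_add, Multiset.cons_inj_right,
        Multiset.cons_inj_right] at hE
      subst hE
      rw [← Multiset.cons_add]
      refine par (h1 u x v E' rfl (fun h => hR (isEndpoint_add.2 (Or.inl h))) hxa hxb) h' ?_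
      intro y hy
      refine hd y ?_
      rcases isEndpoint_cons.1 hy with (hy | hy) | hy
      · exact ⟨_, hu, Or.inl hy⟩
      · exact ⟨_, hv, Or.inr hy⟩
      · exact isEndpoint_cons.2 (Or.inr (isEndpoint_cons.2 (Or.inr hy)))
    have hx : IsEndpoint (E + F) x := hE ▸ isEndpoint_snd (Multiset.mem_cons_self (u, x) _)
    rcases isEndpoint_add.1 hx with hx | hx
    · exact key h h' h1 hd hE hx
    · exact key h' h h2 (fun y hy hy' => hd y hy' hy) (by rw [add_comm, hE]) hx
  | @ser E F a m b h h' hd h1 h2 =>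
    intro u x v R hE hR hxa hxb
    have hu : (u, x) ∈ E + F := hE ▸ Multiset.mem_cons_self _ _
    have hv : (x, v) ∈ E + F := hE ▸ Multiset.mem_cons_of_mem (Multiset.mem_cons_self _ _)
    have hux : u ≠ x := (ser h h' hd).fst_ne_snd _ hu
    have hxv : x ≠ v := (ser h h' hd).fst_ne_snd _ hv
    by_cases hxm : x = m
    -- When the junction itself is contracted, `(u, x)` is the only arc into the target of the first
    -- part. Without it the first part ends in `u`, and the second part is made to start in `u`
    -- instead of `x`.
    · subst hxm
      have hu : (u, x) ∈ E := (Multiset.mem_add.1 hu).resolve_right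
        fun hF => h'.snd_ne_source _ hF rfl
      have hvF : (x, v) ∈ F := (Multiset.mem_add.1 hv).resolve_left
        fun hE => h.fst_ne_target _ hE rfl
      have huF : ¬ IsEndpoint F u := fun hF => hux (hd u (isEndpoint_fst hu) hF)
      obtain ⟨E, rfl⟩ := Multiset.exists_cons_of_mem hu
      obtain ⟨F, rfl⟩ := Multiset.exists_cons_of_mem hvF
      rw [Multiset.cons_add, Multiset.add_cons, Multiset.cons_inj_right,
        Multiset.cons_inj_right] at hE
      subst hE
      have hEx : ¬ IsEndpoint E x := fun h => hR (isEndpoint_add.2 (Or.inl h))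
      have hFx : ¬ IsEndpoint F x := fun h => hR (isEndpoint_add.2 (Or.inr h))
      -- The renaming of `x` to `u` is injective on the second part because `u` does not occur
      -- there.
      have hren : TTSP ((u, v) ::ₘ F) u b := by
        have h3 := h'.map (fun y => if y = x then u else y) (by
          intro y z hy hz hyz
          split_ifs at hyz with h3 h4 h4
          · rw [h3, h4]
          · exact absurd (hyz ▸ hz) huF
          · exact absurd (hyz ▸ hy) huF
          · exact hyz)
        rw [Multiset.map_cons] at h3
        simp only [if_true, if_neg hxv.symm, if_neg hxb.symm] at h3
        convert h3 using 2
        rw [Multiset.map_congr rfl (g := id), Multiset.map_id]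
        intro e he
        have h4 : e.1 ≠ x := fun h => hFx ⟨e, he, Or.inl h⟩
        have h5 : e.2 ≠ x := fun h => hFx ⟨e, he, Or.inr h⟩
        simp [h4, h5]
      rcases h.of_cons_target u E rfl fun e he hx => hEx ⟨e, he, Or.inr hx⟩ with ⟨rfl, rfl⟩ | h3
      · simpa using hren
      · rw [← Multiset.add_cons]
        refine ser h3 hren fun y hy hy' => ?_
        rcases isEndpoint_cons.1 hy' with (hy' | hy') | hy'
        · exact hy'.symm
        · have := hd y (isEndpoint_cons.2 (Or.inr hy)) (isEndpoint_cons.2 (Or.inl (Or.inr hy')))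
          exact absurd (this ▸ hy) hEx
        · have := hd y (isEndpoint_cons.2 (Or.inr hy)) (isEndpoint_cons.2 (Or.inr hy'))
          exact absurd (this ▸ hy) hEx
    · by_cases hxE : IsEndpoint E x
      · have hxF : ¬ IsEndpoint F x := fun hF => hxm (hd x hxE hF)
        have hu := (Multiset.mem_add.1 hu).resolve_right fun h => hxF (isEndpoint_snd h)
        have hv := (Multiset.mem_add.1 hv).resolve_right fun h => hxF (isEndpoint_fst h)
        obtain ⟨E', rfl⟩ := Multiset.exists_cons_of_mem hu
        have hv' : (x, v) ∈ E' := (Multiset.mem_cons.1 hv).resolve_left fun h =>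
          hux (congrArg Prod.fst h).symm
        obtain ⟨E', rfl⟩ := Multiset.exists_cons_of_mem hv'
        rw [Multiset.cons_add, Multiset.cons_add, Multiset.cons_inj_right,
          Multiset.cons_inj_right] at hE
        subst hE
        rw [← Multiset.cons_add]
        refine ser (h1 u x v E' rfl (fun h => hR (isEndpoint_add.2 (Or.inl h))) hxa hxm) h' ?_
        intro y hy
        refine hd y ?_
        rcases isEndpoint_cons.1 hy with (hy | hy) | hy
        · exact ⟨_, hu, Or.inl hy⟩
        · exact ⟨_, hv, Or.inr hy⟩
        · exact isEndpoint_cons.2 (Or.inr (isEndpoint_cons.2 (Or.inr hy)))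
      · have hu := (Multiset.mem_add.1 hu).resolve_left fun h => hxE (isEndpoint_snd h)
        have hv := (Multiset.mem_add.1 hv).resolve_left fun h => hxE (isEndpoint_fst h)
        obtain ⟨F', rfl⟩ := Multiset.exists_cons_of_mem hu
        have hv' : (x, v) ∈ F' := (Multiset.mem_cons.1 hv).resolve_left fun h =>
          hux (congrArg Prod.fst h).symm
        obtain ⟨F', rfl⟩ := Multiset.exists_cons_of_mem hv'
        rw [Multiset.add_cons, Multiset.add_cons, Multiset.cons_inj_right,
          Multiset.cons_inj_right] at hE
        subst hE
        rw [← Multiset.add_cons]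
        refine ser h (h2 u x v F' rfl (fun h => hR (isEndpoint_add.2 (Or.inr h))) hxm hxb) ?_
        intro y hy hy'
        refine hd y hy ?_
        rcases isEndpoint_cons.1 hy' with (hy' | hy') | hy'
        · exact ⟨_, hu, Or.inl hy'⟩
        · exact ⟨_, hv, Or.inr hy'⟩
        · exact isEndpoint_cons.2 (Or.inr (isEndpoint_cons.2 (Or.inr hy')))

/-- If the arc could be erased, the remaining multidigraph would need a second arc leaving the
source. -/
lemma eq_singleton_of_outdeg_le_one (h : TTSP E a b) (ha : outdeg E a ≤ 1) (he : (a, b) ∈ E) :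
    E = {(a, b)} := by
  refine (h.eq_singleton_or_erase he).resolve_right fun h3 => ?_
  obtain ⟨f, hf, hfa⟩ := h3.exists_out_in.1
  have h4 := hfa ▸ outdeg_pos hf
  have h5 : outdeg E a = outdeg (E.erase (a, b)) a + 1 := by
    conv_lhs => rw [← Multiset.cons_erase he]
    exact Multiset.countP_cons_of_pos _ rfl
  omega

/-- A parallel composition has two arcs out of its source, so only series compositions occur, and
the source arc stays in the first part. The descent ends when the first part is a single arc into
the junction, which no arc of the second part enters. -/
lemma indeg_eq_one_of_outdeg_le_one (h : TTSP E a b) : outdeg E a ≤ 1 → ∀ x, (a, x) ∈ E → x ≠ b →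
    indeg E x = 1 := by
  induction h with
  | edge h =>
    intro _ x hx hxb
    exact absurd (congrArg Prod.snd (Multiset.mem_singleton.1 hx)) hxb
  | par h h' hd h1 h2 =>
    intro ha
    exfalso
    obtain ⟨e, he, hea⟩ := h.exists_out_in.1
    obtain ⟨f, hf, hfa⟩ := h'.exists_out_in.1
    have h5 := hea ▸ outdeg_pos he
    have h6 := hfa ▸ outdeg_pos hf
    rw [outdeg_add] at ha
    omega
  | @ser E F a m b h h' hd h1 h2 =>
    intro ha x hx hxb
    have haF : ¬ IsEndpoint F a := fun hF => h.ne (hd a h.isEndpoint_source hF)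
    rw [outdeg_add, outdeg_eq_zero haF] at ha
    have hx := (Multiset.mem_add.1 hx).resolve_right fun hF => haF (isEndpoint_fst hF)
    have hF0 : indeg F x = 0 := Multiset.countP_eq_zero.2 fun e he hex =>
      h'.snd_ne_source e he (hex.trans (hd x (isEndpoint_snd hx) (hex ▸ isEndpoint_snd he)))
    rw [indeg_add, hF0, add_zero]
    by_cases hxm : x = m
    · subst hxm
      rw [h.eq_singleton_of_outdeg_le_one ha hx]
      simp [indeg, ← Multiset.cons_zero]
    · exact h1 ha x hx hxm

/-- A vertex whose out-neighbours other than the target have outdegree one and indegree at least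
two, and which is not the tail of parallel arcs, has at most one out-neighbour. -/
lemma outdeg_le_one (h : TTSP E a b) : ∀ y,
    (∀ e ∈ E, e.1 = y → E.count e ≤ 1 ∧ (e.2 ≠ b → 2 ≤ indeg E e.2)) →
    outdeg E y ≤ 1 := by
  induction h with
  | edge h =>
    intro y _
    exact Multiset.countP_le_card _ _
  | @par E F a b h h' hd h1 h2 =>
    intro y hy
    have key : ∀ {E F : Multiset (ℕ × ℕ)}, TTSP E a b → TTSP F a b →
        (∀ x, IsEndpoint E x → IsEndpoint F x → x = a ∨ x = b) →
        (∀ e ∈ E + F, e.1 = y → (E + F).count e ≤ 1 ∧ (e.2 ≠ b → 2 ≤ indeg (E + F) e.2)) →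
        ∀ e ∈ E, e.1 = y → E.count e ≤ 1 ∧ (e.2 ≠ b → 2 ≤ indeg E e.2) := by
      intro E F h h' hd hy e he hey
      obtain ⟨h3, h4⟩ := hy e (Multiset.mem_add.2 (Or.inl he)) hey
      rw [Multiset.count_add] at h3
      refine ⟨by omega, fun hb => ?_⟩
      have h5 := h4 hb
      have : ¬ IsEndpoint F e.2 := fun hF =>
        (hd _ (isEndpoint_snd he) hF).elim (h.snd_ne_source e he) hb
      rwa [indeg_add, indeg_eq_zero this, add_zero] at h5
    have hE := key h h' hd hy
    have hF := key h' h (fun x hx hx' => hd x hx' hx) (by rwa [add_comm])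
    have hE1 := h1 y hE
    have hF1 := h2 y hF
    rw [outdeg_add]
    -- If both branches have an arc out of `y`, then `y` is the common source and has exactly one
    -- arc in each branch. The head of that arc has indegree one unless it is `b`, so both arcs are
    -- `(a, b)`, against the bound on multiplicities.
    by_contra hlt
    obtain ⟨e, he, hey⟩ := Multiset.countP_pos.1 (show 0 < outdeg E y by omega)
    obtain ⟨f, hf, hfy⟩ := Multiset.countP_pos.1 (show 0 < outdeg F y by omega)
    obtain rfl : y = a := (hd y (hey ▸ isEndpoint_fst he) (hfy ▸ isEndpoint_fst hf)).resolve_right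
      fun hb => h.fst_ne_target e he (hey.trans hb)
    have heb : e.2 = b := by
      by_contra hb
      have h3 := h.indeg_eq_one_of_outdeg_le_one hE1 e.2 (by rw [← hey]; exact he) hb
      have h4 := (hE e he hey).2 hb
      omega
    have hfb : f.2 = b := by
      by_contra hb
      have h3 := h'.indeg_eq_one_of_outdeg_le_one hF1 f.2 (by rw [← hfy]; exact hf) hb
      have h4 := (hF f hf hfy).2 hb
      omega
    obtain rfl : e = f := Prod.ext (hey.trans hfy.symm) (heb.trans hfb.symm)
    have h3 := (hy e (Multiset.mem_add.2 (Or.inl he)) hey).1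
    rw [Multiset.count_add] at h3
    have h4 := Multiset.count_pos.2 he
    have h5 := Multiset.count_pos.2 hf
    omega
  | @ser E F a m b h h' hd h1 h2 =>
    intro y hy
    by_cases hyE : ∃ e ∈ E, e.1 = y
    · obtain ⟨e0, he0, he0y⟩ := hyE
      have hyF : ¬ IsEndpoint F y := fun hF =>
        h.fst_ne_target e0 he0 (he0y.trans (hd y (he0y ▸ isEndpoint_fst he0) hF))
      rw [outdeg_add, outdeg_eq_zero hyF, add_zero]
      refine h1 y fun e he hey => ?_
      obtain ⟨h3, h4⟩ := hy e (Multiset.mem_add.2 (Or.inl he)) hey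
      rw [Multiset.count_add] at h3
      refine ⟨by omega, fun hm => ?_⟩
      have hF : ¬ IsEndpoint F e.2 := fun hF => hm (hd _ (isEndpoint_snd he) hF)
      have h5 := h4 fun hb => hF (hb ▸ h'.isEndpoint_target)
      rwa [indeg_add, indeg_eq_zero hF, add_zero] at h5
    · have hE0 : outdeg E y = 0 := Multiset.countP_eq_zero.2 fun e he hey => hyE ⟨e, he, hey⟩
      rw [outdeg_add, hE0, zero_add]
      refine h2 y fun e he hey => ?_
      obtain ⟨h3, h4⟩ := hy e (Multiset.mem_add.2 (Or.inr he)) hey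
      rw [Multiset.count_add] at h3
      refine ⟨by omega, fun hb => ?_⟩
      have hE : ¬ IsEndpoint E e.2 := fun hE =>
        h'.snd_ne_source e he (hd _ hE (isEndpoint_snd he))
      have h5 := h4 hb
      rwa [indeg_add, indeg_eq_zero hE, zero_add] at h5

end TTSP

/-! ### Minimal series-parallel digraphs are line digraphs of series-parallel multidigraphs -/

namespace FinDigraph

variable {V : Type*} [DecidableEq V]

/-- Acyclicity in a form that serves as an induction measure for showing that the topological sort
reaches all items. -/
lemma IsMSP.exists_rank {G : FinDigraph V} (h : G.IsMSP) :
    ∃ r : V → ℕ, ∀ u v, (u, v) ∈ G.arcs → r u < r v := by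
  induction h with
  | single v => exact ⟨fun _ => 0, by simp [FinDigraph.single]⟩
  | parallel G H hd _ _ h1 h2 =>
    obtain ⟨r, hr⟩ := h1
    obtain ⟨s, hs⟩ := h2
    refine ⟨fun v => if v ∈ G.verts then r v else s v, fun u v huv => ?_⟩
    rcases Finset.mem_union.1 huv with h | h
    · obtain ⟨hu, hv⟩ := G.mem_verts _ h
      simpa [hu, hv] using hr u v h
    · obtain ⟨hu, hv⟩ := H.mem_verts _ h
      have hu' := Finset.disjoint_right.1 hd hu
      have hv' := Finset.disjoint_right.1 hd hv
      simpa [hu', hv'] using hs u v h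
  | series G H hd _ _ h1 h2 =>
    obtain ⟨r, hr⟩ := h1
    obtain ⟨s, hs⟩ := h2
    -- The second part is lifted above all ranks of the first one.
    refine ⟨fun v => if v ∈ G.verts then r v else s v + G.verts.sup r + 1, fun u v huv => ?_⟩
    rcases Finset.mem_union.1 huv with h | h
    · rcases Finset.mem_union.1 h with h | h
      · obtain ⟨hu, hv⟩ := G.mem_verts _ h
        simpa [hu, hv] using hr u v h
      · obtain ⟨hu, hv⟩ := H.mem_verts _ h
        have hu' := Finset.disjoint_right.1 hd hu
        have hv' := Finset.disjoint_right.1 hd hv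
        simpa [hu', hv'] using hs u v h
    · obtain ⟨hu, hv⟩ := Finset.mem_product.1 h
      have hu := (Finset.mem_filter.1 hu).1
      have hv := Finset.disjoint_right.1 hd (Finset.mem_filter.1 hv).1
      have := Finset.le_sup (f := r) hu
      simp only [hu, hv, if_true, if_false] at this ⊢
      omega

/-- The vertices of `G` are the arcs of a two-terminal series-parallel multidigraph with source `a`
and target `b` in which the vertex `v` of `G` leads from `tl v` to `hd v`, and `G` is the line
digraph of this multidigraph. -/
structure IsLineOf (G : FinDigraph V) (tl hd : V → ℕ) (a b : ℕ) : Prop where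
  ttsp : TTSP (G.verts.val.map fun v => (tl v, hd v)) a b
  mem_arcs : ∀ u ∈ G.verts, ∀ v ∈ G.verts, (u, v) ∈ G.arcs ↔ hd u = tl v

namespace IsLineOf

variable {G H : FinDigraph V} {tl hd : V → ℕ} {a b : ℕ}

omit [DecidableEq V] in
lemma isEndpoint_iff {x : ℕ} : IsEndpoint (G.verts.val.map fun v => (tl v, hd v)) x ↔
    ∃ v ∈ G.verts, tl v = x ∨ hd v = x := by
  simp [IsEndpoint]

/-- Every vertex of the multidigraph except the target is left by some arc, and the target by none.
With `mem_sources` this identifies the new arcs of a series composition as the pairs meeting at the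
junction. -/
lemma mem_sinks (h : G.IsLineOf tl hd a b) {v : V} (hv : v ∈ G.verts) :
    v ∈ G.sinks ↔ hd v = b := by
  simp only [sinks, Finset.mem_filter, hv, true_and]
  constructor
  · intro hs
    by_contra hb
    obtain ⟨e, he, hev⟩ := h.ttsp.exists_out (hd v) (IsLineOf.isEndpoint_iff.2 ⟨v, hv, Or.inr rfl⟩) hb
    obtain ⟨w, hw, rfl⟩ := Multiset.mem_map.1 he
    exact hs (v, w) ((h.mem_arcs v hv w hw).2 hev.symm) rfl
  · rintro hb ⟨u, w⟩ huw rfl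
    have hw := (G.mem_verts _ huw).2
    exact h.ttsp.fst_ne_target _ (Multiset.mem_map_of_mem _ hw)
      (((h.mem_arcs u hv w hw).1 huw).symm.trans hb)

lemma mem_sources (h : G.IsLineOf tl hd a b) {v : V} (hv : v ∈ G.verts) :
    v ∈ G.sources ↔ tl v = a := by
  simp only [sources, Finset.mem_filter, hv, true_and]
  constructor
  · intro hs
    by_contra hb
    obtain ⟨e, he, hev⟩ := h.ttsp.exists_in (tl v) (IsLineOf.isEndpoint_iff.2 ⟨v, hv, Or.inl rfl⟩) hb
    obtain ⟨w, hw, rfl⟩ := Multiset.mem_map.1 he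
    exact hs (w, v) ((h.mem_arcs w hw v hv).2 hev) rfl
  · rintro hb ⟨u, w⟩ huw rfl
    have hu := (G.mem_verts _ huw).1
    exact h.ttsp.snd_ne_source _ (Multiset.mem_map_of_mem _ hu)
      (((h.mem_arcs u hu w hv).1 huw).trans hb)

omit [DecidableEq V] in
lemma map (h : G.IsLineOf tl hd a b) {f : ℕ → ℕ} (hf : f.Injective) :
    G.IsLineOf (f ∘ tl) (f ∘ hd) (f a) (f b) where
  ttsp := by
    have := h.ttsp.map f fun x y _ _ hxy => hf hxy
    rwa [Multiset.map_map] at this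
  mem_arcs u hu v hv := (h.mem_arcs u hu v hv).trans hf.eq_iff.symm

end IsLineOf

lemma map_union_ite {α : Type*} {A B : Finset V} (hd : Disjoint A B) (f g : V → α) :
    (A ∪ B).val.map (fun v => if v ∈ A then f v else g v) = A.val.map f + B.val.map g := by
  rw [← Finset.disjUnion_eq_union A B hd, Finset.disjUnion_val, Multiset.map_add]
  congr 1
  · exact Multiset.map_congr rfl fun v hv => if_pos hv
  · exact Multiset.map_congr rfl fun v hv => if_neg (Finset.disjoint_right.1 hd hv)

/-- No adjacency arises between the two parts: they share only `a` and `b`, and no item has head `a`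
or tail `b`. -/
lemma IsLineOf.parallel {G H : FinDigraph V} (hd : Disjoint G.verts H.verts)
    {t1 d1 t2 d2 : V → ℕ} {a b : ℕ} (h1 : G.IsLineOf t1 d1 a b) (h2 : H.IsLineOf t2 d2 a b)
    (hcross : ∀ x, IsEndpoint (G.verts.val.map fun v => (t1 v, d1 v)) x →
      IsEndpoint (H.verts.val.map fun v => (t2 v, d2 v)) x → x = a ∨ x = b) :
    (G.parallel H).IsLineOf (fun v => if v ∈ G.verts then t1 v else t2 v)
      (fun v => if v ∈ G.verts then d1 v else d2 v) a b where
  ttsp := by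
    have h3 := TTSP.par h1.ttsp h2.ttsp hcross
    rw [← map_union_ite hd] at h3
    refine (congrArg (TTSP · a b) (Multiset.map_congr rfl fun v _ => ?_)).mp h3
    split_ifs <;> rfl
  mem_arcs := by
    have key : ∀ u v, (u, v) ∈ (G.parallel H).arcs ↔ (u, v) ∈ G.arcs ∨ (u, v) ∈ H.arcs := by
      intro u v
      exact Finset.mem_union
    intro u hu v hv
    rw [key]
    rcases Finset.mem_union.1 hu with hu | hu <;> rcases Finset.mem_union.1 hv with hv | hv
    · have h3 : (u, v) ∉ H.arcs := fun h => Finset.disjoint_left.1 hd hu (H.mem_verts _ h).1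
      simp only [hu, hv, if_true, h3, or_false]
      exact h1.mem_arcs u hu v hv
    · have hv' := Finset.disjoint_right.1 hd hv
      have h3 : (u, v) ∉ H.arcs := fun h => Finset.disjoint_left.1 hd hu (H.mem_verts _ h).1
      have h4 : (u, v) ∉ G.arcs := fun h => hv' (G.mem_verts _ h).2
      simp only [hu, hv', if_true, if_false, h3, h4, or_false, false_iff]
      intro h
      rcases hcross (d1 u) (IsLineOf.isEndpoint_iff.2 ⟨u, hu, Or.inr rfl⟩)
        (IsLineOf.isEndpoint_iff.2 ⟨v, hv, Or.inl h.symm⟩) with h5 | h5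
      · exact h1.ttsp.snd_ne_source _ (Multiset.mem_map_of_mem _ hu) h5
      · exact h2.ttsp.fst_ne_target _ (Multiset.mem_map_of_mem _ hv) (h.symm.trans h5)
    · have hu' := Finset.disjoint_right.1 hd hu
      have h3 : (u, v) ∉ H.arcs := fun h => Finset.disjoint_left.1 hd hv (H.mem_verts _ h).2
      have h4 : (u, v) ∉ G.arcs := fun h => hu' (G.mem_verts _ h).1
      simp only [hu', hv, if_true, if_false, h3, h4, or_false, false_iff]
      intro h
      rcases hcross (t1 v) (IsLineOf.isEndpoint_iff.2 ⟨v, hv, Or.inl rfl⟩)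
        (IsLineOf.isEndpoint_iff.2 ⟨u, hu, Or.inr h⟩) with h5 | h5
      · exact h2.ttsp.snd_ne_source _ (Multiset.mem_map_of_mem _ hu) (h.trans h5)
      · exact h1.ttsp.fst_ne_target _ (Multiset.mem_map_of_mem _ hv) h5
    · have hu' := Finset.disjoint_right.1 hd hu
      have hv' := Finset.disjoint_right.1 hd hv
      have h3 : (u, v) ∉ G.arcs := fun h => hu' (G.mem_verts _ h).1
      simp only [hu', hv', if_false, h3, false_or]
      exact h2.mem_arcs u hu v hv

/-- The parts meet only in `m`, where the heads of the sinks of the first part coincide with the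
tails of the sources of the second one. In the other direction nothing meets, as no item of the
first part has tail `m`. -/
lemma IsLineOf.series {G H : FinDigraph V} (hd : Disjoint G.verts H.verts)
    {t1 d1 t2 d2 : V → ℕ} {a m b : ℕ} (h1 : G.IsLineOf t1 d1 a m) (h2 : H.IsLineOf t2 d2 m b)
    (hcross : ∀ x, IsEndpoint (G.verts.val.map fun v => (t1 v, d1 v)) x →
      IsEndpoint (H.verts.val.map fun v => (t2 v, d2 v)) x → x = m) :
    (G.series H hd).IsLineOf (fun v => if v ∈ G.verts then t1 v else t2 v)
      (fun v => if v ∈ G.verts then d1 v else d2 v) a b where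
  ttsp := by
    have h3 := TTSP.ser h1.ttsp h2.ttsp hcross
    rw [← map_union_ite hd] at h3
    refine (congrArg (TTSP · a b) (Multiset.map_congr rfl fun v _ => ?_)).mp h3
    split_ifs <;> rfl
  mem_arcs := by
    have key : ∀ u v, (u, v) ∈ (G.series H hd).arcs ↔
        ((u, v) ∈ G.arcs ∨ (u, v) ∈ H.arcs) ∨ u ∈ G.sinks ∧ v ∈ H.sources := by
      intro u v
      simp [FinDigraph.series, or_assoc]
    intro u hu v hv
    rw [key]
    rcases Finset.mem_union.1 hu with hu | hu <;> rcases Finset.mem_union.1 hv with hv | hv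
    · have h3 : (u, v) ∉ H.arcs := fun h => Finset.disjoint_left.1 hd hu (H.mem_verts _ h).1
      have h4 : v ∉ H.sources := fun h =>
        Finset.disjoint_left.1 hd hv (Finset.mem_filter.1 h).1
      simp only [hu, hv, if_true, h3, h4, or_false, and_false]
      exact h1.mem_arcs u hu v hv
    · have hv' := Finset.disjoint_right.1 hd hv
      have h3 : (u, v) ∉ H.arcs := fun h => Finset.disjoint_left.1 hd hu (H.mem_verts _ h).1
      have h4 : (u, v) ∉ G.arcs := fun h => hv' (G.mem_verts _ h).2
      simp only [hu, hv', if_true, if_false, h3, h4, or_false, false_or]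
      rw [h1.mem_sinks hu, h2.mem_sources hv]
      refine ⟨fun h => h.1.trans h.2.symm, fun h => ?_⟩
      have h5 := hcross (d1 u) (IsLineOf.isEndpoint_iff.2 ⟨u, hu, Or.inr rfl⟩)
        (IsLineOf.isEndpoint_iff.2 ⟨v, hv, Or.inl h.symm⟩)
      exact ⟨h5, h.symm.trans h5⟩
    · have hu' := Finset.disjoint_right.1 hd hu
      have h3 : (u, v) ∉ H.arcs := fun h => Finset.disjoint_left.1 hd hv (H.mem_verts _ h).2
      have h4 : (u, v) ∉ G.arcs := fun h => hu' (G.mem_verts _ h).1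
      have h5 : u ∉ G.sinks := fun h => hu' (Finset.mem_filter.1 h).1
      simp only [hu', hv, if_true, if_false, h3, h4, h5, or_false, false_iff, false_and]
      intro h
      exact h1.ttsp.fst_ne_target _ (Multiset.mem_map_of_mem _ hv)
        (hcross (t1 v) (IsLineOf.isEndpoint_iff.2 ⟨v, hv, Or.inl rfl⟩)
        (IsLineOf.isEndpoint_iff.2 ⟨u, hu, Or.inr h⟩))
    · have hu' := Finset.disjoint_right.1 hd hu
      have hv' := Finset.disjoint_right.1 hd hv
      have h3 : (u, v) ∉ G.arcs := fun h => hu' (G.mem_verts _ h).1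
      have h5 : u ∉ G.sinks := fun h => hu' (Finset.mem_filter.1 h).1
      simp only [hu', hv', if_false, h3, h5, false_or, false_and, or_false]
      exact h2.mem_arcs u hu v hv

/-- The multidigraphs of the two parts live on arbitrary numbers. They are first renamed so that
they share exactly the vertices to be identified. -/
lemma IsMSP.exists_isLineOf {G : FinDigraph V} (h : G.IsMSP) :
    ∃ tl hd a b, G.IsLineOf tl hd a b := by
  induction h with
  | single v =>
    refine ⟨fun _ => 0, fun _ => 1, 0, 1, ?_, ?_⟩
    · simpa [FinDigraph.single] using TTSP.edge (zero_ne_one (α := ℕ))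
    · simp [FinDigraph.single]
  | parallel G H hd _ _ h1 h2 =>
    obtain ⟨t1, d1, a1, b1, h1⟩ := h1
    obtain ⟨t2, d2, a2, b2, h2⟩ := h2
    have hab1 := h1.ttsp.ne
    have hab2 := h2.ttsp.ne
    -- The terminals become `0` and `1`; the other vertices become even in the first part and odd in
    -- the second, all at least `2`.
    have h1' := h1.map (f := fun x => if x = a1 then 0 else if x = b1 then 1 else 2 * x + 2) (by
      intro x y hxy
      dsimp only at hxy
      split_ifs at hxy <;> omega)
    have h2' := h2.map (f := fun x => if x = a2 then 0 else if x = b2 then 1 else 2 * x + 3) (by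
      intro x y hxy
      dsimp only at hxy
      split_ifs at hxy <;> omega)
    simp only [if_true, if_neg hab1.symm, if_neg hab2.symm] at h1' h2'
    refine ⟨_, _, _, _, h1'.parallel hd h2' fun x hx hy => ?_⟩
    obtain ⟨v, -, hx⟩ := IsLineOf.isEndpoint_iff.1 hx
    obtain ⟨w, -, hy⟩ := IsLineOf.isEndpoint_iff.1 hy
    simp only [Function.comp_apply] at hx hy
    have hx' : x ≤ 1 ∨ x % 2 = 0 := by
      rcases hx with hx | hx <;> split_ifs at hx <;> omega
    have hy' : x ≤ 1 ∨ x % 2 = 1 := by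
      rcases hy with hy | hy <;> split_ifs at hy <;> omega
    omega
  | series G H hd _ _ h1 h2 =>
    obtain ⟨t1, d1, a1, b1, h1⟩ := h1
    obtain ⟨t2, d2, a2, b2, h2⟩ := h2
    -- The junction becomes `0`; the other vertices become odd in the first part and positive even
    -- in the second.
    have h1' := h1.map (f := fun x => if x = b1 then 0 else 2 * x + 1) (by
      intro x y hxy
      dsimp only at hxy
      split_ifs at hxy <;> omega)
    have h2' := h2.map (f := fun x => if x = a2 then 0 else 2 * x + 2) (by
      intro x y hxy
      dsimp only at hxy
      split_ifs at hxy <;> omega)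
    simp only [if_true] at h1' h2'
    refine ⟨_, _, _, _, h1'.series hd h2' fun x hx hy => ?_⟩
    obtain ⟨v, -, hx⟩ := IsLineOf.isEndpoint_iff.1 hx
    obtain ⟨w, -, hy⟩ := IsLineOf.isEndpoint_iff.1 hy
    simp only [Function.comp_apply] at hx hy
    have hx' : x = 0 ∨ x % 2 = 1 := by
      rcases hx with hx | hx <;> split_ifs at hx <;> omega
    have hy' : x % 2 = 0 := by
      rcases hy with hy | hy <;> split_ifs at hy <;> omega
    omega

end FinDigraph

/-! ### A small language of named variables and arrays on the random access machine -/

set_option linter.constructorNameAsVariable false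

namespace RAM

/-- Program variables. They are kept in registers. -/
inductive Var
  | zero | one | two | n | c | off | arc | t | fresh | k | d | x | y | ct | b | l | r | a | e | g
  | s | kk | j | lim | wr | v | w | p | pe | h | qh | qt
  deriving DecidableEq

/-- Program arrays with one entry per record. -/
inductive Arr
  | indeg | tail | head | queue | cnt | temp | node | tag | left | right | wt | tgt
  deriving DecidableEq

/-- The values of the variables and arrays. The two-dimensional array `tab` has one row per
record. -/
structure Store where
  zero : ℕ
  one : ℕ
  two : ℕ
  n : ℕ
  c : ℕ
  off : ℕ
  arc : ℕ
  t : ℕ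
  fresh : ℕ
  k : ℕ
  d : ℕ
  x : ℕ
  y : ℕ
  ct : ℕ
  b : ℕ
  l : ℕ
  r : ℕ
  a : ℕ
  e : ℕ
  g : ℕ
  s : ℕ
  kk : ℕ
  j : ℕ
  lim : ℕ
  wr : ℕ
  v : ℕ
  w : ℕ
  p : ℕ
  pe : ℕ
  h : ℕ
  qh : ℕ
  qt : ℕ
  indeg : ℕ → ℕ
  tail : ℕ → ℕ
  head : ℕ → ℕ
  queue : ℕ → ℕ
  cnt : ℕ → ℕ
  temp : ℕ → ℕ
  node : ℕ → ℕ
  tag : ℕ → ℕ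
  left : ℕ → ℕ
  right : ℕ → ℕ
  wt : ℕ → ℕ
  tgt : ℕ → ℕ
  tab : ℕ → ℕ → ℕ

namespace Store

def get (s : Store) : Var → ℕ
  | .zero => s.zero | .one => s.one | .two => s.two | .n => s.n | .c => s.c | .off => s.off
  | .arc => s.arc | .t => s.t | .fresh => s.fresh | .k => s.k | .d => s.d | .x => s.x | .y => s.y
  | .ct => s.ct | .b => s.b | .l => s.l | .r => s.r | .a => s.a | .e => s.e | .g => s.g
  | .s => s.s | .kk => s.kk | .j => s.j | .lim => s.lim | .wr => s.wr | .v => s.v | .w => s.w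
  | .p => s.p | .pe => s.pe | .h => s.h | .qh => s.qh | .qt => s.qt

def set (s : Store) (x : Var) (z : ℕ) : Store :=
  match x with
  | .zero => { s with zero := z } | .one => { s with one := z } | .two => { s with two := z }
  | .n => { s with n := z } | .c => { s with c := z } | .off => { s with off := z }
  | .arc => { s with arc := z } | .t => { s with t := z } | .fresh => { s with fresh := z }
  | .k => { s with k := z } | .d => { s with d := z } | .x => { s with x := z }
  | .y => { s with y := z } | .ct => { s with ct := z } | .b => { s with b := z }
  | .l => { s with l := z } | .r => { s with r := z } | .a => { s with a := z }
  | .e => { s with e := z } | .g => { s with g := z } | .s => { s with s := z }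
  | .kk => { s with kk := z } | .j => { s with j := z } | .lim => { s with lim := z }
  | .wr => { s with wr := z } | .v => { s with v := z } | .w => { s with w := z }
  | .p => { s with p := z } | .pe => { s with pe := z } | .h => { s with h := z }
  | .qh => { s with qh := z } | .qt => { s with qt := z }

def arr (s : Store) : Arr → ℕ → ℕ
  | .indeg => s.indeg | .tail => s.tail | .head => s.head | .queue => s.queue | .cnt => s.cnt
  | .temp => s.temp | .node => s.node | .tag => s.tag | .left => s.left | .right => s.right
  | .wt => s.wt | .tgt => s.tgt

def setArr (s : Store) (A : Arr) (f : ℕ → ℕ) : Store :=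
  match A with
  | .indeg => { s with indeg := f } | .tail => { s with tail := f }
  | .head => { s with head := f } | .queue => { s with queue := f }
  | .cnt => { s with cnt := f } | .temp => { s with temp := f }
  | .node => { s with node := f } | .tag => { s with tag := f }
  | .left => { s with left := f } | .right => { s with right := f }
  | .wt => { s with wt := f } | .tgt => { s with tgt := f }

lemma get_set (s : Store) (x y : Var) (z : ℕ) :
    (s.set x z).get y = if y = x then z else s.get y := by
  cases x <;> cases y <;> rfl

lemma arr_set (s : Store) (x : Var) (z : ℕ) : (s.set x z).arr = s.arr := by
  cases x <;> rfl

lemma tab_set (s : Store) (x : Var) (z : ℕ) : (s.set x z).tab = s.tab := by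
  cases x <;> rfl

lemma get_setArr (s : Store) (A : Arr) (f : ℕ → ℕ) : (s.setArr A f).get = s.get := by
  cases A <;> rfl

lemma arr_setArr (s : Store) (A B : Arr) (f : ℕ → ℕ) :
    (s.setArr A f).arr B = if B = A then f else s.arr B := by
  cases A <;> cases B <;> rfl

lemma tab_setArr (s : Store) (A : Arr) (f : ℕ → ℕ) : (s.setArr A f).tab = s.tab := by
  cases A <;> rfl

end Store

/-- The register of a variable. The registers `0` and `1` are scratch registers. -/
def Var.reg (x : Var) : ℕ := x.ctorIdx + 2

lemma Var.reg_injective : Function.Injective Var.reg := by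
  intro x y h
  have h1 : x.ctorIdx = y.ctorIdx := by simpa [Var.reg] using h
  rw [← Var.ofNat_ctorIdx x, h1, Var.ofNat_ctorIdx]

lemma Var.reg_ne_zero (x : Var) : x.reg ≠ 0 := by simp [Var.reg]

lemma Var.reg_ne_one (x : Var) : x.reg ≠ 1 := by simp [Var.reg]

lemma Arr.ctorIdx_injective : Function.Injective Arr.ctorIdx := by
  intro x y h
  rw [← Arr.ofNat_ctorIdx x, h, Arr.ofNat_ctorIdx]

lemma Arr.ctorIdx_lt (A : Arr) : A.ctorIdx < 16 := by
  cases A <;> decide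

/-- The parameters of the memory layout: `N` records of `R` cells each. All variables and array
entries are at most `B`. -/
structure Layout where
  inp : List ℕ
  S : ℕ
  W : ℕ
  N : ℕ
  R : ℕ
  B : ℕ
  le_S : N + N * R ≤ S
  le_W : N + N * R ≤ W
  B_le : B ≤ W
  lt_R : 16 < R
  R_le : R ≤ N * R
  inp_le : ∀ i, inp.getD i 0 ≤ B

namespace Layout

variable (C : Layout)

lemma addr_lt {i f : ℕ} (hi : i < C.N) (hf : f < C.R) : C.N + i * C.R + f < C.N + C.N * C.R := by
  have : (i + 1) * C.R ≤ C.N * C.R := Nat.mul_le_mul_right _ hi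
  rw [add_mul] at this
  omega

/-- Division with remainder by the record length recovers record and field. -/
lemma addr_inj {i f i' f' : ℕ} (hf : f < C.R) (hf' : f' < C.R)
    (h : C.N + i * C.R + f = C.N + i' * C.R + f') : i = i' ∧ f = f' := by
  have h1 : f + i * C.R = f' + i' * C.R := by omega
  have h2 := congrArg (· % C.R) h1
  have h3 := congrArg (· / C.R) h1
  have hR : 0 < C.R := by omega
  simp only [Nat.add_mul_mod_self_right, Nat.mod_eq_of_lt hf, Nat.mod_eq_of_lt hf',
    Nat.add_mul_div_right _ _ hR, Nat.div_eq_of_lt hf, Nat.div_eq_of_lt hf'] at h2 h3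
  omega

/-- The machine state `σ` represents the store `s`. The memory cell `i < N` points to the record
`i`. -/
structure Repr (σ : State) (s : Store) : Prop where
  reg : ∀ x : Var, σ.reg x.reg = s.get x
  ptr : ∀ i < C.N, σ.mem i = C.N + i * C.R
  arr : ∀ i < C.N, ∀ A : Arr, σ.mem (C.N + i * C.R + A.ctorIdx) = s.arr A i
  tab : ∀ i < C.N, ∀ j, 16 + j < C.R → σ.mem (C.N + i * C.R + (16 + j)) = s.tab i j
  get_le : ∀ x, s.get x ≤ C.B
  arr_le : ∀ A i, s.arr A i ≤ C.B
  tab_le : ∀ i j, s.tab i j ≤ C.B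

/-- From every machine state that represents `s`, the program `p` terminates after a number of
steps and in a store which satisfy `Q`. -/
def wp (p : Prog) (s : Store) (Q : ℕ → Store → Prop) : Prop :=
  ∀ σ, C.Repr σ s → ∃ t τ s', Run C.inp C.S C.W p σ t τ ∧ C.Repr τ s' ∧ Q t s'

variable {C} {p q : Prog} {s : Store} {Q Q' : ℕ → Store → Prop}

lemma wp_mono (h : C.wp p s Q) (hQ : ∀ t s', Q t s' → Q' t s') : C.wp p s Q' := by
  intro σ hσ
  obtain ⟨t, τ, s', h1, h2, h3⟩ := h σ hσ
  exact ⟨t, τ, s', h1, h2, hQ t s' h3⟩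

lemma wp_seq (h : C.wp p s fun t s' => C.wp q s' fun u s'' => Q (t + u) s'') :
    C.wp (.seq p q) s Q := by
  intro σ hσ
  obtain ⟨t, τ, s', h1, h2, h3⟩ := h σ hσ
  obtain ⟨u, υ, s'', h4, h5, h6⟩ := h3 τ h2
  exact ⟨_, υ, s'', .seq h1 h4, h5, h6⟩

lemma wp_if {x y : Var} (h1 : s.get x < s.get y → C.wp p s fun t s' => Q (1 + t) s')
    (h2 : ¬ s.get x < s.get y → C.wp q s fun t s' => Q (1 + t) s') :
    C.wp (.ifLt x.reg y.reg p q) s Q := by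
  intro σ hσ
  by_cases h : s.get x < s.get y
  · obtain ⟨t, τ, s', h3, h4, h5⟩ := h1 h σ hσ
    exact ⟨_, τ, s', .ifTrue (by rwa [hσ.reg, hσ.reg]) h3, h4, h5⟩
  · obtain ⟨t, τ, s', h3, h4, h5⟩ := h2 h σ hσ
    exact ⟨_, τ, s', .ifFalse (by rwa [hσ.reg, hσ.reg]) h3, h4, h5⟩

/-- The rule for loops. The first argument of the invariant `I` is an upper bound for the remaining
time. -/
lemma wp_while {x y : Var} (I : ℕ → Store → Prop) (φ : ℕ) (hI : I φ s)
    (hstep : ∀ φ s, I φ s → s.get x < s.get y →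
      C.wp p s fun t s' => ∃ φ', I φ' s' ∧ t + 1 + φ' ≤ φ)
    (hQ : ∀ t φ' s', I φ' s' → ¬ s'.get x < s'.get y → t + φ' ≤ φ + 1 → Q t s') :
    C.wp (.whileLt x.reg y.reg p) s Q := by
  induction φ using Nat.strong_induction_on generalizing s Q with
  | _ φ ih =>
    intro σ hσ
    by_cases h : s.get x < s.get y
    · obtain ⟨t, τ, s', h1, h2, φ', h3, h4⟩ := hstep φ s hI h σ hσ
      obtain ⟨u, υ, s'', h5, h6, h7⟩ := ih φ' (by omega) h3
        (Q := fun u s'' => Q (1 + t + u) s'')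
        (fun u ψ s'' h5 h6 h7 => hQ _ ψ s'' h5 h6 (by omega)) τ h2
      exact ⟨_, υ, s'', .whileTrue (by rwa [hσ.reg, hσ.reg]) h1 h5, h6, h7⟩
    · exact ⟨1, σ, s, .whileFalse (by rwa [hσ.reg, hσ.reg]), hσ, hQ 1 φ s hI h (by omega)⟩

end Layout

/-- Operations on variables and arrays. -/
inductive Op
  | cst (r : Var) (k : ℕ)
  | cp (r a : Var)
  | add (r a b : Var)
  | sub (r a b : Var)
  | inp (r a : Var)
  | ld (r : Var) (A : Arr) (i : Var)
  | st (A : Arr) (i a : Var)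
  | ldt (r i j : Var)
  | stt (i j a : Var)

namespace Op

def prog : Op → Prog
  | .cst r k => .instr (.const r.reg k)
  | .cp r a => .instr (.copy r.reg a.reg)
  | .add r a b => .instr (.add r.reg a.reg b.reg)
  | .sub r a b => .instr (.sub r.reg a.reg b.reg)
  | .inp r a => .instr (.input r.reg a.reg)
  | .ld r A i => .seq (.instr (.load 0 i.reg)) (.seq (.instr (.const 1 A.ctorIdx))
      (.seq (.instr (.add 0 0 1)) (.instr (.load r.reg 0))))
  | .st A i a => .seq (.instr (.load 0 i.reg)) (.seq (.instr (.const 1 A.ctorIdx))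
      (.seq (.instr (.add 0 0 1)) (.instr (.store 0 a.reg))))
  | .ldt r i j => .seq (.instr (.load 0 i.reg)) (.seq (.instr (.const 1 16))
      (.seq (.instr (.add 0 0 1)) (.seq (.instr (.add 0 0 j.reg)) (.instr (.load r.reg 0)))))
  | .stt i j a => .seq (.instr (.load 0 i.reg)) (.seq (.instr (.const 1 16))
      (.seq (.instr (.add 0 0 1)) (.seq (.instr (.add 0 0 j.reg)) (.instr (.store 0 a.reg)))))

/-- The number of steps of an operation. -/
def cost : Op → ℕ
  | .ld .. | .st .. => 4
  | .ldt .. | .stt .. => 5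
  | _ => 1

/-- The effect of an operation. -/
def act (l : List ℕ) (s : Store) : Op → Store
  | .cst r k => s.set r k
  | .cp r a => s.set r (s.get a)
  | .add r a b => s.set r (s.get a + s.get b)
  | .sub r a b => s.set r (s.get a - s.get b)
  | .inp r a => s.set r (l.getD (s.get a) 0)
  | .ld r A i => s.set r (s.arr A (s.get i))
  | .st A i a => s.setArr A (Function.update (s.arr A) (s.get i) (s.get a))
  | .ldt r i j => s.set r (s.tab (s.get i) (s.get j))
  | .stt i j a => { s with
      tab := Function.update s.tab (s.get i)
        (Function.update (s.tab (s.get i)) (s.get j) (s.get a)) }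

/-- The condition under which an operation succeeds. -/
def ok (C : Layout) (s : Store) : Op → Prop
  | .cst _ k => k ≤ C.B
  | .add _ a b => s.get a + s.get b ≤ C.B
  | .ld _ _ i => s.get i < C.N
  | .st _ i _ => s.get i < C.N
  | .ldt _ i j => s.get i < C.N ∧ 16 + s.get j < C.R
  | .stt i j _ => s.get i < C.N ∧ 16 + s.get j < C.R
  | _ => True

end Op

/-! ### Correctness of the operations on variables and arrays. -/

namespace Layout

variable {C : Layout} {s : Store} {Q : ℕ → Store → Prop}

/-- Only the registers of variables are constrained, so the scratch registers may have been changed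
by an address computation. -/
lemma Repr.set {σ τ : State} (h : C.Repr σ s) {r : Var} {z : ℕ} (hz : z ≤ C.B)
    (hr : τ.reg r.reg = z) (hreg : ∀ x : Var, x ≠ r → τ.reg x.reg = σ.reg x.reg)
    (hmem : τ.mem = σ.mem) : C.Repr τ (s.set r z) where
  reg x := by
    rw [Store.get_set]
    split_ifs with hx
    · rw [hx, hr]
    · rw [hreg x hx, h.reg]
  ptr := hmem ▸ h.ptr
  arr := by rw [hmem, Store.arr_set]; exact h.arr
  tab := by rw [hmem, Store.tab_set]; exact h.tab
  get_le x := by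
    rw [Store.get_set]
    split_ifs
    exacts [hz, h.get_le x]
  arr_le := by rw [Store.arr_set]; exact h.arr_le
  tab_le := by rw [Store.tab_set]; exact h.tab_le

lemma Repr.setArr {σ τ : State} (h : C.Repr σ s) {A : Arr} {i z : ℕ} (hi : i < C.N)
    (hz : z ≤ C.B) (hreg : ∀ x : Var, τ.reg x.reg = σ.reg x.reg)
    (hmem : τ.mem = Function.update σ.mem (C.N + i * C.R + A.ctorIdx) z) :
    C.Repr τ (s.setArr A (Function.update (s.arr A) i z)) where
  reg x := by rw [Store.get_setArr, hreg, h.reg]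
  ptr j hj := by rw [hmem, Function.update_of_ne (by omega), h.ptr j hj]
  arr j hj D := by
    have hA := A.ctorIdx_lt
    have hD := D.ctorIdx_lt
    have hR := C.lt_R
    rw [hmem, Store.arr_setArr]
    by_cases hij : j = i ∧ D = A
    · obtain ⟨rfl, rfl⟩ := hij
      simp
    · rw [Function.update_of_ne, h.arr j hj]
      · split_ifs with h1
        · rw [Function.update_of_ne, h1]
          exact fun h2 => hij ⟨h2, h1⟩
        · rfl
      · intro h1
        obtain ⟨h2, h3⟩ := C.addr_inj (by omega) (by omega) h1
        exact hij ⟨h2, Arr.ctorIdx_injective h3⟩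
  tab j hj k hk := by
    have hA := A.ctorIdx_lt
    rw [hmem, Store.tab_setArr, Function.update_of_ne, h.tab j hj k hk]
    intro h1
    have := C.addr_inj (by omega) (by omega) h1
    omega
  get_le := by rw [Store.get_setArr]; exact h.get_le
  arr_le D j := by
    rw [Store.arr_setArr]
    split_ifs
    · rw [Function.update_apply]
      split_ifs
      exacts [hz, h.arr_le A j]
    · exact h.arr_le D j
  tab_le := by rw [Store.tab_setArr]; exact h.tab_le

lemma Repr.setTab {σ τ : State} (h : C.Repr σ s) {i k z : ℕ} (hi : i < C.N) (hk : 16 + k < C.R)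
    (hz : z ≤ C.B) (hreg : ∀ x : Var, τ.reg x.reg = σ.reg x.reg)
    (hmem : τ.mem = Function.update σ.mem (C.N + i * C.R + (16 + k)) z) :
    C.Repr τ { s with
      tab := Function.update s.tab i (Function.update (s.tab i) k z) } where
  reg x := by rw [hreg, h.reg]; cases x <;> rfl
  ptr j hj := by rw [hmem, Function.update_of_ne (by omega), h.ptr j hj]
  arr j hj D := by
    have hD := D.ctorIdx_lt
    rw [hmem, Function.update_of_ne, h.arr j hj]
    · cases D <;> rfl
    · intro h1
      have := C.addr_inj (by omega) (by omega) h1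
      omega
  tab j hj m hm := by
    rw [hmem]
    by_cases hij : j = i ∧ m = k
    · obtain ⟨rfl, rfl⟩ := hij
      simp
    · rw [Function.update_of_ne, h.tab j hj m hm]
      · dsimp only
        rcases eq_or_ne j i with rfl | h1
        · rw [Function.update_self, Function.update_of_ne fun h2 => hij ⟨rfl, h2⟩]
        · rw [Function.update_of_ne h1]
      · intro h1
        have := C.addr_inj (by omega) (by omega) h1
        exact hij ⟨this.1, by omega⟩
  get_le x := (by cases x <;> rfl : Store.get _ x = s.get x) ▸ h.get_le x
  arr_le D j := (by cases D <;> rfl : Store.arr _ D = s.arr D) ▸ h.arr_le D j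
  tab_le j m := by
    dsimp only
    rw [Function.update_apply]
    split_ifs with h1
    · rw [Function.update_apply]
      split_ifs
      exacts [hz, h.tab_le i m]
    · exact h.tab_le j m

lemma setReg_eq {W : ℕ} {σ : State} {r x : ℕ} (h : x ≤ W) :
    σ.setReg W r x = some { σ with reg := Function.update σ.reg r x } := if_pos h

/-- Loading the address of the field `f` of a record into the scratch register `0`. -/
lemma run_addr {σ : State} (h : C.Repr σ s) {i : Var} {f : ℕ} (hi : s.get i < C.N)
    (hf : f < C.R) (p : Prog) (t : ℕ) (τ : State)
    (hp : Run C.inp C.S C.W p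
      { σ with reg := Function.update (Function.update (Function.update σ.reg 0
          (C.N + s.get i * C.R)) 1 f) 0 (C.N + s.get i * C.R + f) } t τ) :
    Run C.inp C.S C.W (.seq (.instr (.load 0 i.reg)) (.seq (.instr (.const 1 f))
      (.seq (.instr (.add 0 0 1)) p))) σ (3 + t) τ := by
  have h1 := C.addr_lt hi hf
  have h2 := C.le_W
  have h3 := C.le_S
  have h4 := C.R_le
  have e1 : Run C.inp C.S C.W (.instr (.load 0 i.reg)) σ 1
      { σ with reg := Function.update σ.reg 0 (C.N + s.get i * C.R) } := by
    refine .instr ?_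
    have hS : s.get i < C.S := by omega
    simp only [Instr.exec, h.reg, hS, if_true, h.ptr _ hi]
    exact setReg_eq (by omega)
  have e2 : Run C.inp C.S C.W (.instr (.const 1 f))
      ⟨Function.update σ.reg 0 (C.N + s.get i * C.R), σ.mem⟩ 1
      ⟨Function.update (Function.update σ.reg 0 (C.N + s.get i * C.R)) 1 f, σ.mem⟩ :=
    .instr (setReg_eq (by omega))
  have e3 : Run C.inp C.S C.W (.instr (.add 0 0 1))
      ⟨Function.update (Function.update σ.reg 0 (C.N + s.get i * C.R)) 1 f, σ.mem⟩ 1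
      ⟨Function.update (Function.update (Function.update σ.reg 0
          (C.N + s.get i * C.R)) 1 f) 0 (C.N + s.get i * C.R + f), σ.mem⟩ := by
    refine .instr ?_
    simp only [Instr.exec, Function.update_self, ne_eq, zero_ne_one, not_false_eq_true,
      Function.update_of_ne]
    exact setReg_eq (by omega)
  have := Run.seq e1 (Run.seq e2 (Run.seq e3 hp))
  rwa [show 1 + (1 + (1 + t)) = 3 + t by omega] at this

/-- This is the bridge from machine instructions to stores; between setup and output no machine
state has to be inspected again. -/
lemma wp_op (o : Op) (hok : o.ok C s) (hQ : Q o.cost (o.act C.inp s)) : C.wp o.prog s Q := by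
  intro σ h
  have hS := C.le_S
  have hW := C.le_W
  have hBW := C.B_le
  have upd : ∀ (f : ℕ → ℕ) (r : Var) z (x : Var), x ≠ r →
      Function.update f r.reg z x.reg = f x.reg := fun f r z x hx =>
    Function.update_of_ne (fun h => hx (Var.reg_injective h)) _ _
  have upd0 : ∀ (f : ℕ → ℕ) z (x : Var), Function.update f 0 z x.reg = f x.reg := fun f z x =>
    Function.update_of_ne (Var.reg_ne_zero x) _ _
  have upd1 : ∀ (f : ℕ → ℕ) z (x : Var), Function.update f 1 z x.reg = f x.reg := fun f z x =>
    Function.update_of_ne (Var.reg_ne_one x) _ _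
  have simple : ∀ (i : Instr) (r : Var) z, z ≤ C.B →
      i.exec C.inp C.S C.W σ = σ.setReg C.W r.reg z →
      ∃ τ, Run C.inp C.S C.W (.instr i) σ 1 τ ∧ C.Repr τ (s.set r z) := by
    intro i r z hz hi
    rw [setReg_eq (hz.trans hBW)] at hi
    exact ⟨_, .instr hi, h.set hz (Function.update_self ..) (fun x hx => upd _ _ _ _ hx) rfl⟩
  cases o with
  | cst r k =>
    obtain ⟨τ, h1, h2⟩ := simple (.const r.reg k) r k hok rfl
    exact ⟨_, τ, _, h1, h2, hQ⟩
  | cp r a =>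
    obtain ⟨τ, h1, h2⟩ := simple (.copy r.reg a.reg) r (s.get a) (h.get_le a)
      (by simp only [Instr.exec, h.reg])
    exact ⟨_, τ, _, h1, h2, hQ⟩
  | add r a b =>
    obtain ⟨τ, h1, h2⟩ := simple (.add r.reg a.reg b.reg) r (s.get a + s.get b) hok
      (by simp only [Instr.exec, h.reg])
    exact ⟨_, τ, _, h1, h2, hQ⟩
  | sub r a b =>
    obtain ⟨τ, h1, h2⟩ := simple (.sub r.reg a.reg b.reg) r (s.get a - s.get b)
      ((Nat.sub_le _ _).trans (h.get_le a)) (by simp only [Instr.exec, h.reg])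
    exact ⟨_, τ, _, h1, h2, hQ⟩
  | inp r a =>
    obtain ⟨τ, h1, h2⟩ := simple (.input r.reg a.reg) r (C.inp.getD (s.get a) 0) (C.inp_le _)
      (by simp only [Instr.exec, h.reg])
    exact ⟨_, τ, _, h1, h2, hQ⟩
  | ld r A i =>
    have hA := A.ctorIdx_lt.trans C.lt_R
    have h1 := C.addr_lt hok hA
    have h2 : s.arr A (s.get i) ≤ C.B := h.arr_le _ _
    refine ⟨4, _, _, run_addr h hok hA _ 1 _ (.instr (τ := ⟨Function.update (Function.update
      (Function.update (Function.update σ.reg 0 (C.N + s.get i * C.R)) 1 A.ctorIdx) 0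
      (C.N + s.get i * C.R + A.ctorIdx)) r.reg (s.arr A (s.get i)), σ.mem⟩) ?_), ?_, hQ⟩
    · simp only [Instr.exec, Function.update_self, h1.trans_le hS, if_true, h.arr _ hok]
      exact setReg_eq (h2.trans hBW)
    · refine h.set h2 (Function.update_self ..) (fun x hx => ?_) rfl
      simp only [upd _ _ _ _ hx, upd0, upd1]
  | st A i a =>
    have hA := A.ctorIdx_lt.trans C.lt_R
    have h1 := C.addr_lt hok hA
    refine ⟨4, _, _, run_addr h hok hA _ 1 _ (.instr (τ := ⟨Function.update
      (Function.update (Function.update σ.reg 0 (C.N + s.get i * C.R)) 1 A.ctorIdx) 0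
      (C.N + s.get i * C.R + A.ctorIdx), Function.update σ.mem
      (C.N + s.get i * C.R + A.ctorIdx) (s.get a)⟩) ?_), ?_, hQ⟩
    · simp only [Instr.exec, Function.update_self, h1.trans_le hS, if_true, upd0, upd1, h.reg]
    · refine h.setArr hok (h.get_le a) (fun x => ?_) rfl
      simp only [upd0, upd1]
  | ldt r i j =>
    obtain ⟨hi, hj⟩ := hok
    have h1 := C.addr_lt hi hj
    have h2 : s.tab (s.get i) (s.get j) ≤ C.B := h.tab_le _ _
    refine ⟨5, _, _, run_addr h hi C.lt_R _ 2 _ (.seq (t := 1) (u := 1) (.instr (τ := ⟨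
      Function.update (Function.update
      (Function.update (Function.update σ.reg 0 (C.N + s.get i * C.R)) 1 16) 0
      (C.N + s.get i * C.R + 16)) 0 (C.N + s.get i * C.R + (16 + s.get j)), σ.mem⟩) ?_)
      (.instr (τ := ⟨Function.update (Function.update (Function.update
      (Function.update (Function.update σ.reg 0 (C.N + s.get i * C.R)) 1 16) 0
      (C.N + s.get i * C.R + 16)) 0 (C.N + s.get i * C.R + (16 + s.get j))) r.reg
      (s.tab (s.get i) (s.get j)), σ.mem⟩) ?_)), ?_, hQ⟩
    · simp only [Instr.exec, Function.update_self, upd0, upd1, h.reg, add_assoc]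
      exact setReg_eq (by omega)
    · simp only [Instr.exec, Function.update_self, h1.trans_le hS, if_true, h.tab _ hi _ hj]
      exact setReg_eq (h2.trans hBW)
    · refine h.set h2 (Function.update_self ..) (fun x hx => ?_) rfl
      simp only [upd _ _ _ _ hx, upd0, upd1]
  | stt i j a =>
    obtain ⟨hi, hj⟩ := hok
    have h1 := C.addr_lt hi hj
    refine ⟨5, _, _, run_addr h hi C.lt_R _ 2 _ (.seq (t := 1) (u := 1) (.instr (τ := ⟨
      Function.update (Function.update
      (Function.update (Function.update σ.reg 0 (C.N + s.get i * C.R)) 1 16) 0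
      (C.N + s.get i * C.R + 16)) 0 (C.N + s.get i * C.R + (16 + s.get j)), σ.mem⟩) ?_)
      (.instr (τ := ⟨Function.update (Function.update
      (Function.update (Function.update σ.reg 0 (C.N + s.get i * C.R)) 1 16) 0
      (C.N + s.get i * C.R + 16)) 0 (C.N + s.get i * C.R + (16 + s.get j)),
      Function.update σ.mem (C.N + s.get i * C.R + (16 + s.get j)) (s.get a)⟩) ?_)), ?_, hQ⟩
    · simp only [Instr.exec, Function.update_self, upd0, upd1, h.reg, add_assoc]
      exact setReg_eq (by omega)
    · simp only [Instr.exec, Function.update_self, h1.trans_le hS, if_true, upd0, upd1, h.reg]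
    · refine h.setTab hi hj (h.get_le a) (fun x => ?_) rfl
      simp only [upd0, upd1]

end Layout

/-- A sequence of operations. -/
def ops : List Op → Prog
  -- There is no empty program; copying a register to itself takes its place and costs one step.
  | [] => (Op.cp .zero .zero).prog
  | o :: l => .seq o.prog (ops l)

namespace Op

def actList (l : List ℕ) (s : Store) : List Op → Store
  | [] => s
  | o :: os => actList l (o.act l s) os

def okList (C : Layout) (s : Store) : List Op → Prop
  | [] => True
  | o :: os => o.ok C s ∧ okList C (o.act C.inp s) os

def costList : List Op → ℕ
  | [] => 1
  | o :: os => o.cost + costList os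

end Op

namespace Layout

variable {C : Layout}

lemma wp_ops (os : List Op) {s : Store} {Q : ℕ → Store → Prop} (hok : Op.okList C s os)
    (hQ : Q (Op.costList os) (Op.actList C.inp s os)) : C.wp (ops os) s Q := by
  induction os generalizing s Q with
  | nil =>
    refine wp_op (.cp .zero .zero) trivial ?_
    cases s
    exact hQ
  | cons o os ih =>
    exact wp_seq (wp_op o hok.1 (ih hok.2 hQ))

end Layout

end RAM

/-! ### Combining two tables of attainable sums. -/

namespace RAM

open Op Layout

def skip : Prog := ops []

/-- Branch on whether the first variable is smaller than the second one. -/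
def ite (x y : Var) (p q : Prog) : Prog := .ifLt x.reg y.reg p q

def loop (x y : Var) (p : Prog) : Prog := .whileLt x.reg y.reg p

infixr:60 " ;; " => Prog.seq

/-- The test for admissible pairs of partial sums `kk` and `j` of the parts of a composition. -/
def guarded (ser : Bool) (p : Prog) : Prog :=
  -- Equality of `j` and `wr` is tested by two strict comparisons.
  if ser then ite .zero .kk (ite .j .wr skip (ite .wr .j skip p)) p else p

/-- One row of the double loop of `combine`. -/
def combineRow (ser : Bool) : Prog :=
  ops [.cp .j .zero, .cp .s .kk, .add .g .kk .one] ;;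
  loop .j .lim (
    ops [.ldt .b .r .j] ;;
    ite .zero .b (guarded ser (ops [.stt .d .s .g])) skip ;;
    ops [.add .j .j .one, .add .s .s .one])

/-- Create the block number `fresh` as the series or parallel composition of the blocks `l` and
`r`, and compute its table of attainable sums. -/
def combine (ser : Bool) : Prog :=
  ops [.cp .d .fresh, .add .fresh .fresh .one, .st .left .d .l, .st .right .d .r,
    .st .tail .d .y, .st .head .d .x, .ld .a .wt .l, .ld .wr .wt .r, .add .a .a .wr,
    .st .wt .d .a, .cp .kk .zero, .add .lim .c .one] ;;
  -- `lim` stays equal to `c + 1 - kk`, so it counts the remaining rows and also bounds the second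
  -- partial sum within a row.
  loop .zero .lim (
    ops [.ldt .a .l .kk] ;;
    ite .zero .a (combineRow ser) skip ;;
    ops [.add .kk .kk .one, .sub .lim .lim .one])

/-- The partial sums `k` and `i` of the parts of a composition are attainable and admissible
together. -/
def Compat (ser : Bool) (Tl Tr : ℕ → ℕ) (wr k i : ℕ) : Prop :=
  Tl k ≠ 0 ∧ Tr i ≠ 0 ∧ (ser = true → k = 0 ∨ i = wr)

/-- The table `T` of a composition is sound: a nonzero entry is the successor of an admissible
first part. -/
def RowSound (ser : Bool) (c : ℕ) (Tl Tr : ℕ → ℕ) (wr : ℕ) (T : ℕ → ℕ) : Prop :=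
  ∀ m ≤ c, T m ≠ 0 → ∃ k i, T m = k + 1 ∧ k + i = m ∧ Compat ser Tl Tr wr k i

/-- Only being nonzero is demanded, since an entry may be overwritten by another pair with the same
sum. -/
def RowComplete (ser : Bool) (c : ℕ) (Tl Tr : ℕ → ℕ) (wr : ℕ) (T : ℕ → ℕ) : Prop :=
  ∀ k i, k + i ≤ c → Compat ser Tl Tr wr k i → T (k + i) ≠ 0

namespace Layout

variable {C : Layout} {s : Store} {Q : ℕ → Store → Prop}

lemma wp_skip (h : Q 1 s) : C.wp skip s Q := wp_ops [] trivial h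

/-- The number of tests depends on the branch taken; the bounds on `u` cover all of them. -/
lemma wp_guarded (ser : Bool) {p : Prog} (hzero : s.zero = 0)
    (h1 : (ser = true → s.kk = 0 ∨ s.j = s.wr) → C.wp p s fun t s' => ∀ u ≤ 3, Q (u + t) s')
    (h2 : ¬ (ser = true → s.kk = 0 ∨ s.j = s.wr) → ∀ u ≤ 4, Q u s) :
    C.wp (guarded ser p) s Q := by
  unfold guarded
  split_ifs with hs
  · refine wp_if (fun h3 => wp_if (fun h4 => wp_skip (h2 ?_ _ (by norm_num))) fun h4 =>
      wp_if (fun h5 => wp_skip (h2 ?_ _ (by norm_num))) fun h5 => wp_mono (h1 ?_) ?_) fun h3 =>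
      wp_mono (h1 ?_) ?_
    · simp only [Store.get, hs, forall_const] at *
      omega
    · simp only [Store.get, hs, forall_const] at *
      omega
    · simp only [Store.get, hs, forall_const] at *
      omega
    · intro t s' h
      have := h 3 (by norm_num)
      rwa [show 3 + t = 1 + (1 + (1 + t)) by omega] at this
    · simp only [Store.get, hs, forall_const] at *
      omega
    · intro t s' h
      exact h 1 (by norm_num)
  · refine wp_mono (h1 fun h => absurd h hs) fun t s' h => ?_
    simpa using h 0 (by norm_num)

/-- Within the row, completeness is known for all pairs that precede `(kk, j)` lexicographically.
Overwriting does no harm: the new entry `kk + 1` is nonzero and belongs to an admissible pair. As `r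
≠ d`, the row that is read is not the one being written. -/
lemma wp_combineRow (ser : Bool) {Tl : ℕ → ℕ} (hzero : s.zero = 0) (hone : s.one = 1)
    (hR : C.R = s.c + 17) (hB : s.c + 2 ≤ C.B) (hd : s.d < C.N) (hr : s.r < C.N)
    (hrd : s.r ≠ s.d) (hkk : s.kk ≤ s.c) (hlim : s.lim + s.kk = s.c + 1) (hTl : Tl s.kk ≠ 0)
    (hsound : RowSound ser s.c Tl (s.tab s.r) s.wr (s.tab s.d))
    (hcomp : ∀ k i, k + i ≤ s.c → Compat ser Tl (s.tab s.r) s.wr k i → k < s.kk →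
      s.tab s.d (k + i) ≠ 0)
    (hQ : ∀ t b j s₁ g T, t ≤ 20 * (s.c + 2) →
      RowSound ser s.c Tl (s.tab s.r) s.wr T →
      (∀ k i, k + i ≤ s.c → Compat ser Tl (s.tab s.r) s.wr k i → k < s.kk + 1 → T (k + i) ≠ 0) →
      Q t { s with b := b, j := j, s := s₁, g := g, tab := Function.update s.tab s.d T }) :
    C.wp (combineRow ser) s Q := by
  refine wp_seq (wp_ops _ ?_ ?_)
  · simp only [okList, ok, act, Store.get, Store.set, hone, and_true, true_and]
    omega
  simp only [actList, act, Store.get, Store.set]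
  refine wp_while (fun φ s' => ∃ b j T, s' = { s with
      b := b, j := j, s := s.kk + j, g := s.kk + 1, tab := Function.update s.tab s.d T } ∧
    φ = 20 * (s.lim - j) ∧ RowSound ser s.c Tl (s.tab s.r) s.wr T ∧
    ∀ k i, k + i ≤ s.c → Compat ser Tl (s.tab s.r) s.wr k i → k < s.kk ∨ k = s.kk ∧ i < j →
      T (k + i) ≠ 0) (20 * s.lim) ⟨s.b, 0, s.tab s.d, ?_, ?_, hsound, ?_⟩ ?_ ?_
  · simp only [hzero, hone, Function.update_eq_self, add_zero]
  · simp
  · intro k i hki hc h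
    exact hcomp k i hki hc (by omega)
  · rintro φ s' ⟨b, j, T, rfl, hφ, hT, hcT⟩ hlt
    simp only [Store.get] at hlt
    refine wp_seq (wp_ops _ ?_ ?_)
    · simp only [okList, ok, Store.get]
      exact ⟨⟨hr, by omega⟩, trivial⟩
    simp only [actList, act, Store.get, Store.set]
    have htr : Function.update s.tab s.d T s.r j = s.tab s.r j := by
      rw [Function.update_of_ne hrd]
    -- All branches end by advancing `j`; what they have to supply is a row `T'` that accounts for
    -- the pair `(kk, j)`.
    have fin : ∀ (t : ℕ) (T' : ℕ → ℕ), t ≤ 10 → RowSound ser s.c Tl (s.tab s.r) s.wr T' →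
        (∀ k i, k + i ≤ s.c → Compat ser Tl (s.tab s.r) s.wr k i →
          k < s.kk ∨ k = s.kk ∧ i < j + 1 → T' (k + i) ≠ 0) →
        C.wp (ops [.add .j .j .one, .add .s .s .one]) { s with
          b := Function.update s.tab s.d T s.r j, j := j, s := s.kk + j, g := s.kk + 1,
          tab := Function.update s.tab s.d T' } fun u s'' => ∃ φ', (∃ b j T, s'' = { s with
            b := b, j := j, s := s.kk + j, g := s.kk + 1,
            tab := Function.update s.tab s.d T } ∧
          φ' = 20 * (s.lim - j) ∧ RowSound ser s.c Tl (s.tab s.r) s.wr T ∧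
          ∀ k i, k + i ≤ s.c → Compat ser Tl (s.tab s.r) s.wr k i → k < s.kk ∨ k = s.kk ∧ i < j →
          T (k + i) ≠ 0) ∧ 6 + (t + u) + 1 + φ' ≤ φ := by
      intro t T' ht hT' hcT'
      refine wp_ops _ ?_ ?_
      · simp only [okList, ok, act, Store.get, Store.set, hone, and_true]
        omega
      refine ⟨_, ⟨Function.update s.tab s.d T s.r j, j + 1, T', ?_, rfl, hT', hcT'⟩, ?_⟩
      · simp only [actList, act, Store.get, Store.set, hone, add_assoc]
      · simp only [costList, cost]
        omega
    refine wp_seq (wp_if (fun hb => ?_) fun hb => wp_skip ?_)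
    · simp only [Store.get, hzero, htr] at hb
      refine wp_guarded ser hzero (fun hg => wp_ops _ ?_ fun u hu => ?_) fun hg u hu => ?_
      · simp only [okList, ok, Store.get]
        exact ⟨⟨hd, by omega⟩, trivial⟩
      · simp only [actList, act, Store.get]
        have hc : Compat ser Tl (s.tab s.r) s.wr s.kk j := ⟨hTl, by omega, hg⟩
        rw [Function.update_self, Function.update_idem]
        refine wp_mono (fin (1 + (u + costList [.stt .d .s .g]))
          (Function.update T (s.kk + j) (s.kk + 1)) ?_ ?_ ?_) fun _ _ h => h
        · simp only [costList, cost]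
          omega
        · intro m hm hTm
          by_cases hmj : m = s.kk + j
          · subst hmj
            exact ⟨s.kk, j, Function.update_self .., rfl, hc⟩
          · rw [Function.update_of_ne hmj] at hTm ⊢
            exact hT m hm hTm
        · intro k i hki hck h
          by_cases hmj : k + i = s.kk + j
          · rw [hmj, Function.update_self]
            omega
          · rw [Function.update_of_ne hmj]
            exact hcT k i hki hck (by omega)
      · refine wp_mono (fin (1 + u) T (by omega) hT fun k i hki hck h => ?_) fun _ _ h => h
        refine hcT k i hki hck ?_
        have : ¬ (k = s.kk ∧ i = j) := by
          rintro ⟨rfl, rfl⟩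
          exact hg hck.2.2
        omega
    · simp only [Store.get, hzero, htr] at hb
      refine wp_mono (fin 2 T (by omega) hT fun k i hki hck h => ?_) fun _ _ h => h
      refine hcT k i hki hck ?_
      have : ¬ (k = s.kk ∧ i = j) := by
        rintro ⟨rfl, rfl⟩
        exact hck.2.1 (by omega)
      omega
  · rintro t φ' s' ⟨b, j, T, rfl, hφ, hT, hcT⟩ hlt ht
    simp only [Store.get] at hlt
    refine hQ _ _ _ _ _ _ ?_ hT fun k i hki hck h => ?_
    · simp only [costList, cost]
      omega
    · exact hcT k i hki hck (by omega)

/-- Each record gets its table only once, so the new row is still zero and need not be cleared. The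
`c + 1` rows cost linear time each. -/
lemma wp_combine (ser : Bool) (hzero : s.zero = 0) (hone : s.one = 1)
    (hR : C.R = s.c + 17) (hB : s.c + s.fresh + 2 ≤ C.B) (hwt : s.wt s.l + s.wt s.r ≤ C.B)
    (hl : s.l < s.fresh) (hr : s.r < s.fresh) (hf : s.fresh < C.N)
    (htab : s.tab s.fresh = fun _ => 0)
    (hQ : ∀ t kk j lim a b s₁ g T, t ≤ 80 * (s.c + 2) ^ 2 →
      RowSound ser s.c (s.tab s.l) (s.tab s.r) (s.wt s.r) T →
      RowComplete ser s.c (s.tab s.l) (s.tab s.r) (s.wt s.r) T →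
      Q t { s with
        d := s.fresh, fresh := s.fresh + 1
        left := Function.update s.left s.fresh s.l
        right := Function.update s.right s.fresh s.r
        tail := Function.update s.tail s.fresh s.y
        head := Function.update s.head s.fresh s.x
        wt := Function.update s.wt s.fresh (s.wt s.l + s.wt s.r)
        tab := Function.update s.tab s.fresh T
        wr := s.wt s.r, kk := kk, j := j, lim := lim, a := a, b := b, s := s₁, g := g }) :
    C.wp (combine ser) s Q := by
  refine wp_seq (wp_ops _ ?_ ?_)
  · simp only [okList, ok, act, Store.get, Store.set, Store.arr, Store.setArr, hone, and_true,
      true_and]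
    omega
  simp only [actList, act, Store.get, Store.set, Store.arr, Store.setArr]
  refine wp_while (fun φ s' => ∃ kk j lim a b s₁ g T, s' = { s with
        d := s.fresh, fresh := s.fresh + 1
        left := Function.update s.left s.fresh s.l
        right := Function.update s.right s.fresh s.r
        tail := Function.update s.tail s.fresh s.y
        head := Function.update s.head s.fresh s.x
        wt := Function.update s.wt s.fresh (s.wt s.l + s.wt s.r)
        tab := Function.update s.tab s.fresh T
        wr := s.wt s.r, kk := kk, j := j, lim := lim, a := a, b := b, s := s₁, g := g } ∧
      φ = (20 * (s.c + 2) + 14) * lim ∧ lim + kk = s.c + 1 ∧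
      RowSound ser s.c (s.tab s.l) (s.tab s.r) (s.wt s.r) T ∧
      ∀ k i, k + i ≤ s.c → Compat ser (s.tab s.l) (s.tab s.r) (s.wt s.r) k i → k < kk →
        T (k + i) ≠ 0) ((20 * (s.c + 2) + 14) * (s.c + 1))
    ⟨0, s.j, s.c + 1, s.wt s.l + s.wt s.r, s.b, s.s, s.g, fun _ => 0, ?_, rfl, ?_, ?_, ?_⟩ ?_ ?_
  · simp only [hone, hzero]
    rw [← htab, Function.update_eq_self]
  · rfl
  · intro m _ h
    exact absurd rfl h
  · intro k i _ _ h
    omega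
  · rintro φ s' ⟨kk, j, lim, a, b, s₁, g, T, rfl, hφ, hlim, hT, hcT⟩ hlt
    simp only [Store.get, hzero] at hlt
    refine wp_seq (wp_ops _ ?_ ?_)
    · simp only [okList, ok, Store.get]
      exact ⟨⟨by omega, by omega⟩, trivial⟩
    simp only [actList, act, Store.get, Store.set]
    have htl : Function.update s.tab s.fresh T s.l = s.tab s.l := Function.update_of_ne hl.ne _ _
    have htr : Function.update s.tab s.fresh T s.r = s.tab s.r := Function.update_of_ne hr.ne _ _
    simp only [htl]
    have hφ' : φ = (20 * (s.c + 2) + 14) * (lim - 1) + (20 * (s.c + 2) + 14) := by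
      rw [hφ, ← Nat.mul_succ]
      congr 1
      omega
    -- The common end of both branches; a row is skipped when its first partial sum is not
    -- attainable.
    have fin : ∀ (t : ℕ) j b s₁ g (T' : ℕ → ℕ), t ≤ 20 * (s.c + 2) + 3 →
        RowSound ser s.c (s.tab s.l) (s.tab s.r) (s.wt s.r) T' →
        (∀ k i, k + i ≤ s.c → Compat ser (s.tab s.l) (s.tab s.r) (s.wt s.r) k i →
          k < kk + 1 → T' (k + i) ≠ 0) →
        C.wp (ops [.add .kk .kk .one, .sub .lim .lim .one]) { s with
          d := s.fresh, fresh := s.fresh + 1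
          left := Function.update s.left s.fresh s.l
          right := Function.update s.right s.fresh s.r
          tail := Function.update s.tail s.fresh s.y
          head := Function.update s.head s.fresh s.x
          wt := Function.update s.wt s.fresh (s.wt s.l + s.wt s.r)
          tab := Function.update s.tab s.fresh T'
          wr := s.wt s.r, kk := kk, j := j, lim := lim, a := s.tab s.l kk
          b := b, s := s₁, g := g } fun u s'' => ∃ φ', (∃ kk j lim a b s₁ g T, s'' = { s with
            d := s.fresh, fresh := s.fresh + 1
            left := Function.update s.left s.fresh s.l
            right := Function.update s.right s.fresh s.r
            tail := Function.update s.tail s.fresh s.y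
            head := Function.update s.head s.fresh s.x
            wt := Function.update s.wt s.fresh (s.wt s.l + s.wt s.r)
            tab := Function.update s.tab s.fresh T
            wr := s.wt s.r, kk := kk, j := j, lim := lim, a := a, b := b, s := s₁, g := g } ∧
          φ' = (20 * (s.c + 2) + 14) * lim ∧ lim + kk = s.c + 1 ∧
          RowSound ser s.c (s.tab s.l) (s.tab s.r) (s.wt s.r) T ∧
          ∀ k i, k + i ≤ s.c → Compat ser (s.tab s.l) (s.tab s.r) (s.wt s.r) k i → k < kk →
            T (k + i) ≠ 0) ∧ 6 + (t + u) + 1 + φ' ≤ φ := by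
      intro t j b s₁ g T' ht hT' hcT'
      refine wp_ops _ ?_ ?_
      · simp only [okList, ok, Store.get, hone, and_true]
        omega
      refine ⟨_, ⟨kk + 1, j, lim - 1, s.tab s.l kk, b, s₁, g, T', ?_, rfl, by omega, hT',
        hcT'⟩, ?_⟩
      · simp only [actList, act, Store.get, Store.set, hone]
      · simp only [costList, cost]
        omega
    refine wp_seq (wp_if (fun ha => ?_) fun ha => wp_skip ?_)
    · simp only [Store.get, hzero] at ha
      refine wp_combineRow ser (Tl := s.tab s.l) hzero hone hR (by simp only; omega) hf
        (hr.trans hf) hr.ne (by simp only; omega) hlim ha.ne' ?_ ?_ ?_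
      · simpa only [htr, Function.update_self] using hT
      · simpa only [htr, Function.update_self] using hcT
      · simp only [htr, Function.update_idem]
        intro t b j s₁ g T' ht hT' hcT'
        exact fin (1 + t) j b s₁ g T' (by omega) hT' hcT'
    · simp only [Store.get, hzero] at ha
      refine fin 2 _ _ _ _ _ (by omega) hT fun k i hki hck h => hcT k i hki hck ?_
      have : k ≠ kk := by
        rintro rfl
        exact hck.1 (by omega)
      omega
  · rintro t φ' s' ⟨kk, j, lim, a, b, s₁, g, T, rfl, hφ, hlim, hT, hcT⟩ hlt ht
    simp only [Store.get, hzero] at hlt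
    refine hQ _ _ _ _ _ _ _ _ _ ?_ hT fun k i hki hck => hcT k i hki hck (by omega)
    simp only [costList, cost]
    nlinarith
end Layout

end RAM

/-! ### Decomposition trees and their attainable sums -/

/-- Series-parallel decomposition trees. A node of a series composition carries the value `true`. -/
inductive SPTree
  | leaf (v : ℕ)
  | node (ser : Bool) (l r : SPTree)

namespace SPTree

def items : SPTree → Finset ℕ
  | leaf v => {v}
  | node _ l r => l.items ∪ r.items

/-- The set `A` is closed under successors inside the tree. -/
def Adm (A : Finset ℕ) : SPTree → Prop
  | leaf _ => True
  | node ser l r => Adm A l ∧ Adm A r ∧ (ser = true → Disjoint A l.items ∨ r.items ⊆ A)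

lemma items_nonempty (t : SPTree) : t.items.Nonempty := by
  induction t with
  | leaf v => exact Finset.singleton_nonempty v
  | node _ l r hl _ => exact hl.mono Finset.subset_union_left

/-- Admissibility depends only on the part of the set inside the tree, which allows solutions for
disjoint trees to be glued. -/
lemma Adm.congr {A B : Finset ℕ} {t : SPTree} (h : ∀ v ∈ t.items, v ∈ A ↔ v ∈ B)
    (hA : Adm A t) : Adm B t := by
  induction t with
  | leaf v => trivial
  | node ser l r hl hr =>
    have h1 : ∀ v ∈ l.items, v ∈ A ↔ v ∈ B := fun v hv => h v (Finset.mem_union_left _ hv)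
    have h2 : ∀ v ∈ r.items, v ∈ A ↔ v ∈ B := fun v hv => h v (Finset.mem_union_right _ hv)
    refine ⟨hl h1 hA.1, hr h2 hA.2.1, fun hs => (hA.2.2 hs).imp (fun h3 => ?_) fun h3 v hv => ?_⟩
    · exact Finset.disjoint_right.2 fun v hv hB => Finset.disjoint_right.1 h3 hv ((h1 v hv).2 hB)
    · exact (h2 v hv).1 (h3 hv)

/-- `T` has a nonzero entry at those sums up to `c` that are attained by admissible sets. -/
def TableOK (c : ℕ) (sz : ℕ → ℕ) (T : ℕ → ℕ) (t : SPTree) : Prop :=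
  ∀ j ≤ c, T j ≠ 0 ↔ ∃ A, Adm A t ∧ ∑ v ∈ A ∩ t.items, sz v = j

/-- Here and in `subset_of_sum_eq` positivity of the sizes is essential: the condition at a series
node can be read off the two partial sums. -/
lemma disjoint_of_sum_eq_zero {sz : ℕ → ℕ} (hsz : ∀ v, 0 < sz v) {A I : Finset ℕ}
    (h : ∑ v ∈ A ∩ I, sz v = 0) : Disjoint A I := by
  rw [Finset.sum_eq_zero_iff] at h
  refine Finset.disjoint_left.2 fun v hA hI => ?_
  exact (hsz v).ne' (h v (Finset.mem_inter.2 ⟨hA, hI⟩))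

lemma subset_of_sum_eq {sz : ℕ → ℕ} (hsz : ∀ v, 0 < sz v) {A I : Finset ℕ}
    (h : ∑ v ∈ A ∩ I, sz v = ∑ v ∈ I, sz v) : I ⊆ A := by
  intro v hv
  by_contra hA
  have := Finset.sum_lt_sum_of_subset (f := sz) (Finset.inter_subset_right : A ∩ I ⊆ I) hv
    (fun h => hA (Finset.mem_inter.1 h).1) (hsz v) fun _ _ _ => Nat.zero_le _
  omega

lemma sum_inter_union {sz : ℕ → ℕ} {A I J : Finset ℕ} (h : Disjoint I J) :
    ∑ v ∈ A ∩ (I ∪ J), sz v = ∑ v ∈ A ∩ I, sz v + ∑ v ∈ A ∩ J, sz v := by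
  rw [Finset.inter_union_distrib_left, Finset.sum_union]
  exact h.mono Finset.inter_subset_right Finset.inter_subset_right

/-- Sets attaining the two partial sums are cut down to their own trees and united. The trees are
disjoint, so the union restricts to the given sets, and the numerical condition of `Compat` becomes
the series condition. Conversely, an admissible set splits into its two restrictions. -/
lemma TableOK.node {c : ℕ} {sz : ℕ → ℕ} (hsz : ∀ v, 0 < sz v) {ser : Bool} {l r : SPTree}
    (hd : Disjoint l.items r.items) {T Tl Tr : ℕ → ℕ} {wr : ℕ} (hwr : wr = ∑ v ∈ r.items, sz v)
    (hl : TableOK c sz Tl l) (hr : TableOK c sz Tr r)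
    (hs : RAM.RowSound ser c Tl Tr wr T) (hc : RAM.RowComplete ser c Tl Tr wr T) :
    TableOK c sz T (node ser l r) := by
  intro m hm
  constructor
  · intro hT
    obtain ⟨k, i, -, hki, hk, hi, hcomp⟩ := hs m hm hT
    obtain ⟨A, hA, hAk⟩ := (hl k (by omega)).1 hk
    obtain ⟨B, hB, hBi⟩ := (hr i (by omega)).1 hi
    have h1 : ∀ v ∈ l.items, v ∈ A ↔ v ∈ A ∩ l.items ∪ B ∩ r.items := by
      intro v hv
      have := Finset.disjoint_left.1 hd hv
      simp [hv, this]
    have h2 : ∀ v ∈ r.items, v ∈ B ↔ v ∈ A ∩ l.items ∪ B ∩ r.items := by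
      intro v hv
      have := Finset.disjoint_right.1 hd hv
      simp [hv, this]
    have h3 : (A ∩ l.items ∪ B ∩ r.items) ∩ l.items = A ∩ l.items := by
      ext v
      simp only [Finset.mem_inter, and_congr_left_iff]
      exact fun hv => (h1 v hv).symm
    have h4 : (A ∩ l.items ∪ B ∩ r.items) ∩ r.items = B ∩ r.items := by
      ext v
      simp only [Finset.mem_inter, and_congr_left_iff]
      exact fun hv => (h2 v hv).symm
    refine ⟨A ∩ l.items ∪ B ∩ r.items, ⟨hA.congr h1, hB.congr h2, fun hs => ?_⟩, ?_⟩
    · refine (hcomp hs).imp (fun h => ?_) fun h => ?_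
      · refine disjoint_of_sum_eq_zero hsz ?_
        rw [h3, hAk, h]
      · refine subset_of_sum_eq hsz ?_
        rw [h4, hBi, h, hwr]
    · rw [items, sum_inter_union hd, h3, h4]
      omega
  · rintro ⟨A, ⟨hA, hB, hcomp⟩, hsum⟩
    rw [items, sum_inter_union hd] at hsum
    rw [← hsum]
    refine hc _ _ (by omega) ⟨?_, ?_, fun hs => ?_⟩
    · exact (hl _ (by omega)).2 ⟨A, hA, rfl⟩
    · exact (hr _ (by omega)).2 ⟨A, hB, rfl⟩
    · refine (hcomp hs).imp (fun h => ?_) fun h => ?_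
      · rw [Finset.disjoint_iff_inter_eq_empty.1 h, Finset.sum_empty]
      · rw [Finset.inter_eq_right.2 h, hwr]

end SPTree

/-! ### Contracting the blocks of a decomposition -/

/-- The arcs of the multidigraph of the blocks in `L`. -/
def blockArcs (L : Finset ℕ) (tail head : ℕ → ℕ) : Multiset (ℕ × ℕ) :=
  L.val.map fun d => (tail d, head d)

/-- Replace the blocks `D` and `b` by the new block `N`. -/
def mergeBlocks (L : Finset ℕ) (D b N : ℕ) : Finset ℕ := insert N ((L.erase D).erase b)

section Merge

variable {L : Finset ℕ} {tail head : ℕ → ℕ} {D b N : ℕ}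

lemma mem_mergeBlocks {d : ℕ} : d ∈ mergeBlocks L D b N ↔ d = N ∨ d ≠ b ∧ d ≠ D ∧ d ∈ L := by
  simp [mergeBlocks]

lemma mem_blockArcs {e : ℕ × ℕ} : e ∈ blockArcs L tail head ↔ ∃ d ∈ L, (tail d, head d) = e := by
  simp [blockArcs]

lemma blockArcs_eq_cons (hD : D ∈ L) (hb : b ∈ L) (hne : b ≠ D) :
    blockArcs L tail head = (tail D, head D) ::ₘ (tail b, head b) ::ₘ
      blockArcs ((L.erase D).erase b) tail head := by
  have h1 : b ∈ L.erase D := Finset.mem_erase.2 ⟨hne, hb⟩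
  conv_lhs => rw [blockArcs, ← Finset.insert_erase hD, ← Finset.insert_erase h1,
    Finset.insert_val_of_notMem (by simp [hne.symm]), Finset.insert_val_of_notMem (by simp),
    Multiset.map_cons, Multiset.map_cons]
  rfl

lemma blockArcs_mergeBlocks (hN : N ∉ L) (u v : ℕ) :
    blockArcs (mergeBlocks L D b N) (Function.update tail N u) (Function.update head N v) =
      (u, v) ::ₘ blockArcs ((L.erase D).erase b) tail head := by
  have h1 : N ∉ (L.erase D).erase b := by simp [hN]
  rw [blockArcs, mergeBlocks, Finset.insert_val_of_notMem h1, Multiset.map_cons,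
    Function.update_self, Function.update_self, blockArcs]
  congr 1
  refine Multiset.map_congr rfl fun d hd => ?_
  have : d ≠ N := fun h => h1 (h ▸ hd)
  rw [Function.update_of_ne this, Function.update_of_ne this]

lemma card_mergeBlocks (hD : D ∈ L) (hb : b ∈ L) (hne : b ≠ D) (hN : N ∉ L) :
    (mergeBlocks L D b N).card + 1 = L.card := by
  have h1 : b ∈ L.erase D := Finset.mem_erase.2 ⟨hne, hb⟩
  rw [mergeBlocks, Finset.card_insert_of_notMem (by simp [hN]), Finset.card_erase_of_mem h1,
    Finset.card_erase_of_mem hD]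
  have := Finset.card_pos.2 ⟨b, h1⟩
  rw [Finset.card_erase_of_mem hD] at this
  omega

end Merge

/-- The blocks in `L` with their decomposition trees partition the items `0, …, n - 1`, they form a
series-parallel multidigraph, and the sets satisfying `Up` are those which are admissible for all
blocks and closed under passing from a block to a following one. -/
structure BlockInv (n : ℕ) (Up : Finset ℕ → Prop) (L : Finset ℕ) (tail head : ℕ → ℕ)
    (tr : ℕ → SPTree) : Prop where
  ttsp : TTSP (blockArcs L tail head) 0 (n + 1)
  up_iff : ∀ A, Up A ↔ (∀ d ∈ L, (tr d).Adm A) ∧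
    ∀ d ∈ L, ∀ f ∈ L, head d = tail f → Disjoint A (tr d).items ∨ (tr f).items ⊆ A
  cover : L.biUnion (fun d => (tr d).items) = Finset.range n
  disj : ∀ d ∈ L, ∀ f ∈ L, d ≠ f → Disjoint (tr d).items (tr f).items

namespace BlockInv

variable {n : ℕ} {Up : Finset ℕ → Prop} {L : Finset ℕ} {tail head : ℕ → ℕ} {tr : ℕ → SPTree}
  {D b N : ℕ}

lemma cover_merge (h : BlockInv n Up L tail head tr) (hD : D ∈ L) (hb : b ∈ L) (hN : N ∉ L)
    (ser : Bool) : (mergeBlocks L D b N).biUnion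
      (fun d => (Function.update tr N (.node ser (tr D) (tr b)) d).items) = Finset.range n := by
  rw [← h.cover]
  ext v
  simp only [Finset.mem_biUnion, mem_mergeBlocks]
  constructor
  · rintro ⟨d, rfl | ⟨h1, h2, h3⟩, hv⟩
    · rw [Function.update_self] at hv
      rcases Finset.mem_union.1 hv with hv | hv
      exacts [⟨D, hD, hv⟩, ⟨b, hb, hv⟩]
    · rw [Function.update_of_ne (ne_of_mem_of_not_mem h3 hN)] at hv
      exact ⟨d, h3, hv⟩
  · rintro ⟨d, hd, hv⟩
    by_cases h1 : d = D
    · refine ⟨N, Or.inl rfl, ?_⟩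
      rw [Function.update_self]
      exact Finset.mem_union_left _ (h1 ▸ hv)
    by_cases h2 : d = b
    · refine ⟨N, Or.inl rfl, ?_⟩
      rw [Function.update_self]
      exact Finset.mem_union_right _ (h2 ▸ hv)
    refine ⟨d, Or.inr ⟨h2, h1, hd⟩, ?_⟩
    rwa [Function.update_of_ne (ne_of_mem_of_not_mem hd hN)]

lemma disj_merge (h : BlockInv n Up L tail head tr) (hD : D ∈ L) (hb : b ∈ L) (hN : N ∉ L)
    (ser : Bool) : ∀ d ∈ mergeBlocks L D b N, ∀ f ∈ mergeBlocks L D b N, d ≠ f →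
      Disjoint (Function.update tr N (.node ser (tr D) (tr b)) d).items
        (Function.update tr N (.node ser (tr D) (tr b)) f).items := by
  have key : ∀ f, f ≠ b → f ≠ D → f ∈ L →
      Disjoint (Function.update tr N (.node ser (tr D) (tr b)) N).items
        (Function.update tr N (.node ser (tr D) (tr b)) f).items := by
    intro f h1 h2 h3
    rw [Function.update_self, Function.update_of_ne (ne_of_mem_of_not_mem h3 hN), SPTree.items,
      Finset.disjoint_union_left]
    exact ⟨h.disj _ hD _ h3 h2.symm, h.disj _ hb _ h3 h1.symm⟩
  intro d hd f hf hdf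
  rcases mem_mergeBlocks.1 hd with rfl | ⟨h1, h2, h3⟩ <;>
    rcases mem_mergeBlocks.1 hf with rfl | ⟨h4, h5, h6⟩
  · exact absurd rfl hdf
  · exact key f h4 h5 h6
  · exact (key d h1 h2 h3).symm
  · rw [Function.update_of_ne (ne_of_mem_of_not_mem h3 hN), Function.update_of_ne (ne_of_mem_of_not_mem h6 hN)]
    exact h.disj _ h3 _ h6 hdf

/-- Merging two parallel blocks. -/
lemma par (h : BlockInv n Up L tail head tr) (hD : D ∈ L) (hb : b ∈ L) (hne : b ≠ D)
    (hN : N ∉ L) (ht : tail b = tail D) (hh : head b = head D) :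
    BlockInv n Up (mergeBlocks L D b N) (Function.update tail N (tail D))
      (Function.update head N (head D))
      (Function.update tr N (.node false (tr D) (tr b))) where
  ttsp := by
    have h1 := h.ttsp
    rw [blockArcs_eq_cons hD hb hne, ht, hh] at h1
    have h2 := h1.erase_of_two_le_count (tail D, head D) (by
      rw [Multiset.count_cons_self, Multiset.count_cons_self]
      omega)
    rw [Multiset.erase_cons_head] at h2
    rwa [blockArcs_mergeBlocks hN]
  cover := h.cover_merge hD hb hN _
  disj := h.disj_merge hD hb hN _
  up_iff A := by
    have hu : ∀ d ∈ L, d ≠ N := fun d hd h => hN (h ▸ hd)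
    rw [h.up_iff]
    constructor
    · rintro ⟨h1, h2⟩
      refine ⟨fun d hd => ?_, fun d hd f hf hdf => ?_⟩
      · rcases mem_mergeBlocks.1 hd with rfl | ⟨-, -, h3⟩
        · rw [Function.update_self]
          exact ⟨h1 _ hD, h1 _ hb, fun h => by simp at h⟩
        · rw [Function.update_of_ne (hu d h3)]
          exact h1 d h3
      · have key : ∀ e ∈ L, e ≠ N := hu
        have kd : ∀ f ∈ L, head D = tail f →
            Disjoint A ((tr D).items ∪ (tr b).items) ∨ (tr f).items ⊆ A := by
          intro f hf hdf
          rcases h2 D hD f hf hdf with h3 | h3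
          · rcases h2 b hb f hf (hh.trans hdf) with h4 | h4
            · exact Or.inl (Finset.disjoint_union_right.2 ⟨h3, h4⟩)
            · exact Or.inr h4
          · exact Or.inr h3
        rcases mem_mergeBlocks.1 hd with rfl | ⟨h4, h5, h6⟩ <;>
          rcases mem_mergeBlocks.1 hf with rfl | ⟨h7, h8, h9⟩
        -- The new block cannot follow itself, but this case yields to the same argument and need
        -- not be excluded.
        · rw [Function.update_self, Function.update_self] at hdf
          rw [Function.update_self]
          rcases kd D hD hdf with h3 | h3
          · exact Or.inl h3
          · rcases kd b hb (hdf.trans ht.symm) with h4 | h4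
            · exact Or.inl h4
            · exact Or.inr (Finset.union_subset h3 h4)
        · rw [Function.update_self, Function.update_of_ne (hu f h9)] at hdf
          rw [Function.update_self, Function.update_of_ne (hu f h9)]
          exact kd f h9 hdf
        · rw [Function.update_self, Function.update_of_ne (hu d h6)] at hdf
          rw [Function.update_self, Function.update_of_ne (hu d h6)]
          rcases h2 d h6 D hD hdf with h3 | h3
          · exact Or.inl h3
          · rcases h2 d h6 b hb (hdf.trans ht.symm) with h4 | h4
            · exact Or.inl h4
            · exact Or.inr (Finset.union_subset h3 h4)
        · rw [Function.update_of_ne (hu f h9), Function.update_of_ne (hu d h6)] at hdf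
          rw [Function.update_of_ne (hu f h9), Function.update_of_ne (hu d h6)]
          exact h2 d h6 f h9 hdf
    · rintro ⟨h1, h2⟩
      have hNm : N ∈ mergeBlocks L D b N := mem_mergeBlocks.2 (Or.inl rfl)
      have hAN := h1 N hNm
      rw [Function.update_self] at hAN
      -- every old block is part of a new one with the same ends
      have lift : ∀ d ∈ L, ∃ d' ∈ mergeBlocks L D b N,
          Function.update tail N (tail D) d' = tail d ∧
          Function.update head N (head D) d' = head d ∧
          (tr d).items ⊆ (Function.update tr N (.node false (tr D) (tr b)) d').items := by
        intro d hd
        by_cases h3 : d = D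
        · refine ⟨N, hNm, ?_⟩
          simp only [Function.update_self, h3, true_and]
          exact Finset.subset_union_left
        by_cases h4 : d = b
        · refine ⟨N, hNm, ?_⟩
          simp only [Function.update_self, h4, ht, hh, true_and]
          exact Finset.subset_union_right
        refine ⟨d, mem_mergeBlocks.2 (Or.inr ⟨h4, h3, hd⟩), ?_⟩
        simp [Function.update_of_ne (hu d hd)]
      refine ⟨fun d hd => ?_, fun d hd f hf hdf => ?_⟩
      · by_cases h3 : d = D
        · exact h3 ▸ hAN.1
        by_cases h4 : d = b
        · exact h4 ▸ hAN.2.1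
        have := h1 d (mem_mergeBlocks.2 (Or.inr ⟨h4, h3, hd⟩))
        rwa [Function.update_of_ne (hu d hd)] at this
      · obtain ⟨d', hd', -, h4, h5⟩ := lift d hd
        obtain ⟨f', hf', h6, -, h8⟩ := lift f hf
        exact (h2 d' hd' f' hf' (h4.trans (hdf.trans h6.symm))).imp
          (fun h => h.mono_right h5) fun h => h8.trans h

/-- Merging the only block `D` that ends in a vertex with the only block `b` that starts there. -/
lemma ser (h : BlockInv n Up L tail head tr) (hD : D ∈ L) (hb : b ∈ L) (hN : N ∉ L)
    (hx : head D = tail b) (hin : ∀ d ∈ L, head d = head D → d = D)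
    (hout : ∀ d ∈ L, tail d = tail b → d = b) :
    BlockInv n Up (mergeBlocks L D b N) (Function.update tail N (tail D))
      (Function.update head N (head b))
      (Function.update tr N (.node true (tr D) (tr b))) where
  ttsp := by
    have hne : b ≠ D := by
      rintro rfl
      exact h.ttsp.fst_ne_snd _ (mem_blockArcs.2 ⟨b, hb, rfl⟩) hx.symm
    rw [blockArcs_mergeBlocks hN]
    refine h.ttsp.contract (tail D) (head D) (head b) _ ?_ ?_ ?_ ?_
    · rw [blockArcs_eq_cons hD hb hne, ← hx]
    · rintro ⟨e, he, hex⟩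
      obtain ⟨d, hd, rfl⟩ := mem_blockArcs.1 he
      simp only [Finset.mem_erase] at hd
      rcases hex with hex | hex
      · exact hd.1 (hout d hd.2.2 (hex.trans hx))
      · exact hd.2.1 (hin d hd.2.2 hex)
    · exact h.ttsp.snd_ne_source _ (mem_blockArcs.2 ⟨D, hD, rfl⟩)
    · rw [hx]
      exact h.ttsp.fst_ne_target _ (mem_blockArcs.2 ⟨b, hb, rfl⟩)
  cover := h.cover_merge hD hb hN _
  disj := h.disj_merge hD hb hN _
  up_iff A := by
    have hu : ∀ d ∈ L, d ≠ N := fun d hd h => hN (h ▸ hd)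
    -- Blocks are nonempty, so a block contained in `A` meets `A`.
    have touch : ∀ d, (tr d).items ⊆ A → ¬ Disjoint A (tr d).items := by
      intro d h1 h2
      obtain ⟨v, hv⟩ := (tr d).items_nonempty
      exact Finset.disjoint_left.1 h2 (h1 hv) hv
    rw [h.up_iff]
    constructor
    · rintro ⟨h1, h2⟩
      -- This is the condition at the new series node. If `A` contains `D`, then it contains `b`; if
      -- it avoids `b`, then it avoids `D`. Hence conditions on one of the two blocks extend to
      -- their union.
      have hDb := h2 D hD b hb hx
      -- a block in front of `D`, and a block behind `b`
      have front : ∀ d ∈ L, head d = tail D →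
          Disjoint A (tr d).items ∨ (tr D).items ∪ (tr b).items ⊆ A := by
        intro d hd hdD
        rcases h2 d hd D hD hdD with h3 | h3
        · exact Or.inl h3
        · exact Or.inr (Finset.union_subset h3 (hDb.resolve_left (touch D h3)))
      have back : ∀ f ∈ L, head b = tail f →
          Disjoint A ((tr D).items ∪ (tr b).items) ∨ (tr f).items ⊆ A := by
        intro f hf hbf
        rcases h2 b hb f hf hbf with h3 | h3
        · refine Or.inl (Finset.disjoint_union_right.2 ⟨hDb.resolve_right fun h4 => ?_, h3⟩)
          exact touch b h4 h3
        · exact Or.inr h3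
      refine ⟨fun d hd => ?_, fun d hd f hf hdf => ?_⟩
      · rcases mem_mergeBlocks.1 hd with rfl | ⟨-, -, h3⟩
        · rw [Function.update_self]
          exact ⟨h1 _ hD, h1 _ hb, fun _ => hDb⟩
        · rw [Function.update_of_ne (hu d h3)]
          exact h1 d h3
      · rcases mem_mergeBlocks.1 hd with rfl | ⟨h4, h5, h6⟩ <;>
          rcases mem_mergeBlocks.1 hf with rfl | ⟨h7, h8, h9⟩
        · rw [Function.update_self, Function.update_self] at hdf
          rw [Function.update_self]
          rcases back D hD hdf with h3 | h3
          · exact Or.inl h3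
          · exact Or.inr (Finset.union_subset h3 (hDb.resolve_left (touch D h3)))
        · rw [Function.update_self, Function.update_of_ne (hu f h9)] at hdf
          rw [Function.update_self, Function.update_of_ne (hu f h9)]
          exact back f h9 hdf
        · rw [Function.update_self, Function.update_of_ne (hu d h6)] at hdf
          rw [Function.update_self, Function.update_of_ne (hu d h6)]
          exact front d h6 hdf
        · rw [Function.update_of_ne (hu f h9), Function.update_of_ne (hu d h6)] at hdf
          rw [Function.update_of_ne (hu f h9), Function.update_of_ne (hu d h6)]
          exact h2 d h6 f h9 hdf
    · rintro ⟨h1, h2⟩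
      have hNm : N ∈ mergeBlocks L D b N := mem_mergeBlocks.2 (Or.inl rfl)
      have hAN := h1 N hNm
      rw [Function.update_self] at hAN
      have asHead : ∀ d ∈ L, d ≠ D → ∃ d' ∈ mergeBlocks L D b N,
          Function.update head N (head b) d' = head d ∧
          (tr d).items ⊆ (Function.update tr N (.node true (tr D) (tr b)) d').items := by
        intro d hd h3
        by_cases h4 : d = b
        · refine ⟨N, hNm, ?_⟩
          simp only [Function.update_self, h4, true_and]
          exact Finset.subset_union_right
        refine ⟨d, mem_mergeBlocks.2 (Or.inr ⟨h4, h3, hd⟩), ?_⟩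
        simp [Function.update_of_ne (hu d hd)]
      have asTail : ∀ d ∈ L, d ≠ b → ∃ d' ∈ mergeBlocks L D b N,
          Function.update tail N (tail D) d' = tail d ∧
          (tr d).items ⊆ (Function.update tr N (.node true (tr D) (tr b)) d').items := by
        intro d hd h3
        by_cases h4 : d = D
        · refine ⟨N, hNm, ?_⟩
          simp only [Function.update_self, h4, true_and]
          exact Finset.subset_union_left
        refine ⟨d, mem_mergeBlocks.2 (Or.inr ⟨h3, h4, hd⟩), ?_⟩
        simp [Function.update_of_ne (hu d hd)]
      refine ⟨fun d hd => ?_, fun d hd f hf hdf => ?_⟩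
      · by_cases h3 : d = D
        · exact h3 ▸ hAN.1
        by_cases h4 : d = b
        · exact h4 ▸ hAN.2.1
        have := h1 d (mem_mergeBlocks.2 (Or.inr ⟨h4, h3, hd⟩))
        rwa [Function.update_of_ne (hu d hd)] at this
      -- The adjacency from `D` to `b` is the only one that disappears, and the new node keeps its
      -- condition. In every other adjacency the first block is not `D` and the second is not `b`,
      -- so the meeting vertex survives.
      · by_cases h3 : d = D
        · subst h3
          obtain rfl := hout f hf (hdf.symm.trans hx)
          exact hAN.2.2 rfl
        have h4 : f ≠ b := by
          rintro rfl
          exact h3 (hin d hd (hdf.trans hx.symm))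
        obtain ⟨d', hd', h5, h6⟩ := asHead d hd h3
        obtain ⟨f', hf', h7, h8⟩ := asTail f hf h4
        exact (h2 d' hd' f' hf' (h5.trans (hdf.trans h7.symm))).imp
          (fun h => h.mono_right h6) fun h => h8.trans h

end BlockInv

/-! ### The invariant of the reduction -/

section Degrees

variable {L : Finset ℕ} {tail head : ℕ → ℕ} {D b N x : ℕ}

lemma indeg_blockArcs : indeg (blockArcs L tail head) x = (L.filter fun d => head d = x).card := by
  rw [indeg, blockArcs, Multiset.countP_map]
  rfl

lemma outdeg_blockArcs : outdeg (blockArcs L tail head) x = (L.filter fun d => tail d = x).card := by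
  rw [outdeg, blockArcs, Multiset.countP_map]
  rfl

lemma indeg_cons {E : Multiset (ℕ × ℕ)} {u v : ℕ} :
    indeg ((u, v) ::ₘ E) x = indeg E x + if v = x then 1 else 0 := by
  rw [indeg, Multiset.countP_cons]
  rfl

lemma indeg_merge_par (hD : D ∈ L) (hb : b ∈ L) (hne : b ≠ D) (hN : N ∉ L)
    (hh : head b = head D) :
    indeg (blockArcs L tail head) x = indeg (blockArcs (mergeBlocks L D b N)
      (Function.update tail N (tail D)) (Function.update head N (head D))) x +
      if head D = x then 1 else 0 := by
  rw [blockArcs_eq_cons hD hb hne, blockArcs_mergeBlocks hN, indeg_cons, indeg_cons, indeg_cons, hh]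

/-- The new block enters `head b` in place of `b`. So a series merge requires no update of the
counters except at the contracted vertex, where no block ends any more. -/
lemma indeg_merge_ser (hD : D ∈ L) (hb : b ∈ L) (hne : b ≠ D) (hN : N ∉ L) (hx : head D ≠ x) :
    indeg (blockArcs L tail head) x = indeg (blockArcs (mergeBlocks L D b N)
      (Function.update tail N (tail D)) (Function.update head N (head b))) x := by
  rw [blockArcs_eq_cons hD hb hne, blockArcs_mergeBlocks hN, indeg_cons, indeg_cons, indeg_cons,
    if_neg hx, add_zero]

end Degrees

/-- `q` lists the items in a topological order in which the items with the same tail stand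
together. Here item `v` leads from `tl v` to `hd v`. -/
structure ItemOrder (n : ℕ) (q tl hd : ℕ → ℕ) : Prop where
  lt : ∀ i < n, q i < n
  inj : ∀ i < n, ∀ j < n, q i = q j → i = j
  topo : ∀ i < n, ∀ j < n, hd (q i) = tl (q j) → i < j
  contig : ∀ i j l, i < j → j < l → l < n → tl (q i) = tl (q l) → tl (q j) = tl (q i)
  tl_le : ∀ v < n, tl v ≤ n
  hd_le : ∀ v < n, hd v ≤ n + 1

/-- The block `d` consists of items that stand at the positions from `k` on in the order `q`. -/
def Done (q : ℕ → ℕ) (k : ℕ) (L : Finset ℕ) (d : ℕ) : Prop := d ∈ L ∧ ∀ i < k, q i ≠ d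

/-- The invariant of the reduction when the items at the positions from `k` on have been processed
and `y` is the tail of the item at the position `k`. The blocks with a tail other than `y` are
stored in `node`, the ones with tail `y` are stored at their heads in `temp`. The block `hp` is
exempt from the requirement that it is stored and that its head has another incoming block, and the
block `ht` has not been stored in `temp`. -/
structure ReduceInv (n : ℕ) (Up : Finset ℕ → Prop) (q tl hd : ℕ → ℕ) (k y fresh : ℕ)
    (L : Finset ℕ) (tail head : ℕ → ℕ) (tr : ℕ → SPTree) (cnt temp node tag : ℕ → ℕ)
    (hp ht : Option ℕ) : Prop where
  block : BlockInv n Up L tail head tr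
  lt : ∀ d ∈ L, d < fresh
  n_le : n ≤ fresh
  card : L.card + fresh = 2 * n
  unproc : ∀ i < k, q i ∈ L
  tail_eq : ∀ v < n, tail v = tl v
  head_eq : ∀ v < n, head v = hd v
  cnt_eq : ∀ d ∈ L, cnt (head d) =
    indeg (blockArcs L tail head) (head d) + if head d = n + 1 then 1 else 0
  src : ∀ d, Done q k L d → ∃ i, k ≤ i ∧ i < n ∧ tl (q i) = tail d
  dst : ∀ d, Done q k L d → ∃ i, k ≤ i ∧ i < n ∧ hd (q i) = head d
  node_eq : ∀ d, Done q k L d → tail d ≠ y → node (tail d) = d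
  cur : k < n → y = tl (q k)
  pend : ∀ d, Done q k L d → some d ≠ hp → tail d = y →
    tag (head d) = y + 1 ∧ temp (head d) = d ∧ 2 ≤ cnt (head d)
  tagged : ∀ x, tag x = y + 1 → (∃ d ∈ L, head d = x) →
    Done q k L (temp x) ∧ some (temp x) ≠ ht ∧ tail (temp x) = y ∧ head (temp x) = x
  tag_src : ∀ x z, tag x = z + 1 → ∃ i, k ≤ i ∧ i < n ∧ tl (q i) = z

namespace ReduceInv

variable {n : ℕ} {Up : Finset ℕ → Prop} {q tl hd : ℕ → ℕ} {k y fresh : ℕ} {L : Finset ℕ}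
  {tail head : ℕ → ℕ} {tr : ℕ → SPTree} {cnt temp node tag : ℕ → ℕ} {hp ht : Option ℕ} {D : ℕ}

lemma fresh_notMem (h : ReduceInv n Up q tl hd k y fresh L tail head tr cnt temp node tag hp ht) :
    fresh ∉ L := fun hf => (h.lt _ hf).false

lemma head_ne_tail (h : ReduceInv n Up q tl hd k y fresh L tail head tr cnt temp node tag hp ht)
    {d : ℕ} (hd : d ∈ L) : head d ≠ tail d :=
  (h.block.ttsp.fst_ne_snd _ (mem_blockArcs.2 ⟨d, hd, rfl⟩)).symm

/-- The block `D` gets stored at its head, where no other block is stored. -/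
lemma store (h : ReduceInv n Up q tl hd k y fresh L tail head tr cnt temp node tag
      (some D) (some D))
    (hD : Done q k L D) (hy : tail D = y) (hk : k < n) (htag : tag (head D) ≠ y + 1) :
    ReduceInv n Up q tl hd k y fresh L tail head tr cnt (Function.update temp (head D) D) node
      (Function.update tag (head D) (y + 1)) (some D) none where
  __ := h
  pend d hd hdD hdy := by
    obtain ⟨h1, h2, h3⟩ := h.pend d hd hdD hdy
    have : head d ≠ head D := fun h4 => htag (h4 ▸ h1)
    rw [Function.update_of_ne this, Function.update_of_ne this]
    exact ⟨h1, h2, h3⟩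
  tagged x hx hdx := by
    by_cases hxD : x = head D
    · subst hxD
      rw [Function.update_self]
      exact ⟨hD, by simp, hy, rfl⟩
    · rw [Function.update_of_ne hxD] at hx ⊢
      obtain ⟨h1, -, h3⟩ := h.tagged x hx hdx
      exact ⟨h1, by simp, h3⟩
  tag_src x z hx := by
    by_cases hxD : x = head D
    · rw [hxD, Function.update_self] at hx
      exact ⟨k, le_rfl, hk, by rw [← h.cur hk]; omega⟩
    · rw [Function.update_of_ne hxD] at hx
      exact h.tag_src x z hx

/-- The block `D` gets merged with the parallel block that is stored at its head. -/
lemma mergePar (h : ReduceInv n Up q tl hd k y fresh L tail head tr cnt temp node tag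
      (some D) (some D))
    (hD : Done q k L D) (hy : tail D = y) (htag : tag (head D) = y + 1) :
    Done q k L (temp (head D)) ∧ temp (head D) ≠ D ∧ tail (temp (head D)) = y ∧
    head (temp (head D)) = head D ∧
    Done q k (mergeBlocks L (temp (head D)) D fresh) fresh ∧
    ReduceInv n Up q tl hd k y (fresh + 1) (mergeBlocks L (temp (head D)) D fresh)
      (Function.update tail fresh y) (Function.update head fresh (head D))
      (Function.update tr fresh (.node false (tr (temp (head D))) (tr D)))
      (Function.update cnt (head D) (cnt (head D) - 1)) (Function.update temp (head D) fresh) node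
      (Function.update tag (head D) (y + 1)) (some fresh) none := by
  obtain ⟨hl, hne, hly, hlx⟩ := h.tagged _ htag ⟨D, hD.1, rfl⟩
  have hne : D ≠ temp (head D) := fun h => hne (congrArg some h.symm)
  have hN := h.fresh_notMem
  have hu : ∀ d ∈ L, d ≠ fresh := fun d hd h => hN (h ▸ hd)
  have hb := h.block.par hl.1 hD.1 hne hN (hy.trans hly.symm) hlx.symm
  rw [hly, hlx] at hb
  have hdone : ∀ d, Done q k (mergeBlocks L (temp (head D)) D fresh) d →
      d = fresh ∨ d ≠ D ∧ d ≠ temp (head D) ∧ Done q k L d := by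
    intro d hd
    exact (mem_mergeBlocks.1 hd.1).imp_right fun h => ⟨h.1, h.2.1, h.2.2, hd.2⟩
  have hmem : ∀ d, Done q k L d → d ≠ D → d ≠ temp (head D) →
      Done q k (mergeBlocks L (temp (head D)) D fresh) d := fun d hd h1 h2 =>
    ⟨mem_mergeBlocks.2 (Or.inr ⟨h1, h2, hd.1⟩), hd.2⟩
  have hNdone : Done q k (mergeBlocks L (temp (head D)) D fresh) fresh :=
    ⟨mem_mergeBlocks.2 (Or.inl rfl), fun i hi => hu _ (h.unproc i hi)⟩
  have hind : ∀ x, indeg (blockArcs L tail head) x = indeg (blockArcs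
      (mergeBlocks L (temp (head D)) D fresh) (Function.update tail fresh y)
      (Function.update head fresh (head D))) x + if head D = x then 1 else 0 := by
    intro x
    have := indeg_merge_par (x := x) (tail := tail) hl.1 hD.1 hne hN hlx.symm
    rwa [hly, hlx] at this
  have hcnt : ∀ d ∈ L, Function.update cnt (head D) (cnt (head D) - 1) (head d) =
      indeg (blockArcs (mergeBlocks L (temp (head D)) D fresh) (Function.update tail fresh y)
      (Function.update head fresh (head D))) (head d) + if head d = n + 1 then 1 else 0 := by
    intro d hd
    have h1 := h.cnt_eq d hd
    rw [hind] at h1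
    by_cases hdx : head d = head D
    · rw [hdx, Function.update_self]
      rw [hdx, if_pos rfl] at h1
      omega
    · rw [Function.update_of_ne hdx, h1, if_neg (Ne.symm hdx)]
      rfl
  refine ⟨hl, hne.symm, hly, hlx, hNdone, ?_⟩
  exact {
    block := hb
    lt := by
      intro d hd
      rcases mem_mergeBlocks.1 hd with rfl | ⟨-, -, h1⟩
      · omega
      · have := h.lt d h1
        omega
    n_le := by
      have := h.n_le
      omega
    card := by
      have := card_mergeBlocks hl.1 hD.1 hne hN
      have := h.card
      omega
    unproc := fun i hi => mem_mergeBlocks.2 (Or.inr ⟨hD.2 i hi, hl.2 i hi, h.unproc i hi⟩)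
    tail_eq := fun v hv => by
      rw [Function.update_of_ne (hv.trans_le h.n_le).ne, h.tail_eq v hv]
    head_eq := fun v hv => by
      rw [Function.update_of_ne (hv.trans_le h.n_le).ne, h.head_eq v hv]
    cnt_eq := by
      intro d hd
      rcases mem_mergeBlocks.1 hd with rfl | ⟨-, -, h1⟩
      · rw [Function.update_self]
        exact hcnt D hD.1
      · rw [Function.update_of_ne (hu d h1)]
        exact hcnt d h1
    src := by
      intro d hd
      rcases hdone d hd with rfl | ⟨-, -, h1⟩
      · rw [Function.update_self, ← hy]
        exact h.src D hD
      · rw [Function.update_of_ne (hu d h1.1)]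
        exact h.src d h1
    dst := by
      intro d hd
      rcases hdone d hd with rfl | ⟨-, -, h1⟩
      · rw [Function.update_self]
        exact h.dst D hD
      · rw [Function.update_of_ne (hu d h1.1)]
        exact h.dst d h1
    node_eq := by
      intro d hd hdy
      rcases hdone d hd with rfl | ⟨-, -, h1⟩
      · exact absurd (Function.update_self ..) hdy
      · rw [Function.update_of_ne (hu d h1.1)] at hdy ⊢
        exact h.node_eq d h1 hdy
    cur := h.cur
    pend := by
      intro d hd hdf hdy
      rcases hdone d hd with rfl | ⟨h1, h2, h3⟩
      · exact absurd rfl hdf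
      · rw [Function.update_of_ne (hu d h3.1)] at hdy
        rw [Function.update_of_ne (hu d h3.1)]
        obtain ⟨h4, h5, h6⟩ := h.pend d h3 (fun h => h1 (Option.some.inj h)) hdy
        -- A stored block with this head would be `temp (head D)` itself, which has just been
        -- merged.
        have : head d ≠ head D := fun h7 => h2 (by rw [← h7, h5])
        rw [Function.update_of_ne this, Function.update_of_ne this, Function.update_of_ne this]
        exact ⟨h4, h5, h6⟩
    tagged := by
      intro x hx hdx
      by_cases hxD : x = head D
      · rw [hxD, Function.update_self, Function.update_self, Function.update_self]
        exact ⟨hNdone, by simp, rfl, rfl⟩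
      · rw [Function.update_of_ne hxD] at hx ⊢
        obtain ⟨d, hd, hdx⟩ := hdx
        have : ∃ d ∈ L, head d = x := by
          rcases mem_mergeBlocks.1 hd with rfl | ⟨-, -, h1⟩
          · rw [Function.update_self] at hdx
            exact absurd hdx.symm hxD
          · rw [Function.update_of_ne (hu d h1)] at hdx
            exact ⟨d, h1, hdx⟩
        obtain ⟨h1, h2, h3, h4⟩ := h.tagged x hx this
        rw [Function.update_of_ne (hu _ h1.1), Function.update_of_ne (hu _ h1.1)]
        refine ⟨hmem _ h1 (fun h => h2 (congrArg some h)) (fun h5 => hxD ?_), by simp, h3, h4⟩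
        rw [← h4, h5, hlx]
    tag_src := by
      intro x z hx
      by_cases hxD : x = head D
      · rw [hxD, Function.update_self, ← htag] at hx
        exact h.tag_src _ z hx
      · rw [Function.update_of_ne hxD] at hx
        exact h.tag_src x z hx }

/-- The head of the block `D` has no other incoming block; then `D` gets merged with the block
that starts there. -/
lemma mergeSer (horder : ItemOrder n q tl hd)
    (h : ReduceInv n Up q tl hd k y fresh L tail head tr cnt temp node tag (some D) none)
    (hD : Done q k L D) (hy : tail D = y) (hcnt : cnt (head D) < 2) :
    Done q k L (node (head D)) ∧ node (head D) ≠ D ∧ tail (node (head D)) = head D ∧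
    Done q k (mergeBlocks L D (node (head D)) fresh) fresh ∧
    ReduceInv n Up q tl hd k y (fresh + 1) (mergeBlocks L D (node (head D)) fresh)
      (Function.update tail fresh y) (Function.update head fresh (head (node (head D))))
      (Function.update tr fresh (.node true (tr D) (tr (node (head D)))))
      cnt temp node tag (some fresh) (some fresh) := by
  have hN := h.fresh_notMem
  have hu : ∀ d ∈ L, d ≠ fresh := fun d hd h => hN (h ▸ hd)
  have hDarc := mem_blockArcs.2 ⟨D, hD.1, (rfl : (tail D, head D) = _)⟩
  have hpos : 0 < indeg (blockArcs L tail head) (head D) := indeg_pos hDarc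
  have h1 := h.cnt_eq D hD.1
  -- The counter of the target exceeds its indegree by one, so it is at least two as long as a block
  -- ends there.
  have hxT : head D ≠ n + 1 := by
    intro h2
    rw [if_pos h2] at h1
    omega
  rw [if_neg hxT, add_zero] at h1
  have hin : ∀ d ∈ L, head d = head D → d = D := by
    have h2 : (L.filter fun d => head d = head D).card ≤ 1 := by
      rw [← indeg_blockArcs (tail := tail)]
      omega
    intro d hd hdD
    exact Finset.card_le_one.1 h2 d (Finset.mem_filter.2 ⟨hd, hdD⟩) D
      (Finset.mem_filter.2 ⟨hD.1, rfl⟩)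
  have hxy : head D ≠ y := hy ▸ h.head_ne_tail hD.1
  -- Items leaving `head D` stand behind an item with that head in the topological order, so they
  -- have been processed. Hence every block leaving `head D` is recorded in `node`, and there is at
  -- most one.
  have hout : ∀ d ∈ L, tail d = head D → Done q k L d ∧ node (head D) = d := by
    intro d hd hdD
    have h2 : Done q k L d := by
      refine ⟨hd, ?_⟩
      rintro j hj rfl
      obtain ⟨i, hki, hin, hi⟩ := h.dst D hD
      have hjn : j < n := by omega
      rw [h.tail_eq _ (horder.lt j hjn), ← hi] at hdD
      have := horder.topo i hin j hjn hdD.symm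
      omega
    exact ⟨h2, by rw [← hdD]; exact h.node_eq d h2 (by rwa [hdD])⟩
  obtain ⟨e, he, hex⟩ := h.block.ttsp.exists_out (head D) (isEndpoint_snd hDarc) hxT
  obtain ⟨b, hb, rfl⟩ := mem_blockArcs.1 he
  obtain ⟨hbd, hnode⟩ := hout b hb hex
  rw [hnode]
  replace hout : ∀ d ∈ L, tail d = head D → d = b := fun d hd hdD =>
    (hout d hd hdD).2.symm.trans hnode
  have hex : tail b = head D := hex
  have hne : b ≠ D := by
    rintro rfl
    exact h.head_ne_tail hb hex.symm
  have hbl := h.block.ser hD.1 hb hN hex.symm hin (fun d hd h => hout d hd (h.trans hex))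
  rw [hy] at hbl
  have hdone : ∀ d, Done q k (mergeBlocks L D b fresh) d →
      d = fresh ∨ d ≠ b ∧ d ≠ D ∧ Done q k L d := by
    intro d hd
    exact (mem_mergeBlocks.1 hd.1).imp_right fun h => ⟨h.1, h.2.1, h.2.2, hd.2⟩
  have hNdone : Done q k (mergeBlocks L D b fresh) fresh :=
    ⟨mem_mergeBlocks.2 (Or.inl rfl), fun i hi => hu _ (h.unproc i hi)⟩
  have hcnt : ∀ d ∈ L, head d ≠ head D → cnt (head d) =
      indeg (blockArcs (mergeBlocks L D b fresh) (Function.update tail fresh y)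
      (Function.update head fresh (head b))) (head d) + if head d = n + 1 then 1 else 0 := by
    intro d hd hdD
    have := indeg_merge_ser (x := head d) (tail := tail) hD.1 hb hne hN hdD.symm
    rw [hy] at this
    rw [← this, h.cnt_eq d hd]
  have hbx : head b ≠ head D := hex ▸ h.head_ne_tail hb
  refine ⟨hbd, hne, hex, hNdone, ?_⟩
  exact {
    block := hbl
    lt := by
      intro d hd
      rcases mem_mergeBlocks.1 hd with rfl | ⟨-, -, h1⟩
      · omega
      · have := h.lt d h1
        omega
    n_le := by
      have := h.n_le
      omega
    card := by
      have := card_mergeBlocks hD.1 hb hne hN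
      have := h.card
      omega
    unproc := fun i hi => mem_mergeBlocks.2 (Or.inr ⟨hbd.2 i hi, hD.2 i hi, h.unproc i hi⟩)
    tail_eq := fun v hv => by
      rw [Function.update_of_ne (hv.trans_le h.n_le).ne, h.tail_eq v hv]
    head_eq := fun v hv => by
      rw [Function.update_of_ne (hv.trans_le h.n_le).ne, h.head_eq v hv]
    cnt_eq := by
      intro d hd
      rcases mem_mergeBlocks.1 hd with rfl | ⟨-, h0, h1⟩
      · rw [Function.update_self]
        exact hcnt b hb hbx
      · rw [Function.update_of_ne (hu d h1)]
        exact hcnt d h1 fun h2 => h0 (hin d h1 h2)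
    src := by
      intro d hd
      rcases hdone d hd with rfl | ⟨-, -, h1⟩
      · rw [Function.update_self, ← hy]
        exact h.src D hD
      · rw [Function.update_of_ne (hu d h1.1)]
        exact h.src d h1
    dst := by
      intro d hd
      rcases hdone d hd with rfl | ⟨-, -, h1⟩
      · rw [Function.update_self]
        exact h.dst b hbd
      · rw [Function.update_of_ne (hu d h1.1)]
        exact h.dst d h1
    node_eq := by
      intro d hd hdy
      rcases hdone d hd with rfl | ⟨-, -, h1⟩
      · exact absurd (Function.update_self ..) hdy
      · rw [Function.update_of_ne (hu d h1.1)] at hdy ⊢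
        exact h.node_eq d h1 hdy
    cur := h.cur
    pend := by
      intro d hd hdf hdy
      rcases hdone d hd with rfl | ⟨h1, h2, h3⟩
      · exact absurd rfl hdf
      · rw [Function.update_of_ne (hu d h3.1)] at hdy
        rw [Function.update_of_ne (hu d h3.1)]
        exact h.pend d h3 (fun h => h2 (Option.some.inj h)) hdy
    tagged := by
      intro x hx hdx
      -- The contracted vertex may keep its tag and an outdated entry of `temp`. The premise of
      -- `tagged` that some block ends in `x` rules it out.
      have hdx' : x ≠ head D ∧ ∃ d ∈ L, head d = x := by
        obtain ⟨d, hd, hdx⟩ := hdx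
        rcases mem_mergeBlocks.1 hd with rfl | ⟨-, h0, h1⟩
        · rw [Function.update_self] at hdx
          exact ⟨hdx ▸ hbx, b, hb, hdx⟩
        · rw [Function.update_of_ne (hu d h1)] at hdx
          refine ⟨?_, d, h1, hdx⟩
          rintro rfl
          exact h0 (hin d h1 hdx)
      obtain ⟨hxD, hdx⟩ := hdx'
      obtain ⟨h1, -, h3, h4⟩ := h.tagged x hx hdx
      have h5 : temp x ≠ b := by
        rintro rfl
        exact hxy (hex.symm.trans h3)
      have h6 : temp x ≠ D := by
        rintro rfl
        exact hxD h4.symm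
      rw [Function.update_of_ne (hu _ h1.1), Function.update_of_ne (hu _ h1.1)]
      exact ⟨⟨mem_mergeBlocks.2 (Or.inr ⟨h5, h6, h1.1⟩), h1.2⟩,
        fun h => hu _ h1.1 (Option.some.inj h), h3, h4⟩
    tag_src := h.tag_src }

/-- The block `D` is stored and its head has another incoming block. -/
lemma settle (h : ReduceInv n Up q tl hd k y fresh L tail head tr cnt temp node tag (some D) none)
    (htag : tag (head D) = y + 1) (htemp : temp (head D) = D) (hcnt : 2 ≤ cnt (head D)) :
    ReduceInv n Up q tl hd k y fresh L tail head tr cnt temp (Function.update node y D) tag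
      none none where
  __ := h
  node_eq d hd hdy := by
    rw [Function.update_of_ne hdy]
    exact h.node_eq d hd hdy
  pend d hd _ hdy := by
    by_cases hdD : d = D
    · rw [hdD]
      exact ⟨htag, htemp, hcnt⟩
    · exact h.pend d hd (fun h => hdD (Option.some.inj h)) hdy

/-- When all items with tail `y` have been processed, only one block starts in `y`. -/
lemma eq_node_of_tail_eq
    (h : ReduceInv n Up q tl hd k y fresh L tail head tr cnt temp node tag none none)
    (horder : ItemOrder n q tl hd) (hk : k ≤ n)
    (hlast : Done q k L (node y) ∧ tail (node y) = y) (hgroup : ∀ i < k, tl (q i) ≠ y) :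
    ∀ d ∈ L, tail d = y → d = node y := by
  have hdone : ∀ d ∈ L, tail d = y → Done q k L d := by
    refine fun d hd hdy => ⟨hd, ?_⟩
    rintro i hi rfl
    exact hgroup i hi (by rw [← h.tail_eq _ (horder.lt i (by omega)), hdy])
  -- All blocks leaving `y` are settled: each is determined by its head through `temp`, which
  -- excludes parallel blocks, and each head other than the target has indegree at least two. These
  -- are the hypotheses of `TTSP.outdeg_le_one`.
  have h1 : outdeg (blockArcs L tail head) y ≤ 1 := by
    refine h.block.ttsp.outdeg_le_one y fun e he hey => ?_
    obtain ⟨d, hd, rfl⟩ := mem_blockArcs.1 he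
    obtain ⟨h1, h2, h3⟩ := h.pend d (hdone d hd hey) (by simp) hey
    constructor
    · rw [blockArcs, Multiset.count_map]
      change (L.filter fun f => (tail d, head d) = (tail f, head f)).card ≤ 1
      rw [Finset.card_le_one]
      have key : ∀ f ∈ L.filter (fun f => (tail d, head d) = (tail f, head f)), f = d := by
        intro f hf
        obtain ⟨hf, hdf⟩ := Finset.mem_filter.1 hf
        have h4 := congrArg Prod.fst hdf
        have h5 : head d = head f := congrArg Prod.snd hdf
        have h6 : tail f = y := h4.symm.trans hey
        rw [← h2, h5, (h.pend f (hdone f hf h6) (by simp) h6).2.1]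
      exact fun f hf g hg => (key f hf).trans (key g hg).symm
    · intro hT
      have h4 := h.cnt_eq d hd
      rw [if_neg hT] at h4
      exact h3.trans_eq h4
  rw [outdeg_blockArcs, Finset.card_le_one] at h1
  exact fun d hd hdy => h1 d (Finset.mem_filter.2 ⟨hd, hdy⟩) _
    (Finset.mem_filter.2 ⟨hlast.1.1, hlast.2⟩)

/-- The next item gets processed. -/
lemma next (horder : ItemOrder n q tl hd) (hk : k < n)
    (h : ReduceInv n Up q tl hd (k + 1) y fresh L tail head tr cnt temp node tag none none)
    (hlast : k + 1 < n → Done q (k + 1) L (node y) ∧ tail (node y) = y) :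
    Done q k L (q k) ∧ tail (q k) = tl (q k) ∧
    ReduceInv n Up q tl hd k (tl (q k)) fresh L tail head tr cnt temp node tag
      (some (q k)) (some (q k)) := by
  have hqk := horder.lt k hk
  have hdone : ∀ d, Done q k L d → d ≠ q k → Done q (k + 1) L d := by
    refine fun d hd hne => ⟨hd.1, fun i hi => ?_⟩
    rcases Nat.lt_succ_iff_lt_or_eq.1 hi with hi | rfl
    exacts [hd.2 i hi, hne.symm]
  have hdone' : ∀ d, Done q (k + 1) L d → Done q k L d ∧ d ≠ q k := fun d hd =>
    ⟨⟨hd.1, fun i hi => hd.2 i (by omega)⟩, (hd.2 k (by omega)).symm⟩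
  -- By contiguity, a tail shared by position `k` and a later position is also the tail at position
  -- `k + 1`, which is `y`. So blocks and tags belonging to the tail of `q k` exist only if the
  -- group of `y` goes on.
  have hsrc : ∀ i, k + 1 ≤ i → i < n → tl (q i) = tl (q k) → tl (q k) = y := by
    intro i h1 h2 h3
    rw [h.cur (by omega)]
    rcases eq_or_lt_of_le h1 with rfl | h1
    · exact h3.symm
    · exact (horder.contig k (k + 1) i (by omega) h1 h2 h3.symm).symm
  refine ⟨⟨h.unproc k (by omega), fun i hi hik => ?_⟩, h.tail_eq _ hqk, ?_⟩
  · have := horder.inj i (by omega) k hk hik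
    omega
  exact {
    block := h.block
    lt := h.lt
    n_le := h.n_le
    card := h.card
    unproc := fun i hi => h.unproc i (by omega)
    tail_eq := h.tail_eq
    head_eq := h.head_eq
    cnt_eq := h.cnt_eq
    src := by
      intro d hd
      by_cases hdq : d = q k
      · rw [hdq, h.tail_eq _ hqk]
        exact ⟨k, le_rfl, hk, rfl⟩
      · obtain ⟨i, h1, h2⟩ := h.src d (hdone d hd hdq)
        exact ⟨i, by omega, h2⟩
    dst := by
      intro d hd
      by_cases hdq : d = q k
      · rw [hdq, h.head_eq _ hqk]
        exact ⟨k, le_rfl, hk, rfl⟩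
      · obtain ⟨i, h1, h2⟩ := h.dst d (hdone d hd hdq)
        exact ⟨i, by omega, h2⟩
    node_eq := by
      intro d hd hdy
      have hdq : d ≠ q k := by
        rintro rfl
        exact hdy (h.tail_eq _ hqk)
      have hd' := hdone d hd hdq
      -- If `d` starts in `y`, then the tail has changed and the group of `y` is complete by
      -- contiguity. So `d` is its only block, the one that has been stored.
      by_cases hy : tail d = y
      · have hk1 : k + 1 < n := by
          obtain ⟨i, h1, h2, -⟩ := h.src d hd'
          omega
        rw [hy]
        refine (h.eq_node_of_tail_eq horder hk1.le (hlast hk1) (fun i hi hiy => ?_) d hd.1 hy).symm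
        rcases Nat.lt_succ_iff_lt_or_eq.1 hi with hi | rfl
        · have := horder.contig i k (k + 1) hi (by omega) hk1 (by rw [hiy, h.cur hk1])
          exact hdy (by rw [this, hiy, hy])
        · exact hdy (by rw [hiy, hy])
      · exact h.node_eq d hd' hy
    cur := fun _ => rfl
    pend := by
      intro d hd hdq hdy
      have hd' := hdone d hd fun h => hdq (congrArg some h)
      obtain ⟨i, h1, h2, h3⟩ := h.src d hd'
      have hy := hsrc i h1 h2 (h3.trans hdy)
      rw [hy] at hdy ⊢
      exact h.pend d hd' (by simp) hdy
    tagged := by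
      intro x hx hdx
      obtain ⟨i, h1, h2, h3⟩ := h.tag_src x _ hx
      have hy := hsrc i h1 h2 h3
      rw [hy] at hx ⊢
      obtain ⟨h4, -, h5⟩ := h.tagged x hx hdx
      exact ⟨(hdone' _ h4).1, fun h => (hdone' _ h4).2 (Option.some.inj h), h5⟩
    tag_src := by
      intro x z hx
      obtain ⟨i, h1, h2⟩ := h.tag_src x z hx
      exact ⟨i, by omega, h2⟩ }

/-- When all items have been processed, a single block is left, which is stored at the source. -/
lemma eq_singleton (horder : ItemOrder n q tl hd) (hn : 0 < n)
    (h : ReduceInv n Up q tl hd 0 y fresh L tail head tr cnt temp node tag none none)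
    (hlast : Done q 0 L (node y) ∧ tail (node y) = y) :
    L = {node 0} ∧ head (node 0) ≠ tail (node 0) := by
  -- Any other vertex is entered by a block, hence is the head of an item, which would have to
  -- precede the first item of the order.
  have hy : y = 0 := by
    by_contra hy
    obtain ⟨e, he, hey⟩ := h.block.ttsp.exists_in y
      (isEndpoint_fst (mem_blockArcs.2 ⟨node y, hlast.1.1, Prod.ext hlast.2 rfl⟩ :
        (y, head (node y)) ∈ _)) hy
    obtain ⟨d, hd, rfl⟩ := mem_blockArcs.1 he
    obtain ⟨i, -, hi, hid⟩ := h.dst d ⟨hd, fun _ h => by omega⟩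
    have := horder.topo i hi 0 hn (by rw [hid, ← h.cur hn]; exact hey)
    omega
  subst hy
  have h1 := h.eq_node_of_tail_eq horder (Nat.zero_le _) hlast fun i hi => by omega
  have h2 : outdeg (blockArcs L tail head) 0 ≤ 1 := by
    rw [outdeg_blockArcs, Finset.card_le_one]
    intro d hd f hf
    rw [Finset.mem_filter] at hd hf
    exact (h1 d hd.1 hd.2).trans (h1 f hf.1 hf.2).symm
  have h3 : (0, head (node 0)) ∈ blockArcs L tail head :=
    mem_blockArcs.2 ⟨node 0, hlast.1.1, Prod.ext hlast.2 rfl⟩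
  -- As only one block leaves the source, its head has indegree one unless it is the target, whereas
  -- a settled block with another head has a counter of at least two.
  have hT : head (node 0) = n + 1 := by
    by_contra hT
    have h4 := h.block.ttsp.indeg_eq_one_of_outdeg_le_one h2 _ h3 hT
    obtain ⟨-, -, h5⟩ := h.pend _ hlast.1 (by simp) hlast.2
    rw [h.cnt_eq _ hlast.1.1, if_neg hT] at h5
    omega
  rw [hT] at h3
  have h4 := congrArg Multiset.card (h.block.ttsp.eq_singleton_of_outdeg_le_one h2 h3)
  rw [blockArcs, Multiset.card_map, Multiset.card_singleton] at h4
  refine ⟨?_, h.head_ne_tail hlast.1.1⟩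
  obtain ⟨d, rfl⟩ := Finset.card_eq_one.1 h4
  rw [Finset.mem_singleton.1 hlast.1.1]

end ReduceInv

/-! ### The forest of all blocks, and the start of the reduction. -/

/-- The binary forest of all blocks below `fresh`; `L` is the set of its roots. -/
structure BlockForest (n c : ℕ) (sz : ℕ → ℕ) (fresh : ℕ) (L : Finset ℕ) (left right wt : ℕ → ℕ)
    (tab : ℕ → ℕ → ℕ) (tr : ℕ → SPTree) : Prop where
  leaf : ∀ v < n, tr v = .leaf v
  node : ∀ d, n ≤ d → d < fresh → left d < d ∧ right d < d ∧ left d ∉ L ∧ right d ∉ L ∧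
    Disjoint (tr (left d)).items (tr (right d)).items ∧
    ∃ ser, tr d = .node ser (tr (left d)) (tr (right d)) ∧
      RAM.RowSound ser c (tab (left d)) (tab (right d)) (wt (right d)) (tab d)
  inj : ∀ d e, n ≤ d → d < fresh → n ≤ e → e < fresh → d ≠ e →
    left d ≠ left e ∧ left d ≠ right e ∧ right d ≠ right e
  wt_eq : ∀ d < fresh, wt d = ∑ v ∈ (tr d).items, sz v
  table : ∀ d < fresh, (tr d).TableOK c sz (tab d)
  tab_zero : ∀ d, fresh ≤ d → tab d = fun _ => 0

/-- The merged blocks are roots, so they have no parent yet. Therefore no block becomes a part of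
two others, which the distribution of the targets relies on. -/
lemma BlockForest.merge {n c : ℕ} {sz : ℕ → ℕ} {fresh : ℕ} {L : Finset ℕ} {left right wt : ℕ → ℕ}
    {tab : ℕ → ℕ → ℕ} {tr : ℕ → SPTree}
    (h : BlockForest n c sz fresh L left right wt tab tr) (hsz : ∀ v, 0 < sz v) (hn : n ≤ fresh)
    {l r : ℕ} (hl : l ∈ L) (hr : r ∈ L) (hlf : l < fresh) (hrf : r < fresh)
    (hd : Disjoint (tr l).items (tr r).items) {ser : Bool} {T : ℕ → ℕ}
    (hs : RAM.RowSound ser c (tab l) (tab r) (wt r) T)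
    (hc : RAM.RowComplete ser c (tab l) (tab r) (wt r) T) :
    BlockForest n c sz (fresh + 1) (mergeBlocks L l r fresh) (Function.update left fresh l)
      (Function.update right fresh r) (Function.update wt fresh (wt l + wt r))
      (Function.update tab fresh T) (Function.update tr fresh (.node ser (tr l) (tr r))) := by
  have hnL : ∀ d < fresh, d ∉ L → d ∉ mergeBlocks L l r fresh := by
    intro d hd hdL hm
    rcases mem_mergeBlocks.1 hm with rfl | ⟨-, -, h⟩
    exacts [hd.false, hdL h]
  have hlt : ∀ d < fresh + 1, d = fresh ∨ d < fresh := fun d hd => by omega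
  refine ⟨fun v hv => ?_, fun d hnd hd => ?_, fun d e hnd hd hne he hde => ?_, fun d hd => ?_,
    fun d hd => ?_, fun d hd => ?_⟩
  · rw [Function.update_of_ne (by omega), h.leaf v hv]
  · rcases hlt d hd with rfl | hd
    · simp only [Function.update_self, Function.update_of_ne hlf.ne, Function.update_of_ne hrf.ne]
      refine ⟨hlf, hrf, fun hm => ?_, fun hm => ?_, ‹_›, ser, rfl, hs⟩
      · rcases mem_mergeBlocks.1 hm with h | ⟨-, h, -⟩
        exacts [hlf.ne h, h rfl]
      · rcases mem_mergeBlocks.1 hm with h | ⟨h, -, -⟩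
        exacts [hrf.ne h, h rfl]
    · obtain ⟨h1, h2, h3, h4, h5⟩ := h.node d hnd hd
      simp only [Function.update_of_ne hd.ne, Function.update_of_ne (h1.trans hd).ne,
        Function.update_of_ne (h2.trans hd).ne]
      exact ⟨h1, h2, hnL _ (h1.trans hd) h3, hnL _ (h2.trans hd) h4, h5⟩
  · rcases hlt d hd with rfl | hd <;> rcases hlt e he with rfl | he
    · exact absurd rfl hde
    · obtain ⟨-, -, h3, h4, -⟩ := h.node e hne he
      simp only [Function.update_self, Function.update_of_ne he.ne]
      exact ⟨fun h => h3 (h ▸ hl), fun h => h4 (h ▸ hl), fun h => h4 (h ▸ hr)⟩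
    · obtain ⟨-, -, h3, h4, -⟩ := h.node d hnd hd
      simp only [Function.update_self, Function.update_of_ne hd.ne]
      exact ⟨fun h => h3 (h ▸ hl), fun h => h3 (h ▸ hr), fun h => h4 (h ▸ hr)⟩
    · simp only [Function.update_of_ne hd.ne, Function.update_of_ne he.ne]
      exact h.inj d e hnd hd hne he hde
  · rcases hlt d hd with rfl | hd
    · rw [Function.update_self, Function.update_self, h.wt_eq l hlf, h.wt_eq r hrf, SPTree.items,
        Finset.sum_union ‹_›]
    · rw [Function.update_of_ne hd.ne, Function.update_of_ne hd.ne, h.wt_eq d hd]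
  · rcases hlt d hd with rfl | hd
    · rw [Function.update_self, Function.update_self]
      exact SPTree.TableOK.node hsz ‹_› (h.wt_eq r hrf) (h.table l hlf) (h.table r hrf) hs hc
    · rw [Function.update_of_ne hd.ne, Function.update_of_ne hd.ne]
      exact h.table d hd
  · rw [Function.update_of_ne (by omega), h.tab_zero d (by omega)]

lemma ItemOrder.surj {n : ℕ} {q tl hd : ℕ → ℕ} (h : ItemOrder n q tl hd) :
    ∀ v < n, ∃ i < n, q i = v := by
  intro v hv
  have h1 : (Finset.range n).image q = Finset.range n := by
    refine Finset.eq_of_subset_of_card_le (fun x hx => ?_) ?_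
    · obtain ⟨i, hi, rfl⟩ := Finset.mem_image.1 hx
      exact Finset.mem_range.2 (h.lt i (Finset.mem_range.1 hi))
    · rw [Finset.card_image_of_injOn]
      intro i hi j hj hij
      exact h.inj i (Finset.mem_range.1 hi) j (Finset.mem_range.1 hj) hij
  have h2 : v ∈ (Finset.range n).image q := by
    rw [h1]
    exact Finset.mem_range.2 hv
  obtain ⟨i, hi, rfl⟩ := Finset.mem_image.1 h2
  exact ⟨i, Finset.mem_range.1 hi, rfl⟩

/-- At position `n` nothing has been processed, so all claims about processed blocks are vacuous.
For single items the block conditions are closure under the arcs. -/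
lemma ReduceInv.init {n : ℕ} {Up : Finset ℕ → Prop} {q tl hd : ℕ → ℕ} (h : ItemOrder n q tl hd)
    (hT : TTSP (blockArcs (Finset.range n) tl hd) 0 (n + 1))
    (hup : ∀ A, Up A ↔ ∀ u < n, ∀ v < n, hd u = tl v → u ∈ A → v ∈ A)
    {cnt : ℕ → ℕ} (hcnt : ∀ x, cnt x = ((Finset.range n).filter fun v => hd v = x).card)
    (y : ℕ) (temp node : ℕ → ℕ) :
    ReduceInv n Up q tl hd n y n (Finset.range n) tl hd .leaf
      (Function.update cnt (n + 1) (cnt (n + 1) + 1)) temp node (fun _ => 0) none none := by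
  have hdone : ∀ d, ¬ Done q n (Finset.range n) d := by
    rintro d ⟨h1, h2⟩
    obtain ⟨i, hi, rfl⟩ := h.surj d (Finset.mem_range.1 h1)
    exact h2 i hi rfl
  exact {
    block := {
      ttsp := hT
      up_iff := by
        intro A
        rw [hup]
        simp only [SPTree.Adm, SPTree.items, Finset.disjoint_singleton_right,
          Finset.singleton_subset_iff, Finset.mem_range, implies_true, true_and]
        refine forall₄_congr fun u _ v _ => forall_congr' fun _ => ?_
        tauto
      cover := by
        ext v
        simp [SPTree.items]
      disj := by
        intro d _ f _ hdf
        simpa [SPTree.items] using hdf }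
    lt := fun d hd => Finset.mem_range.1 hd
    n_le := le_rfl
    card := by rw [Finset.card_range]; omega
    unproc := fun i hi => Finset.mem_range.2 (h.lt i hi)
    tail_eq := fun _ _ => rfl
    head_eq := fun _ _ => rfl
    cnt_eq := by
      intro d _
      rw [indeg_blockArcs, ← hcnt]
      by_cases hd : hd d = n + 1
      · rw [hd, Function.update_self, if_pos rfl]
      · rw [Function.update_of_ne hd, if_neg hd, add_zero]
    src := fun d hd => absurd hd (hdone d)
    dst := fun d hd => absurd hd (hdone d)
    node_eq := fun d hd => absurd hd (hdone d)
    cur := fun h => absurd h (lt_irrefl n)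
    pend := fun d hd => absurd hd (hdone d)
    tagged := fun x hx => by omega
    tag_src := fun x z hx => by omega }

/-! ### The reduction program and its amortized running time. -/

namespace RAM

open Op Layout

/-- Store the block `d` at its head `x`; if another block with the same tail `y` is stored there,
merge the two blocks first. -/
def absorb : Prog :=
  -- Equality of the tag with `y + 1` is tested by means of the sum of the two truncated
  -- differences. The shift by one keeps the initial tag `0` from denoting the tail `0`.
  ops [.ld .g .tag .x, .add .e .y .one, .sub .a .g .e, .sub .b .e .g, .add .a .a .b] ;;
  ite .a .one
    (ops [.ld .l .temp .x, .cp .r .d] ;; combine false ;;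
      ops [.ld .a .cnt .x, .sub .a .a .one, .st .cnt .x .a])
    skip ;;
  ops [.st .tag .x .e, .st .temp .x .d]

/-- Merge the block `d` with the block that starts at its head `x`. -/
def climb : Prog :=
  ops [.ld .b .node .x, .cp .l .d, .cp .r .b, .ld .x .head .b] ;; combine true ;; absorb ;;
  ops [.ld .ct .cnt .x]

/-- Items are taken up from the end of the queue, so that everything behind the head of the current
block has been reduced. Raising the counter of the target `t` stops the climbing there. -/
def reduce : Prog :=
  ops [.ld .a .cnt .t, .add .a .a .one, .st .cnt .t .a, .cp .fresh .n, .cp .k .n] ;;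
  loop .zero .k (
    ops [.sub .k .k .one, .ld .d .queue .k, .ld .y .tail .d, .ld .x .head .d] ;;
    absorb ;;
    ops [.ld .ct .cnt .x] ;;
    loop .ct .two climb ;;
    ops [.st .node .y .d])

/-- An instance of the problem: the number of items, the capacity, the sizes, and the sets that
satisfy the digraph constraint. -/
structure Problem where
  n : ℕ
  c : ℕ
  sz : ℕ → ℕ
  Up : Finset ℕ → Prop
  n_pos : 0 < n
  sz_pos : ∀ v, 0 < sz v

/-- The memory layout is the one for the problem `P`. -/
structure Fits (P : Problem) (C : Layout) : Prop where
  N_eq : C.N = 2 * P.n + 2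
  R_eq : C.R = P.c + 17
  le_B : 8 * P.n + 2 * P.c + 20 ≤ C.B
  sum_le : ∑ v ∈ Finset.range P.n, P.sz v ≤ C.B

/-- The variables which keep their values after the start. -/
def Consts (P : Problem) (s : Store) : Prop :=
  s.zero = 0 ∧ s.one = 1 ∧ s.two = 2 ∧ s.n = P.n ∧ s.c = P.c ∧ s.t = P.n + 1

/-- The invariant of the reduction as a property of the store. -/
structure StoreInv (P : Problem) (q tl hd : ℕ → ℕ) (L : Finset ℕ) (tr : ℕ → SPTree)
    (hp ht : Option ℕ) (s : Store) : Prop where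
  consts : Consts P s
  red : ReduceInv P.n P.Up q tl hd s.k s.y s.fresh L s.tail s.head tr s.cnt s.temp s.node s.tag
    hp ht
  forest : BlockForest P.n P.c P.sz s.fresh L s.left s.right s.wt s.tab tr
  queue : s.queue = q
  tgt : s.tgt = fun _ => 0
  k_le : s.k ≤ P.n

/-- The block `d` leads from `y` to `x`. -/
structure InHand (q : ℕ → ℕ) (L : Finset ℕ) (s : Store) : Prop where
  done : Done q s.k L s.d
  tail_eq : s.tail s.d = s.y
  head_eq : s.head s.d = s.x

/-- An upper bound for the time needed for one composition. -/
def mergeCost (P : Problem) : ℕ := 80 * (P.c + 2) ^ 2 + 200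

section

variable {C : Layout} {s : Store} {P : Problem} {q tl hd : ℕ → ℕ} {L : Finset ℕ} {tr : ℕ → SPTree}
  {hp ht : Option ℕ}

/-- A merge creates one block and lowers the number of roots by one, so fewer than `2n` blocks exist
while there is a root. Weights of roots are sums over items and bounded by the total size. -/
lemma StoreInv.lt_N (hC : Fits P C) (h : StoreInv P q tl hd L tr hp ht s) {d : ℕ} (hd : d ∈ L) :
    d < s.fresh ∧ s.fresh < C.N ∧ s.fresh ≤ 2 * P.n ∧ s.wt d ≤ C.B := by
  have h1 := h.red.lt d hd
  have h2 := h.red.card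
  have h3 := hC.N_eq
  refine ⟨h1, by omega, by omega, ?_⟩
  rw [h.forest.wt_eq d h1]
  refine (Finset.sum_le_sum_of_subset ?_).trans hC.sum_le
  rw [← h.red.block.cover]
  exact Finset.subset_biUnion_of_mem (fun d => (tr d).items) hd

lemma StoreInv.wt_add_le (hC : Fits P C) (h : StoreInv P q tl hd L tr hp ht s) {d f : ℕ}
    (hd : d ∈ L) (hf : f ∈ L) (hdf : d ≠ f) : s.wt d + s.wt f ≤ C.B := by
  rw [h.forest.wt_eq d (h.red.lt d hd), h.forest.wt_eq f (h.red.lt f hf),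
    ← Finset.sum_union (h.red.block.disj d hd f hf hdf)]
  refine (Finset.sum_le_sum_of_subset ?_).trans hC.sum_le
  rw [← h.red.block.cover]
  exact Finset.union_subset (Finset.subset_biUnion_of_mem (fun d => (tr d).items) hd)
    (Finset.subset_biUnion_of_mem (fun d => (tr d).items) hf)

lemma StoreInv.head_lt (hC : Fits P C) (horder : ItemOrder P.n q tl hd)
    (h : StoreInv P q tl hd L tr hp ht s) {d : ℕ} (hd : Done q s.k L d) : s.head d < C.N := by
  obtain ⟨i, -, hi, h1⟩ := h.red.dst d hd
  have := horder.hd_le _ (horder.lt i hi)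
  have := hC.N_eq
  omega

lemma StoreInv.tail_le (horder : ItemOrder P.n q tl hd)
    (h : StoreInv P q tl hd L tr hp ht s) {d : ℕ} (hd : Done q s.k L d) : s.tail d ≤ P.n := by
  obtain ⟨i, -, hi, h1⟩ := h.red.src d hd
  have := horder.tl_le _ (horder.lt i hi)
  omega

end

namespace Layout

variable {C : Layout} {s : Store} {Q : ℕ → Store → Prop} {p : Prog}

lemma wp_of_le (h : (∀ x, s.get x ≤ C.B) → (∀ A i, s.arr A i ≤ C.B) → C.wp p s Q) :
    C.wp p s Q := fun σ hσ => h hσ.get_le hσ.arr_le σ hσ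

variable {P : Problem} {q tl hd : ℕ → ℕ} {L : Finset ℕ} {tr : ℕ → SPTree} {hp ht : Option ℕ}

/-- The potential is `mergeCost P` times the number of blocks that can still be created. A merge
pays for itself by consuming one of them; only a constant is charged to the caller. -/
lemma wp_absorb (hC : Fits P C) (horder : ItemOrder P.n q tl hd) (hk : s.k < P.n)
    (h : StoreInv P q tl hd L tr (some s.d) (some s.d) s) (hh : InHand q L s)
    (hQ : ∀ t s' L' tr', StoreInv P q tl hd L' tr' (some s'.d) none s' → InHand q L' s' →
      s'.tag s'.x = s'.y + 1 → s'.temp s'.x = s'.d → s'.k = s.k →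
      t + mergeCost P * (2 * P.n - s'.fresh) ≤ mergeCost P * (2 * P.n - s.fresh) + 40 → Q t s') :
    C.wp absorb s Q := by
  obtain ⟨hzero, hone, htwo, hsn, hsc, hst⟩ := h.consts
  have hxN : s.x < C.N := hh.head_eq ▸ h.head_lt hC horder hh.done
  have hyn : s.y ≤ P.n := hh.tail_eq ▸ h.tail_le horder hh.done
  have hB := hC.le_B
  refine wp_of_le fun _ hle => ?_
  have hg : s.tag s.x ≤ C.B := hle .tag s.x
  refine wp_seq (wp_ops _ ?_ ?_)
  · simp only [okList, ok, act, Store.get, Store.set, Store.arr, hone, and_true, true_and]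
    omega
  simp only [actList, act, Store.get, Store.set, Store.arr, hone]
  refine wp_seq (wp_if (fun ha => ?_) fun ha => wp_skip ?_)
  · simp only [Store.get] at ha
    have htag : s.tag (s.head s.d) = s.y + 1 := by rw [hh.head_eq]; omega
    obtain ⟨h1, h2, h3, h4, h5, h6⟩ := h.red.mergePar hh.done hh.tail_eq htag
    rw [hh.head_eq] at h1 h2 h3 h4 h5 h6
    obtain ⟨hl1, hl2, hl3, -⟩ := h.lt_N hC h1.1
    have hr1 := (h.lt_N hC hh.done.1).1
    refine wp_seq (wp_ops _ ?_ ?_)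
    · simp only [okList, ok, Store.get, and_true]
      exact hxN
    simp only [actList, act, Store.get, Store.set, Store.arr]
    refine wp_seq (wp_combine false hzero rfl (by rw [hC.R_eq, hsc]) (by simp only; omega)
      (h.wt_add_le hC h1.1 hh.done.1 h2) hl1 hr1 hl2 (h.forest.tab_zero _ le_rfl) ?_)
    simp only
    intro t kk j lim a b s₁ g T ht hT hcT
    refine wp_ops _ ?_ ?_
    · simp only [okList, ok, Store.get, Store.set, act, and_true, true_and]
      omega
    simp only [actList, act, Store.get, Store.set, Store.setArr, Store.arr]
    refine wp_ops _ ?_ ?_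
    · simp only [okList, ok, Store.get, Store.setArr, act, and_true]
      omega
    simp only [actList, act, Store.get, Store.setArr, Store.arr]
    refine hQ _ _ (mergeBlocks L (s.temp s.x) s.d s.fresh)
      (Function.update tr s.fresh (.node false (tr (s.temp s.x)) (tr s.d)))
      ⟨⟨hzero, rfl, htwo, hsn, hsc, hst⟩, h6, ?_, h.queue, h.tgt, h.k_le⟩ ⟨h5, ?_, ?_⟩ ?_ ?_ ?_ ?_
    · rw [hsc] at hT hcT
      exact h.forest.merge P.sz_pos h.red.n_le h1.1 hh.done.1 hl1 hr1
        (h.red.block.disj _ h1.1 _ hh.done.1 h2) hT hcT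
    · simp only [Function.update_self]
    · simp only [Function.update_self]
    · simp only [Function.update_self]
    · simp only [Function.update_self]
    · rfl
    · have h7 := h6.card
      have h8 : 2 * P.n - s.fresh = (2 * P.n - (s.fresh + 1)) + 1 := by
        have := Finset.card_pos.2 ⟨_, h5.1⟩
        omega
      rw [hsc] at ht
      simp only [costList, cost]
      rw [h8, mul_add]
      simp only [mergeCost]
      omega
  · simp only [Store.get] at ha
    have htag : s.tag (s.head s.d) ≠ s.y + 1 := by rw [hh.head_eq]; omega
    refine wp_ops _ ?_ ?_
    · simp only [okList, ok, Store.get, Store.setArr, act, and_true]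
      omega
    simp only [actList, act, Store.get, Store.setArr, Store.arr]
    have h1 := h.red.store hh.done hh.tail_eq hk htag
    rw [hh.head_eq] at h1
    refine hQ _ _ L tr ⟨⟨hzero, rfl, htwo, hsn, hsc, hst⟩, h1, h.forest, h.queue, h.tgt, h.k_le⟩
      ⟨hh.done, hh.tail_eq, hh.head_eq⟩ ?_ ?_ rfl ?_
    · simp only [Function.update_self]
    · simp only [Function.update_self]
    · simp only [costList, cost]
      omega

/-- The series merge always creates a block, and the constant summand of `mergeCost` also covers the
charge of `absorb` and the loop test. So a round of climbing is paid entirely from the potential. -/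
lemma wp_climb (hC : Fits P C) (horder : ItemOrder P.n q tl hd) (hk : s.k < P.n)
    (h : StoreInv P q tl hd L tr (some s.d) none s) (hh : InHand q L s)
    (hcnt : s.cnt s.x < 2)
    (hQ : ∀ t s' L' tr', StoreInv P q tl hd L' tr' (some s'.d) none s' → InHand q L' s' →
      s'.tag s'.x = s'.y + 1 → s'.temp s'.x = s'.d → s'.k = s.k → s'.ct = s'.cnt s'.x →
      t + 1 + mergeCost P * (2 * P.n - s'.fresh) ≤ mergeCost P * (2 * P.n - s.fresh) → Q t s') :
    C.wp climb s Q := by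
  obtain ⟨hzero, hone, htwo, hsn, hsc, hst⟩ := h.consts
  have hxN : s.x < C.N := hh.head_eq ▸ h.head_lt hC horder hh.done
  have hB := hC.le_B
  obtain ⟨h1, h2, h3, h5, h6⟩ := h.red.mergeSer horder hh.done hh.tail_eq
    (by rwa [hh.head_eq])
  rw [hh.head_eq] at h1 h2 h3 h5 h6
  obtain ⟨hl1, hl2, hl3, -⟩ := h.lt_N hC h1.1
  have hr1 := (h.lt_N hC hh.done.1).1
  refine wp_seq (wp_ops _ ?_ ?_)
  · simp only [okList, ok, act, Store.get, Store.set, Store.arr, and_true, true_and]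
    omega
  simp only [actList, act, Store.get, Store.set, Store.arr]
  refine wp_seq (wp_combine true hzero hone (by rw [hC.R_eq, hsc]) (by simp only; omega)
    (h.wt_add_le hC hh.done.1 h1.1 h2.symm) hr1 hl1 hl2 (h.forest.tab_zero _ le_rfl) ?_)
  simp only
  intro t kk j lim a b s₁ g T ht hT hcT
  rw [hsc] at hT hcT
  have hf := h.forest.merge P.sz_pos h.red.n_le hh.done.1 h1.1 hr1 hl1
    (h.red.block.disj _ hh.done.1 _ h1.1 h2.symm) hT hcT
  have h7 := h6.card
  have h8 : 2 * P.n - s.fresh = (2 * P.n - (s.fresh + 1)) + 1 := by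
    have := Finset.card_pos.2 ⟨_, h5.1⟩
    omega
  refine wp_seq (wp_absorb (L := mergeBlocks L s.d (s.node s.x) s.fresh)
    (tr := Function.update tr s.fresh (.node true (tr s.d) (tr (s.node s.x)))) hC horder hk
    ⟨h.consts, h6, hf, h.queue, h.tgt, h.k_le⟩ ⟨h5, ?_, ?_⟩ ?_)
  · simp only [Function.update_self]
  · simp only [Function.update_self]
  intro u s' L' tr' hs' hh' htag htemp hk' htime
  have hxN' : s'.x < C.N := hh'.head_eq ▸ hs'.head_lt hC horder hh'.done
  refine wp_ops _ ?_ ?_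
  · simp only [okList, ok, Store.get, and_true]
    exact hxN'
  simp only [actList, act, Store.get, Store.set, Store.arr]
  refine hQ _ _ L' tr' ⟨hs'.consts, hs'.red, hs'.forest, hs'.queue, hs'.tgt, hs'.k_le⟩
    ⟨hh'.done, hh'.tail_eq, hh'.head_eq⟩ htag htemp hk' rfl ?_
  simp only at htime
  rw [hsc] at ht
  simp only [costList, cost]
  rw [h8, mul_add]
  simp only [mergeCost] at *
  omega

/-- Besides the potential, each item brings a constant allowance for its own round. Since a block is
processed with the item that starts the round, `node` holds a block with the current tail whenever a
round has ended. -/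
lemma wp_reduce (hC : Fits P C) (hconst : Consts P s)
    (horder : ItemOrder P.n s.queue s.tail s.head)
    (hT : TTSP (blockArcs (Finset.range P.n) s.tail s.head) 0 (P.n + 1))
    (hup : ∀ A, P.Up A ↔ ∀ u < P.n, ∀ v < P.n, s.head u = s.tail v → u ∈ A → v ∈ A)
    (hcnt : ∀ x, s.cnt x = ((Finset.range P.n).filter fun v => s.head v = x).card)
    (htag : s.tag = fun _ => 0) (htgt : s.tgt = fun _ => 0)
    (hforest : BlockForest P.n P.c P.sz P.n (Finset.range P.n) s.left s.right s.wt s.tab .leaf)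
    (hQ : ∀ t s' tr', t ≤ mergeCost P * P.n + 100 * P.n + 100 → Consts P s' →
      BlockForest P.n P.c P.sz s'.fresh {s'.node 0} s'.left s'.right s'.wt s'.tab tr' →
      (∀ A, P.Up A ↔ (tr' (s'.node 0)).Adm A) → (tr' (s'.node 0)).items = Finset.range P.n →
      s'.node 0 < s'.fresh → P.n ≤ s'.fresh → s'.fresh ≤ 2 * P.n →
      (s'.tgt = fun _ => 0) → Q t s') :
    C.wp reduce s Q := by
  obtain ⟨hzero, hone, htwo, hsn, hsc, hst⟩ := id hconst
  have hB := hC.le_B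
  have hN := hC.N_eq
  have hcardle : s.cnt (P.n + 1) ≤ P.n := by
    rw [hcnt]
    exact (Finset.card_filter_le _ _).trans_eq (Finset.card_range _)
  refine wp_seq (wp_ops _ ?_ ?_)
  · simp only [okList, ok, act, Store.get, Store.set, Store.arr, and_true, hst, hone]
    omega
  simp only [actList, act, Store.get, Store.set, Store.setArr, Store.arr, hst, hone, hsn]
  refine wp_while (fun φ s' => ∃ L tr, StoreInv P s.queue s.tail s.head L tr none none s' ∧
      (s'.k < P.n → Done s.queue s'.k L (s'.node s'.y) ∧ s'.tail (s'.node s'.y) = s'.y) ∧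
      φ = mergeCost P * (2 * P.n - s'.fresh) + 80 * s'.k)
    (mergeCost P * P.n + 80 * P.n) ⟨Finset.range P.n, .leaf, ?_, ?_, ?_⟩ ?_ ?_
  · refine ⟨⟨hzero, rfl, htwo, rfl, hsc, rfl⟩, ?_, hforest, rfl, htgt, le_rfl⟩
    simp only
    rw [htag]
    exact ReduceInv.init horder hT hup hcnt _ _ _
  · intro h
    exact absurd h (lt_irrefl _)
  · simp only
    congr 2
    omega
  · rintro φ s' ⟨L, tr, h, hlast, hφ⟩ hlt
    obtain ⟨hzero, hone, htwo, hsn, hsc, hst⟩ := h.consts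
    simp only [Store.get, hzero] at hlt
    obtain ⟨k, hk⟩ : ∃ k, s'.k = k + 1 := ⟨s'.k - 1, by omega⟩
    have hkn : k < P.n := by
      have := h.k_le
      omega
    have hred := h.red
    rw [hk] at hred
    obtain ⟨h1, h2, h3⟩ := hred.next horder hkn (by rwa [hk] at hlast)
    have hql := horder.lt k hkn
    have hdN : s.queue k < C.N := by omega
    refine wp_seq (wp_ops _ ?_ ?_)
    · simp only [okList, ok, act, Store.get, Store.set, Store.arr, and_true, true_and, hk, hone,
        Nat.add_sub_cancel, h.queue]
      omega
    simp only [actList, act, Store.get, Store.set, Store.arr, hk, hone, Nat.add_sub_cancel,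
      h.queue, h2]
    refine wp_seq (wp_absorb hC horder hkn ⟨⟨hzero, rfl, htwo, hsn, hsc, hst⟩, h3, h.forest, rfl, h.tgt, hkn.le⟩
      ⟨h1, h2, rfl⟩ ?_)
    simp only
    intro t s₁ L₁ tr₁ hs₁ hh₁ htag₁ htemp₁ hk₁ htime₁
    have hxN₁ : s₁.x < C.N := hh₁.head_eq ▸ hs₁.head_lt hC horder hh₁.done
    refine wp_seq (wp_ops _ ?_ ?_)
    · simp only [okList, ok, Store.get, and_true]
      exact hxN₁
    simp only [actList, act, Store.get, Store.set, Store.arr]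
    refine wp_seq (wp_while (fun φ s₂ => ∃ L tr,
        StoreInv P s.queue s.tail s.head L tr (some s₂.d) none s₂ ∧ InHand s.queue L s₂ ∧
        s₂.tag s₂.x = s₂.y + 1 ∧ s₂.temp s₂.x = s₂.d ∧ s₂.k = k ∧ s₂.ct = s₂.cnt s₂.x ∧
        φ = mergeCost P * (2 * P.n - s₂.fresh)) _
      ⟨L₁, tr₁, ⟨hs₁.consts, hs₁.red, hs₁.forest, hs₁.queue, hs₁.tgt, hs₁.k_le⟩,
        ⟨hh₁.done, hh₁.tail_eq, hh₁.head_eq⟩, htag₁, htemp₁, hk₁, rfl, rfl⟩ ?_ ?_)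
    · rintro φ s₂ ⟨L₂, tr₂, h₂, hh₂, -, -, hk₂, hct₂, rfl⟩ hlt
      simp only [Store.get, h₂.consts.2.2.1, hct₂] at hlt
      refine wp_climb hC horder (by omega) h₂ hh₂ hlt ?_
      intro t s₃ L₃ tr₃ h₃ hh₃ htag₃ htemp₃ hk₃ hct₃ htime₃
      exact ⟨_, ⟨L₃, tr₃, h₃, hh₃, htag₃, htemp₃, hk₃.trans hk₂, hct₃, rfl⟩, htime₃⟩
    · rintro u φ' s₂ ⟨L₂, tr₂, h₂, hh₂, htag₂, htemp₂, hk₂, hct₂, rfl⟩ hge htime₂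
      simp only [Store.get, h₂.consts.2.2.1, hct₂, not_lt] at hge
      have hy := h₂.tail_le horder hh₂.done
      rw [hh₂.tail_eq] at hy
      refine wp_ops _ ?_ ?_
      · simp only [okList, ok, Store.get, and_true]
        omega
      simp only [actList, act, Store.get, Store.setArr, Store.arr]
      have h₃ := h₂.red.settle (by rwa [hh₂.head_eq]) (by rwa [hh₂.head_eq])
        (by rwa [hh₂.head_eq])
      refine ⟨_, ⟨L₂, tr₂, ⟨h₂.consts, h₃, h₂.forest, h₂.queue, h₂.tgt, h₂.k_le⟩, ?_, rfl⟩, ?_⟩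
      · intro _
        simp only [Function.update_self]
        exact ⟨hh₂.done, hh₂.tail_eq⟩
      · simp only [costList, cost]
        simp only at htime₂
        omega
  · rintro t φ' s' ⟨L, tr, h, hlast, rfl⟩ hge htime
    simp only [Store.get, h.consts.1, not_lt, Nat.le_zero] at hge
    have hred := h.red
    rw [hge] at hred hlast
    obtain ⟨h1, h2⟩ := hred.eq_singleton horder P.n_pos (hlast P.n_pos)
    subst h1
    have hmem : s'.node 0 ∈ ({s'.node 0} : Finset ℕ) := Finset.mem_singleton_self _
    have hc := h.red.card
    refine hQ _ _ tr ?_ h.consts h.forest ?_ ?_ (h.red.lt _ hmem) h.red.n_le (by omega) h.tgt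
    · simp only [costList, cost]
      omega
    · intro A
      rw [hred.block.up_iff]
      simp [h2]
    · have := hred.block.cover
      simpa using this

end Layout

end RAM

/-! ### Extraction of an optimal solution -/

lemma SPTree.adm_empty (t : SPTree) : t.Adm ∅ := by
  induction t with
  | leaf v => trivial
  | node ser l r hl hr => exact ⟨hl, hr, fun _ => .inl (Finset.disjoint_empty_left _)⟩

lemma SPTree.TableOK.zero {c : ℕ} {sz T : ℕ → ℕ} {t : SPTree} (h : t.TableOK c sz T) : T 0 ≠ 0 :=
  (h 0 c.zero_le).2 ⟨∅, t.adm_empty, by simp⟩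

/-- The targets `tgt` are attainable sums for all blocks, and those of the blocks from `f` on are
the sums of the targets of their two parts, as prescribed by the tables. -/
structure Targets (c fresh : ℕ) (left right : ℕ → ℕ) (tab : ℕ → ℕ → ℕ) (tgt : ℕ → ℕ) (f : ℕ) :
    Prop where
  le : ∀ d < fresh, tgt d ≤ c
  attained : ∀ d < fresh, tab d (tgt d) ≠ 0
  split : ∀ d, f ≤ d → d < fresh →
    tab d (tgt d) = tgt (left d) + 1 ∧ tgt (left d) + tgt (right d) = tgt d

namespace Targets

variable {n c fresh : ℕ} {sz : ℕ → ℕ} {L : Finset ℕ} {left right wt tgt : ℕ → ℕ}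
  {tab : ℕ → ℕ → ℕ} {tr : ℕ → SPTree}

/-- The sum `0` is attained by the empty set in every block, so `0` is a legitimate target away from
the root. -/
lemma init (h : BlockForest n c sz fresh L left right wt tab tr) {ρ j : ℕ} (hj : j ≤ c)
    (hρ : tab ρ j ≠ 0) :
    Targets c fresh left right tab (Function.update (fun _ => 0) ρ j) fresh where
  le d _ := by
    rw [Function.update_apply]
    split_ifs <;> omega
  attained d hd := by
    rw [Function.update_apply]
    split_ifs with h1
    · rwa [h1]
    · exact (h.table d hd).zero
  split d h1 h2 := by omega

/-- The table entry is the successor of the share of the left part. Both parts of `d` are smaller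
than `d` and are parts of no other block, so the splits made for `d + 1` and beyond are not
disturbed. -/
lemma step (h : BlockForest n c sz fresh L left right wt tab tr) {d : ℕ} (hn : n ≤ d)
    (hd : d < fresh) (ht : Targets c fresh left right tab tgt (d + 1)) :
    Targets c fresh left right tab (Function.update (Function.update tgt (left d)
      (tab d (tgt d) - 1)) (right d) (tgt d - (tab d (tgt d) - 1))) d := by
  obtain ⟨hl, hr, -, -, hdisj, ser, -, hs⟩ := h.node d hn hd
  obtain ⟨k, i, h1, h2, h3, h4, -⟩ := hs _ (ht.le d hd) (ht.attained d hd)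
  have hne : left d ≠ right d := by
    intro hlr
    rw [hlr, disjoint_self, Finset.bot_eq_empty] at hdisj
    exact (SPTree.items_nonempty _).ne_empty hdisj
  have hc := ht.le d hd
  have e1 : tab d (tgt d) - 1 = k := by omega
  have e2 : tgt d - k = i := by omega
  rw [e1, e2]
  refine ⟨fun e he => ?_, fun e he => ?_, fun e he1 he2 => ?_⟩
  · simp only [Function.update_apply]
    split_ifs
    exacts [by omega, by omega, ht.le e he]
  · rcases eq_or_ne e (right d) with rfl | h5
    · rwa [Function.update_self]
    rw [Function.update_of_ne h5]
    rcases eq_or_ne e (left d) with rfl | h6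
    · rwa [Function.update_self]
    rw [Function.update_of_ne h6]
    exact ht.attained e he
  · rw [Function.update_of_ne (by omega : e ≠ right d), Function.update_of_ne (by omega : e ≠ left d)]
    rcases eq_or_ne e d with rfl | hne'
    · rw [Function.update_of_ne hne, Function.update_self, Function.update_self]
      exact ⟨h1, h2⟩
    · obtain ⟨h5, h6, h7⟩ := h.inj e d (by omega) he2 hn hd hne'
      obtain ⟨-, h8, -⟩ := h.inj d e hn hd (by omega) he2 hne'.symm
      rw [Function.update_of_ne h6, Function.update_of_ne h5, Function.update_of_ne h7,
        Function.update_of_ne h8.symm]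
      exact ht.split e (by omega) he2

/-- At a leaf an attainable target is `0` or the size of the item. At a node the soundness of the
table makes the two targets compatible, and positivity of the sizes turns this into the series
condition. -/
lemma adm_and_sum (h : BlockForest n c sz fresh L left right wt tab tr) (hsz : ∀ v, 0 < sz v)
    (ht : Targets c fresh left right tab tgt n) {A : Finset ℕ}
    (hA : ∀ v < n, v ∈ A ↔ tgt v ≠ 0) :
    ∀ d < fresh, (tr d).Adm A ∧ ∑ v ∈ A ∩ (tr d).items, sz v = tgt d := by
  intro d
  induction d using Nat.strong_induction_on with
  | _ d ih =>
    intro hd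
    rcases lt_or_ge d n with hdn | hdn
    · rw [h.leaf d hdn]
      refine ⟨trivial, ?_⟩
      obtain ⟨B, -, hB⟩ := (h.table d hd _ (ht.le d hd)).1 (ht.attained d hd)
      rw [h.leaf d hdn] at hB
      simp only [SPTree.items] at *
      by_cases hz : tgt d = 0
      · rw [Finset.inter_singleton_of_notMem fun h1 => (hA d hdn).1 h1 hz, hz, Finset.sum_empty]
      · rw [Finset.inter_singleton_of_mem ((hA d hdn).2 hz), ← hB]
        by_cases hdB : d ∈ B
        · rw [Finset.inter_singleton_of_mem hdB]
        · rw [Finset.inter_singleton_of_notMem hdB, Finset.sum_empty] at hB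
          exact absurd hB.symm hz
    · obtain ⟨hl, hr, -, -, hdisj, ser, htr, hs⟩ := h.node d hdn hd
      obtain ⟨h1, h2⟩ := ih _ hl (hl.trans hd)
      obtain ⟨h3, h4⟩ := ih _ hr (hr.trans hd)
      obtain ⟨h5, h6⟩ := ht.split d hdn hd
      obtain ⟨k, i, h7, h8, -, -, h9⟩ := hs _ (ht.le d hd) (ht.attained d hd)
      rw [htr, SPTree.items, SPTree.sum_inter_union hdisj, h2, h4]
      refine ⟨⟨h1, h3, fun hser => (h9 hser).imp (fun h10 => ?_) fun h10 => ?_⟩, h6⟩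
      · exact SPTree.disjoint_of_sum_eq_zero hsz (by omega)
      · refine SPTree.subset_of_sum_eq hsz ?_
        rw [← h.wt_eq _ (hr.trans hd)]
        omega

end Targets

/-! ### The extraction program. -/

namespace RAM

open Op Layout

/-- A set of items that satisfies the constraints and has maximum total size among these. -/
structure Problem.Optimal (P : Problem) (A : Finset ℕ) : Prop where
  subset : A ⊆ Finset.range P.n
  up : P.Up A
  le : ∑ v ∈ A, P.sz v ≤ P.c
  max : ∀ B ⊆ Finset.range P.n, P.Up B → ∑ v ∈ B, P.sz v ≤ P.c →
    ∑ v ∈ B, P.sz v ≤ ∑ v ∈ A, P.sz v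

/-- The sum of any competing set is attainable, hence it occurs in the root table and is at most the
target of the root. -/
lemma _root_.Targets.optimal {P : Problem} {fresh ρ : ℕ} {L : Finset ℕ} {left right wt tgt : ℕ → ℕ}
    {tab : ℕ → ℕ → ℕ} {tr : ℕ → SPTree}
    (h : BlockForest P.n P.c P.sz fresh L left right wt tab tr)
    (ht : Targets P.c fresh left right tab tgt P.n) (hρ : ρ < fresh)
    (hup : ∀ A, P.Up A ↔ (tr ρ).Adm A) (hitems : (tr ρ).items = Finset.range P.n)
    (hmax : ∀ j ≤ P.c, tab ρ j ≠ 0 → j ≤ tgt ρ) :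
    P.Optimal ((Finset.range P.n).filter fun v => tgt v ≠ 0) := by
  obtain ⟨h1, h2⟩ := ht.adm_and_sum h P.sz_pos (A := (Finset.range P.n).filter fun v => tgt v ≠ 0)
    (fun v hv => by simp [hv]) ρ hρ
  rw [hitems, Finset.inter_eq_left.2 (Finset.filter_subset _ _)] at h2
  refine ⟨Finset.filter_subset _ _, (hup _).2 h1, h2.trans_le (ht.le ρ hρ), fun B hB hBup hBc => ?_⟩
  rw [h2]
  refine hmax _ hBc ((h.table ρ hρ _ hBc).2 ⟨B, (hup B).1 hBup, ?_⟩)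
  rw [hitems, Finset.inter_eq_left.2 hB]

/-- Find the largest attainable sum and distribute it to the blocks. -/
def extract : Prog :=
  ops [.ld .d .node .zero, .cp .j .zero, .cp .a .zero, .add .lim .c .one] ;;
  loop .j .lim (
    ops [.ldt .b .d .j] ;; ite .zero .b (ops [.cp .a .j]) skip ;; ops [.add .j .j .one]) ;;
  ops [.st .tgt .d .a] ;;
  loop .n .fresh (
    ops [.sub .fresh .fresh .one, .ld .a .tgt .fresh, .ldt .b .fresh .a, .sub .b .b .one,
      .ld .l .left .fresh, .ld .r .right .fresh, .st .tgt .l .b, .sub .a .a .b, .st .tgt .r .a])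

namespace Layout

variable {C : Layout} {s : Store} {Q : ℕ → Store → Prop} {P : Problem}

lemma wp_extract (hC : Fits P C) (hconst : Consts P s) {tr : ℕ → SPTree}
    (hforest : BlockForest P.n P.c P.sz s.fresh {s.node 0} s.left s.right s.wt s.tab tr)
    (hup : ∀ A, P.Up A ↔ (tr (s.node 0)).Adm A)
    (hitems : (tr (s.node 0)).items = Finset.range P.n)
    (hroot : s.node 0 < s.fresh) (hn : P.n ≤ s.fresh) (hfresh : s.fresh ≤ 2 * P.n)
    (htgt : s.tgt = fun _ => 0)
    (hQ : ∀ t s' A, t ≤ 20 * P.c + 50 * P.n + 100 → Consts P s' → P.Optimal A →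
      (∀ v < P.n, 0 < s'.tgt v ↔ v ∈ A) → Q t s') :
    C.wp extract s Q := by
  obtain ⟨hzero, hone, htwo, hsn, hsc, hst⟩ := id hconst
  have hB := hC.le_B
  have hN := hC.N_eq
  have hR := hC.R_eq
  refine wp_seq (wp_ops _ ?_ ?_)
  · simp only [okList, ok, act, Store.get, Store.set, Store.arr, and_true, true_and, hsc, hone,
      hzero]
    omega
  simp only [actList, act, Store.get, Store.set, Store.arr, hsc, hone, hzero]
  refine wp_seq (wp_while (fun φ s' => ∃ j a b, s' = { s with
      zero := 0, one := 1, c := P.c, d := s.node 0, j := j, a := a, b := b, lim := P.c + 1 } ∧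
      j ≤ P.c + 1 ∧ a ≤ P.c ∧ s.tab (s.node 0) a ≠ 0 ∧
      (∀ i < j, s.tab (s.node 0) i ≠ 0 → i ≤ a) ∧ φ = 15 * (P.c + 1 - j)) (15 * (P.c + 1))
    ⟨0, 0, s.b, rfl, by omega, by omega, (hforest.table _ hroot).zero, by simp, rfl⟩ ?_ ?_)
  · rintro φ _ ⟨j, a, b, rfl, hj, ha, hta, hmax, rfl⟩ hlt
    simp only [Store.get] at hlt
    refine wp_seq (wp_ops _ ?_ ?_)
    · simp only [okList, ok, Store.get, and_true]
      omega
    simp only [actList, act, Store.get, Store.set]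
    refine wp_seq (wp_if (fun hb => wp_ops _ ?_ ?_) fun hb => wp_skip ?_)
    · simp only [okList, ok, and_true]
    · simp only [Store.get] at hb
      simp only [actList, act, Store.get, Store.set]
      refine wp_ops _ ?_ ?_
      · simp only [okList, ok, Store.get, and_true]
        omega
      simp only [actList, act, Store.get, Store.set]
      refine ⟨_, ⟨j + 1, j, _, rfl, by omega, by omega, hb.ne', fun i hi _ => by omega, rfl⟩, ?_⟩
      simp only [costList, cost]
      omega
    · simp only [Store.get] at hb
      refine wp_ops _ ?_ ?_
      · simp only [okList, ok, Store.get, and_true]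
        omega
      simp only [actList, act, Store.get, Store.set]
      refine ⟨_, ⟨j + 1, a, _, rfl, by omega, ha, hta, fun i hi hi0 => ?_, rfl⟩, ?_⟩
      · rcases Nat.lt_succ_iff_lt_or_eq.1 hi with h1 | rfl
        exacts [hmax i h1 hi0, absurd (Nat.pos_of_ne_zero hi0) hb]
      · simp only [costList, cost]
        omega
  rintro t φ _ ⟨j, a, b, rfl, hj, ha, hta, hmax, rfl⟩ hge htime
  simp only [Store.get] at hge
  refine wp_seq (wp_ops _ ?_ ?_)
  · simp only [okList, ok, Store.get, and_true]
    omega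
  simp only [actList, act, Store.get, Store.setArr, Store.arr, htgt]
  have hinit := Targets.init hforest ha hta
  refine wp_while (fun φ s' => ∃ f a' b' l r tgt, s' = { s with
      zero := 0, one := 1, c := P.c, d := s.node 0, j := j, lim := P.c + 1, fresh := f, a := a',
      b := b', l := l, r := r, tgt := tgt } ∧ P.n ≤ f ∧ f ≤ s.fresh ∧
      Targets P.c s.fresh s.left s.right s.tab tgt f ∧ tgt (s.node 0) = a ∧
      φ = 40 * (f - P.n)) (40 * (s.fresh - P.n))
    ⟨s.fresh, a, b, s.l, s.r, _, rfl, hn, le_rfl, hinit, Function.update_self .., rfl⟩ ?_ ?_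
  · rintro φ _ ⟨f, a', b', l, r, tgt, rfl, hf, hfF, ht, hta', rfl⟩ hlt
    simp only [Store.get, hsn] at hlt
    obtain ⟨d, rfl⟩ : ∃ d, f = d + 1 := ⟨f - 1, by omega⟩
    obtain ⟨hl, hr, hlL, hrL, -⟩ := hforest.node d (by omega) (by omega)
    have hc := ht.le d (by omega)
    refine wp_ops _ ?_ ?_
    · simp only [okList, ok, act, Store.get, Store.set, Store.arr, Store.setArr, and_true, true_and,
        Nat.add_sub_cancel]
      omega
    simp only [actList, act, Store.get, Store.set, Store.arr, Store.setArr, Nat.add_sub_cancel]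
    refine ⟨_, ⟨d, _, _, _, _, _, rfl, by omega, by omega, ht.step hforest (by omega) (by omega),
      ?_, rfl⟩, ?_⟩
    -- The root is not a part of any block, so its target is never overwritten.
    · rw [Finset.mem_singleton, eq_comm] at hlL hrL
      rw [Function.update_of_ne hrL, Function.update_of_ne hlL, hta']
    · simp only [costList, cost]
      omega
  · rintro u ψ _ ⟨f, a', b', l, r, tgt, rfl, hf, hfF, ht, hta', rfl⟩ hge' htime'
    simp only [Store.get, hsn] at hge'
    obtain rfl : f = P.n := by omega
    refine hQ _ _ _ ?_ ⟨rfl, rfl, htwo, hsn, rfl, hst⟩ (ht.optimal hforest hroot hup hitems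
      fun i hi hi0 => hta' ▸ hmax i (by omega) hi0) fun v hv => ?_
    · simp only [costList, cost]
      omega
    · simp [hv, Nat.pos_iff_ne_zero]

end Layout

end RAM

/-! ### The memory layout and the output -/

namespace RAM

/-- From the machine state `σ` the program `p` terminates after a number of steps and in a machine
state which satisfy `Q`. -/
def Reaches (inp : List ℕ) (S W : ℕ) (p : Prog) (σ : State) (Q : ℕ → State → Prop) : Prop :=
  ∃ t τ, Run inp S W p σ t τ ∧ Q t τ

namespace Reaches

variable {inp : List ℕ} {S W : ℕ} {p q : Prog} {σ : State} {Q : ℕ → State → Prop} {r a b : ℕ}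

lemma mono {Q' : ℕ → State → Prop} (h : Reaches inp S W p σ Q) (hQ : ∀ t τ, Q t τ → Q' t τ) :
    Reaches inp S W p σ Q' := by
  obtain ⟨t, τ, h1, h2⟩ := h
  exact ⟨t, τ, h1, hQ t τ h2⟩

lemma seq (h : Reaches inp S W p σ fun t τ => Reaches inp S W q τ fun u υ => Q (t + u) υ) :
    Reaches inp S W (.seq p q) σ Q := by
  obtain ⟨t, τ, h1, u, υ, h2, h3⟩ := h
  exact ⟨_, υ, .seq h1 h2, h3⟩

lemma ifLt (h1 : σ.reg a < σ.reg b → Reaches inp S W p σ fun t τ => Q (1 + t) τ)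
    (h2 : ¬ σ.reg a < σ.reg b → Reaches inp S W q σ fun t τ => Q (1 + t) τ) :
    Reaches inp S W (.ifLt a b p q) σ Q := by
  by_cases h : σ.reg a < σ.reg b
  · obtain ⟨t, τ, h3, h4⟩ := h1 h
    exact ⟨_, τ, .ifTrue h h3, h4⟩
  · obtain ⟨t, τ, h3, h4⟩ := h2 h
    exact ⟨_, τ, .ifFalse h h3, h4⟩

lemma whileLt (I : ℕ → State → Prop) (φ : ℕ) (hI : I φ σ)
    (hstep : ∀ φ σ, I φ σ → σ.reg a < σ.reg b →
      Reaches inp S W p σ fun t τ => ∃ φ', I φ' τ ∧ t + 1 + φ' ≤ φ)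
    (hQ : ∀ t φ' τ, I φ' τ → ¬ τ.reg a < τ.reg b → t + φ' ≤ φ + 1 → Q t τ) :
    Reaches inp S W (.whileLt a b p) σ Q := by
  induction φ using Nat.strong_induction_on generalizing σ Q with
  | _ φ ih =>
    by_cases h : σ.reg a < σ.reg b
    · obtain ⟨t, τ, h1, φ', h3, h4⟩ := hstep φ σ hI h
      obtain ⟨u, υ, h5, h6⟩ := ih φ' (by omega) h3 (Q := fun u υ => Q (1 + t + u) υ)
        fun u ψ υ h5 h6 h7 => hQ _ ψ υ h5 h6 (by omega)
      exact ⟨_, υ, .whileTrue h h1 h5, h6⟩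
    · exact ⟨1, σ, .whileFalse h, hQ 1 φ σ hI h (by omega)⟩

lemma const {k : ℕ} (hk : k ≤ W) (hQ : Q 1 ⟨Function.update σ.reg r k, σ.mem⟩) :
    Reaches inp S W (.instr (.const r k)) σ Q :=
  ⟨_, _, .instr (Layout.setReg_eq hk), hQ⟩

lemma copy (hk : σ.reg a ≤ W) (hQ : Q 1 ⟨Function.update σ.reg r (σ.reg a), σ.mem⟩) :
    Reaches inp S W (.instr (.copy r a)) σ Q :=
  ⟨_, _, .instr (Layout.setReg_eq hk), hQ⟩

lemma add (hk : σ.reg a + σ.reg b ≤ W)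
    (hQ : Q 1 ⟨Function.update σ.reg r (σ.reg a + σ.reg b), σ.mem⟩) :
    Reaches inp S W (.instr (.add r a b)) σ Q :=
  ⟨_, _, .instr (Layout.setReg_eq hk), hQ⟩

lemma input (hk : inp.getD (σ.reg a) 0 ≤ W)
    (hQ : Q 1 ⟨Function.update σ.reg r (inp.getD (σ.reg a) 0), σ.mem⟩) :
    Reaches inp S W (.instr (.input r a)) σ Q :=
  ⟨_, _, .instr (Layout.setReg_eq hk), hQ⟩

lemma load (ha : σ.reg a < S) (hk : σ.mem (σ.reg a) ≤ W)
    (hQ : Q 1 ⟨Function.update σ.reg r (σ.mem (σ.reg a)), σ.mem⟩) :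
    Reaches inp S W (.instr (.load r a)) σ Q :=
  ⟨_, _, .instr (by rw [Instr.exec, if_pos ha, Layout.setReg_eq hk]), hQ⟩

lemma store (ha : σ.reg a < S)
    (hQ : Q 1 ⟨σ.reg, Function.update σ.mem (σ.reg a) (σ.reg b)⟩) :
    Reaches inp S W (.instr (.store a b)) σ Q :=
  ⟨_, _, .instr (by rw [Instr.exec, if_pos ha]), hQ⟩

end Reaches

lemma update_reg (f : ℕ → ℕ) (x y : Var) (z : ℕ) :
    Function.update f x.reg z y.reg = if y = x then z else f y.reg := by
  rcases eq_or_ne y x with rfl | h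
  · simp
  · rw [Function.update_of_ne (fun h1 => h (Var.reg_injective h1)), if_neg h]

lemma update_zero_reg (f : ℕ → ℕ) (y : Var) (z : ℕ) : Function.update f 0 z y.reg = f y.reg :=
  Function.update_of_ne y.reg_ne_zero _ _

lemma update_one_reg (f : ℕ → ℕ) (y : Var) (z : ℕ) : Function.update f 1 z y.reg = f y.reg :=
  Function.update_of_ne y.reg_ne_one _ _

/-- The store at the beginning, for `n` items and the capacity `c`. -/
def Store.start (n c : ℕ) : Store where
  zero := 0
  one := 1
  two := 2
  n := n
  c := c
  off := 0
  arc := 0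
  t := 0
  fresh := 0
  k := 0
  d := 0
  x := 0
  y := 0
  ct := 0
  b := 0
  l := 0
  r := c + 17
  a := 0
  e := 0
  g := 0
  s := 0
  kk := 0
  j := 2 * n + 2
  lim := 2 * n + 2
  wr := 0
  v := 0
  w := 0
  p := 2 * n + 2 + (2 * n + 2) * (c + 17)
  pe := 0
  h := 0
  qh := 0
  qt := 0
  indeg _ := 0
  tail _ := 0
  head _ := 0
  queue _ := 0
  cnt _ := 0
  temp _ := 0
  node _ := 0
  tag _ := 0
  left _ := 0
  right _ := 0
  wt _ := 0
  tgt _ := 0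
  tab _ _ := 0

/-- Read the number of items and the capacity and write the pointers to the records. -/
def setup : Prog :=
  .instr (.input Var.n.reg Var.zero.reg) ;;
  .instr (.const Var.one.reg 1) ;;
  .instr (.input Var.c.reg Var.one.reg) ;;
  .instr (.const Var.r.reg 17) ;;
  .instr (.add Var.r.reg Var.c.reg Var.r.reg) ;;
  .instr (.const Var.two.reg 2) ;;
  .instr (.add Var.lim.reg Var.n.reg Var.n.reg) ;;
  .instr (.add Var.lim.reg Var.lim.reg Var.two.reg) ;;
  .instr (.copy Var.p.reg Var.lim.reg) ;;
  loop .j .lim (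
    .instr (.store Var.j.reg Var.p.reg) ;;
    .instr (.add Var.p.reg Var.p.reg Var.r.reg) ;;
    .instr (.add Var.j.reg Var.j.reg Var.one.reg))

/-- No store is represented before the pointers exist, so this program is treated on bare machine
states. The machine cannot multiply; the record addresses are produced by repeated addition and kept
in the first cells. -/
lemma reaches_setup {C : Layout} {n c : ℕ} (hn : C.inp.getD 0 0 = n) (hc : C.inp.getD 1 0 = c)
    (hN : C.N = 2 * n + 2) (hR : C.R = c + 17) (hB : C.N + C.N * C.R ≤ C.B) :
    Reaches C.inp C.S C.W setup .init fun t τ =>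
      t ≤ 20 * n + 30 ∧ C.Repr τ (Store.start n c) := by
  have hW := C.B_le
  have hS := C.le_S
  have hRN := C.R_le
  have hinit : ∀ x : Var, State.init.reg x.reg = 0 := fun _ => rfl
  refine .seq (.input ?_ (.seq (.const ?_ (.seq (.input ?_ (.seq (.const ?_ (.seq (.add ?_
    (.seq (.const ?_ (.seq (.add ?_ (.seq (.add ?_ (.seq (.copy ?_ ?_)))))))))))))))))
  all_goals try simp only [update_reg, hinit, hn, hc, if_true, reduceCtorEq, if_false]
  any_goals omega
  set ρ := Function.update (Function.update (Function.update (Function.update (Function.update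
    (Function.update (Function.update (Function.update (Function.update State.init.reg Var.n.reg n)
    Var.one.reg 1) Var.c.reg c) Var.r.reg 17) Var.r.reg (c + 17)) Var.two.reg 2) Var.lim.reg
    (n + n)) Var.lim.reg (n + n + 2)) Var.p.reg (n + n + 2) with hρ
  refine .whileLt (fun φ σ => ∃ i ≤ C.N, σ.reg Var.p.reg = C.N + i * C.R ∧ σ.reg Var.j.reg = i ∧
    (∀ x : Var, x ≠ .p → x ≠ .j → σ.reg x.reg = ρ x.reg) ∧
    (∀ a, σ.mem a = if a < i then C.N + a * C.R else 0) ∧ φ = 5 * (C.N - i)) (5 * C.N)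
    ⟨0, by omega, ?_, ?_, fun _ _ _ => rfl, fun _ => rfl, rfl⟩ ?_ ?_
  · simp only [hρ, update_reg, if_true]
    omega
  · simp only [hρ, update_reg, reduceCtorEq, if_false]
    rfl
  · rintro φ σ ⟨i, hi, h1, h2, h3, h4, rfl⟩ hlt
    have hlim : σ.reg Var.lim.reg = C.N := by
      rw [h3 _ (by simp) (by simp)]
      simp only [hρ, update_reg, reduceCtorEq, if_true, if_false]
      omega
    have hr : σ.reg Var.r.reg = C.R := by
      rw [h3 _ (by simp) (by simp)]
      simp only [hρ, update_reg, reduceCtorEq, if_true, if_false]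
      omega
    have hone : σ.reg Var.one.reg = 1 := by
      rw [h3 _ (by simp) (by simp)]
      simp only [hρ, update_reg, reduceCtorEq, if_true, if_false]
    rw [h2, hlim] at hlt
    have h5 : (i + 1) * C.R ≤ C.N * C.R := Nat.mul_le_mul_right _ hlt
    have h6 := add_mul i 1 C.R
    refine .seq (.store ?_ (.seq (.add ?_ (.add ?_ ?_))))
    all_goals simp only [update_reg, h1, h2, hr, hone, if_true, reduceCtorEq, if_false]
    any_goals omega
    refine ⟨_, ⟨i + 1, by omega, by omega, rfl, fun x hx1 hx2 => ?_, fun a => ?_, rfl⟩, by omega⟩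
    · rw [if_neg hx2, if_neg hx1, h3 x hx1 hx2]
    · rw [Function.update_apply, h4]
      split_ifs <;> first | omega | (subst_vars; rfl)
  · rintro t φ σ ⟨i, hi, h1, h2, h3, h4, rfl⟩ hge ht
    have hlim : σ.reg Var.lim.reg = C.N := by
      rw [h3 _ (by simp) (by simp)]
      simp only [hρ, update_reg, reduceCtorEq, if_true, if_false]
      omega
    rw [h2, hlim] at hge
    obtain rfl : i = C.N := by omega
    refine ⟨by omega, ?_, fun i hi => ?_, fun i hi A => ?_, fun i hi j hj => ?_, ?_, ?_, ?_⟩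
    · intro x
      by_cases hxp : x = .p
      · rw [hxp, h1, hN, hR]
        rfl
      by_cases hxj : x = .j
      · rw [hxj, h2, hN]
        rfl
      rw [h3 x hxp hxj]
      cases x <;> simp only [hρ, update_reg, reduceCtorEq, if_true, if_false, Store.start,
        Store.get, hinit, not_true_eq_false] at * <;> omega
    · rw [h4, if_pos hi]
    · rw [h4, if_neg (by omega)]
      cases A <;> rfl
    · rw [h4, if_neg (by omega)]
      rfl
    · have h6 : C.N * C.R = (2 * n + 2) * (c + 17) := by rw [hN, hR]
      intro x
      cases x <;> simp only [Store.start, Store.get] <;> omega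
    · intro A i
      cases A <;> exact Nat.zero_le _
    · intro i j
      exact Nat.zero_le _

/-- Write the characteristic vector of the solution to the first memory cells. -/
def output : Prog :=
  .instr (.copy Var.v.reg Var.zero.reg) ;;
  loop .v .n (
    .instr (.load 0 Var.v.reg) ;;
    .instr (.const 1 Arr.tgt.ctorIdx) ;;
    .instr (.add 0 0 1) ;;
    .instr (.load Var.a.reg 0) ;;
    ite .zero .a (.instr (.store Var.v.reg Var.one.reg))
      (.instr (.store Var.v.reg Var.zero.reg)) ;;
    .instr (.add Var.v.reg Var.v.reg Var.one.reg))

/-- The output replaces the pointers. The pointer in cell `k` is read just before it is overwritten,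
the later ones are still intact, and the records lie beyond all pointers. -/
lemma reaches_output {C : Layout} {s : Store} {σ : State} (hσ : C.Repr σ s) (hzero : s.zero = 0)
    (hone : s.one = 1) (hn : s.n < C.N) :
    Reaches C.inp C.S C.W output σ fun t τ => t ≤ 20 * s.n + 10 ∧
      ∀ v < s.n, τ.mem v = if 0 < s.tgt v then 1 else 0 := by
  have hS := C.le_S
  have hW := C.le_W
  have hB := C.B_le
  have hA := Arr.tgt.ctorIdx_lt
  have hR := C.lt_R
  refine .seq (.copy ((hσ.get_le .zero).trans hB |>.trans' (hσ.reg .zero).le) ?_)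
  rw [hσ.reg, Store.get, hzero]
  refine .whileLt (fun φ τ => ∃ k ≤ s.n, τ.reg Var.v.reg = k ∧
    (∀ x : Var, x ≠ .v → x ≠ .a → τ.reg x.reg = s.get x) ∧
    (∀ v < k, τ.mem v = if 0 < s.tgt v then 1 else 0) ∧ (∀ a, k ≤ a → τ.mem a = σ.mem a) ∧
    φ = 12 * (s.n - k)) (12 * s.n) ⟨0, by omega, ?_, ?_, by simp, fun _ _ => rfl, rfl⟩ ?_ ?_
  · simp only [Function.update_self]
  · intro x hx _
    exact (update_reg ..).trans (by rw [if_neg hx, hσ.reg])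
  · rintro φ τ ⟨k, hk, h1, h2, h3, h4, rfl⟩ hlt
    have e0 := h2 .zero (by simp) (by simp)
    have e1 := h2 .one (by simp) (by simp)
    have en := h2 .n (by simp) (by simp)
    simp only [Store.get, hzero, hone] at e0 e1 en
    rw [h1, en] at hlt
    have hkN : k < C.N := by omega
    have h5 := C.addr_lt hkN (hA.trans hR)
    have h6 : τ.mem k = C.N + k * C.R := by rw [h4 k le_rfl, hσ.ptr k hkN]
    have h7 : τ.mem (C.N + k * C.R + Arr.tgt.ctorIdx) = s.tgt k := by
      rw [h4 _ (by omega), hσ.arr k hkN]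
      rfl
    have h8 : s.tgt k ≤ C.B := hσ.arr_le .tgt k
    refine .seq (.load (by omega) (by rw [h1, h6]; omega) ?_)
    refine .seq (.const (by omega) ?_)
    refine .seq (.add ?_ (.seq (.load ?_ ?_ (.seq (.ifLt (fun ha => .store ?_ (.add ?_ ?_))
      fun ha => .store ?_ (.add ?_ ?_))))))
    all_goals simp only [update_reg, update_zero_reg, update_one_reg, Function.update_self,
      Function.update_of_ne zero_ne_one, h1, h6, h7, e0, e1, reduceCtorEq, if_false] at *
    any_goals omega
    all_goals
      refine ⟨_, ⟨k + 1, by omega, rfl, fun x hx1 hx2 => ?_, fun v hv => ?_, fun a ha' => ?_, rfl⟩,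
        by omega⟩
      · rw [if_neg hx1, if_neg hx2, h2 x hx1 hx2]
      · rcases Nat.lt_succ_iff_lt_or_eq.1 hv with h9 | rfl
        · rw [Function.update_of_ne h9.ne, h3 v h9]
        · rw [Function.update_self]
          simp only [ha, if_true, if_false]
      · rw [Function.update_of_ne (by omega), h4 a (by omega)]
  · rintro t φ τ ⟨k, hk, h1, h2, h3, h4, rfl⟩ hge ht
    have en := h2 .n (by simp) (by simp)
    simp only [Store.get] at en
    rw [h1, en] at hge
    exact ⟨by omega, fun v hv => h3 v (by omega)⟩

end RAM

/-! ### Topological sorting -/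

/-- The labels `tail` and `head` represent a digraph as a line digraph: each item leads from its
tail to its head. -/
structure Labelling (n : ℕ) (E : ℕ → ℕ → Prop) (tail head : ℕ → ℕ) : Prop where
  arc_iff : ∀ u < n, ∀ v < n, E u v ↔ head u = tail v
  tail_le : ∀ v < n, tail v ≤ n
  tail_eq_zero : ∀ v < n, (∀ u < n, ¬ E u v) → tail v = 0
  tail_ne_zero : ∀ u < n, ∀ v < n, E u v → tail v ≠ 0
  head_eq : ∀ u < n, (∀ v < n, ¬ E u v) → head u = n + 1

namespace Labelling

variable {n : ℕ} {E : ℕ → ℕ → Prop} {tail head : ℕ → ℕ}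

lemma head_le (h : Labelling n E tail head) (u : ℕ) (hu : u < n) : head u ≤ n + 1 := by
  by_cases hs : ∀ v < n, ¬ E u v
  · exact (h.head_eq u hu hs).le
  · push Not at hs
    obtain ⟨v, hv, huv⟩ := hs
    rw [(h.arc_iff u hu v hv).1 huv]
    exact (h.tail_le v hv).trans n.le_succ

/-- Two line representations of the same digraph differ by an injective renaming of the vertices: a
vertex is determined by the arcs entering or leaving it, and adjacency is the same in both. -/
lemma ttsp (h : Labelling n E tail head) {tl hd : ℕ → ℕ} {a b : ℕ}
    (hE : ∀ u < n, ∀ v < n, E u v ↔ hd u = tl v)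
    (hT : TTSP (blockArcs (Finset.range n) tl hd) a b) :
    TTSP (blockArcs (Finset.range n) tail head) 0 (n + 1) := by
  classical
  have mem : ∀ v < n, (tl v, hd v) ∈ blockArcs (Finset.range n) tl hd := fun v hv =>
    mem_blockArcs.2 ⟨v, Finset.mem_range.2 hv, rfl⟩
  have tl_ne : ∀ v < n, tl v ≠ b := fun v hv => hT.fst_ne_target _ (mem v hv)
  have hd_ne : ∀ v < n, hd v ≠ a := fun v hv => hT.snd_ne_source _ (mem v hv)
  have out : ∀ x, IsEndpoint (blockArcs (Finset.range n) tl hd) x → x ≠ b →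
      ∃ v < n, tl v = x := by
    intro x hx hxb
    obtain ⟨e, he, hex⟩ := hT.exists_out x hx hxb
    obtain ⟨v, hv, rfl⟩ := mem_blockArcs.1 he
    exact ⟨v, Finset.mem_range.1 hv, hex⟩
  have inn : ∀ x, IsEndpoint (blockArcs (Finset.range n) tl hd) x → x ≠ a →
      ∃ v < n, hd v = x := by
    intro x hx hxb
    obtain ⟨e, he, hex⟩ := hT.exists_in x hx hxb
    obtain ⟨v, hv, rfl⟩ := mem_blockArcs.1 he
    exact ⟨v, Finset.mem_range.1 hv, hex⟩
  have src : ∀ v < n, tl v = a → tail v = 0 := by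
    intro v hv hva
    refine h.tail_eq_zero v hv fun u hu huv => ?_
    exact hd_ne u hu (((hE u hu v hv).1 huv).trans hva)
  have snk : ∀ u < n, hd u = b → head u = n + 1 := by
    intro u hu hub
    refine h.head_eq u hu fun v hv huv => ?_
    exact tl_ne v hv (((hE u hu v hv).1 huv).symm.trans hub)
  have congr : ∀ v < n, ∀ w < n, tl v = tl w → tail v = tail w := by
    intro v hv w hw hvw
    by_cases hs : tl v = a
    · rw [src v hv hs, src w hw (hvw ▸ hs)]
    · obtain ⟨u, hu, huv⟩ := inn _ (isEndpoint_fst (mem v hv)) hs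
      rw [← (h.arc_iff u hu v hv).1 ((hE u hu v hv).2 huv),
        (h.arc_iff u hu w hw).1 ((hE u hu w hw).2 (huv.trans hvw))]
  -- Every endpoint other than `b` is the tail of some item, so the default `0` is never taken on
  -- endpoints.
  let f : ℕ → ℕ := fun x => if x = b then n + 1 else if h : ∃ v < n, tl v = x then tail h.choose
    else 0
  have f_tl : ∀ v < n, f (tl v) = tail v := by
    intro v hv
    have h1 : ∃ w < n, tl w = tl v := ⟨v, hv, rfl⟩
    simp only [f, if_neg (tl_ne v hv), dif_pos h1]
    exact congr _ h1.choose_spec.1 v hv h1.choose_spec.2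
  have f_b : f b = n + 1 := if_pos rfl
  have f_hd : ∀ u < n, f (hd u) = head u := by
    intro u hu
    by_cases hub : hd u = b
    · rw [hub, f_b, snk u hu hub]
    · obtain ⟨v, hv, hvu⟩ := out _ (isEndpoint_snd (mem u hu)) hub
      have hvu : tl v = hd u := hvu
      rw [← hvu, f_tl v hv, (h.arc_iff u hu v hv).1 ((hE u hu v hv).2 hvu.symm)]
  have f_a : f a = 0 := by
    obtain ⟨v, hv, hva⟩ := out a hT.isEndpoint_source hT.ne
    rw [← hva, f_tl v hv, src v hv hva]
  have hmap : (blockArcs (Finset.range n) tl hd).map (fun e => (f e.1, f e.2)) =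
      blockArcs (Finset.range n) tail head := by
    rw [blockArcs, blockArcs, Multiset.map_map]
    refine Multiset.map_congr rfl fun v hv => ?_
    have hv := Finset.mem_range.1 hv
    exact Prod.ext (f_tl v hv) (f_hd v hv)
  have := hT.map f ?_
  · rwa [hmap, f_a, f_b] at this
  intro x y hx hy hxy
  -- Injectivity on tails: an item whose tail is not the source has a predecessor, and that
  -- predecessor then precedes both items. If neither item has a predecessor, both start in `a`.
  have key : ∀ v < n, ∀ w < n, tail v = tail w → tl v = tl w := by
    have half : ∀ v < n, ∀ w < n, tail v = tail w → tl v ≠ a → tl v = tl w := by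
      intro v hv w hw hvw hva
      obtain ⟨u, hu, huv⟩ := inn _ (isEndpoint_fst (mem v hv)) hva
      have h1 := (h.arc_iff u hu v hv).1 ((hE u hu v hv).2 huv)
      have huv : hd u = tl v := huv
      rw [← huv]
      exact (hE u hu w hw).1 ((h.arc_iff u hu w hw).2 (h1.trans hvw))
    intro v hv w hw hvw
    by_cases h1 : tl v = a
    · by_cases h2 : tl w = a
      · rw [h1, h2]
      · exact (half w hw v hv hvw.symm h2).symm
    · exact half v hv w hw hvw h1
  by_cases hxb : x = b <;> by_cases hyb : y = b
  · rw [hxb, hyb]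
  · obtain ⟨w, hw, rfl⟩ := out y hy hyb
    rw [hxb, f_b, f_tl w hw] at hxy
    have := h.tail_le w hw
    omega
  · obtain ⟨v, hv, rfl⟩ := out x hx hxb
    rw [hyb, f_b, f_tl v hv] at hxy
    have := h.tail_le v hv
    omega
  · obtain ⟨v, hv, rfl⟩ := out x hx hxb
    obtain ⟨w, hw, rfl⟩ := out y hy hyb
    rw [f_tl v hv, f_tl w hw] at hxy
    exact key v hv w hw hxy

end Labelling

/-- The state of the topological sorting of the digraph with the arcs `(src j, dst j)`, `j < m`.
The arcs in `J` have been processed, they start at the first `z` items of the queue `q`, which has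
`qt` entries. The items satisfying `X` are exempt from the requirement that they are in the queue
as soon as all incoming arcs have been processed. -/
structure Sorting (n m : ℕ) (src dst : ℕ → ℕ) (X : ℕ → Prop) (J : Finset ℕ) (q : ℕ → ℕ)
    (z qt : ℕ) (indeg tail : ℕ → ℕ) : Prop where
  lt : ∀ i < qt, q i < n
  inj : ∀ i < qt, ∀ j < qt, q i = q j → i = j
  le : z ≤ qt
  indeg_eq : ∀ w, indeg w = ((Finset.range m).filter fun e => dst e = w ∧ e ∉ J).card
  queued : ∀ w < n, indeg w = 0 → X w ∨ ∃ i < qt, q i = w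
  preds : ∀ i < qt, ∀ e < m, dst e = q i → e ∈ J ∧ ∃ a < z, a < i ∧ src e = q a
  started : ∀ e ∈ J, e < m ∧ ∃ a < z, src e = q a
  near : ∀ i j, i < j → j < qt → ∀ a < z, ∀ e < m, dst e = q i → src e = q a →
    ∃ b < z, a ≤ b ∧ ∃ f < m, dst f = q j ∧ src f = q b
  tail_zero : ∀ w, tail w = 0 → ∀ e ∈ J, dst e ≠ w
  tail_pos : ∀ w, tail w ≠ 0 → ∃ a < z, tail w = q a + 1 ∧ (∃ e ∈ J, src e = q a ∧ dst e = w) ∧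
    ∀ e ∈ J, dst e = w → ∀ b < z, src e = q b → a ≤ b

namespace Sorting

variable {n m : ℕ} {src dst : ℕ → ℕ} {X : ℕ → Prop} {J : Finset ℕ} {q : ℕ → ℕ} {z qt : ℕ}
  {indeg tail : ℕ → ℕ}

lemma qt_le (h : Sorting n m src dst X J q z qt indeg tail) : qt ≤ n := by
  have h1 : (Finset.range qt).image q ⊆ Finset.range n := by
    intro x hx
    obtain ⟨i, hi, rfl⟩ := Finset.mem_image.1 hx
    exact Finset.mem_range.2 (h.lt i (Finset.mem_range.1 hi))
  have h2 := Finset.card_le_card h1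
  rwa [Finset.card_image_of_injOn, Finset.card_range, Finset.card_range] at h2
  intro i hi j hj hij
  exact h.inj i (by simpa using hi) j (by simpa using hj) hij

/-- The exemption is written as `0 ≤ w` to match the loop of `enter`, in which the items not yet
inspected are exempt. -/
lemma init (h : ∀ w, indeg w = ((Finset.range m).filter fun e => dst e = w).card) (q : ℕ → ℕ) :
    Sorting n m src dst (fun w => 0 ≤ w) ∅ q 0 0 indeg (fun _ => 0) where
  lt i hi := absurd hi i.not_lt_zero
  inj i hi := absurd hi i.not_lt_zero
  le := le_rfl
  indeg_eq w := by simp [h]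
  queued w _ _ := .inl w.zero_le
  preds i hi := absurd hi i.not_lt_zero
  started e he := absurd he (Finset.notMem_empty e)
  near i j _ hj := absurd hj j.not_lt_zero
  tail_zero w _ e he := absurd he (Finset.notMem_empty e)
  tail_pos w hw := absurd rfl hw

/-- The item `w` enters the queue. -/
lemma push (h : Sorting n m src dst X J q z qt indeg tail) {w : ℕ} (hw : w < n)
    (hdeg : indeg w = 0) (hq : ∀ i < qt, q i ≠ w)
    (hnear : ∀ a < z, ∃ b < z, a ≤ b ∧ ∃ f < m, dst f = w ∧ src f = q b) :
    Sorting n m src dst (fun x => X x ∧ x ≠ w) J (Function.update q qt w) z (qt + 1) indeg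
      tail := by
  have hne : ∀ a < z, Function.update q qt w a = q a := fun a ha =>
    Function.update_of_ne (by have := h.le; omega) _ _
  have hold : ∀ a < qt, Function.update q qt w a = q a := fun a ha =>
    Function.update_of_ne ha.ne _ _
  have hlt : ∀ i < qt + 1, i < qt ∨ i = qt := fun i hi => by omega
  refine ⟨fun i hi => ?_, fun i hi j hj hij => ?_, h.le.trans qt.le_succ, h.indeg_eq,
    fun x hx hx0 => ?_, fun i hi e he hei => ?_, fun e he => ?_,
    fun i j hij hj a ha e he hei hea => ?_, h.tail_zero, fun x hx => ?_⟩
  · rcases hlt i hi with hi | rfl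
    · rw [hold i hi]
      exact h.lt i hi
    · rwa [Function.update_self]
  · rcases hlt i hi with hi | rfl <;> rcases hlt j hj with hj | rfl
    · rw [hold i hi, hold j hj] at hij
      exact h.inj i hi j hj hij
    · rw [hold i hi, Function.update_self] at hij
      exact absurd hij (hq i hi)
    · rw [hold j hj, Function.update_self] at hij
      exact absurd hij.symm (hq j hj)
    · rfl
  · by_cases hxw : x = w
    · exact .inr ⟨qt, by omega, by rw [Function.update_self, hxw]⟩
    · rcases h.queued x hx hx0 with h1 | ⟨i, hi, h1⟩
      · exact .inl ⟨h1, hxw⟩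
      · exact .inr ⟨i, by omega, by rw [hold i hi, h1]⟩
  · rcases hlt i hi with hi | rfl
    · rw [hold i hi] at hei
      obtain ⟨h1, a, ha, hai, h2⟩ := h.preds i hi e he hei
      exact ⟨h1, a, ha, hai, by rw [hne a ha, h2]⟩
    · rw [Function.update_self] at hei
      have h1 : e ∈ J := by
        by_contra h1
        rw [h.indeg_eq, Finset.card_eq_zero, Finset.filter_eq_empty_iff] at hdeg
        exact hdeg (Finset.mem_range.2 he) ⟨hei, h1⟩
      obtain ⟨-, a, ha, h2⟩ := h.started e h1
      exact ⟨h1, a, ha, ha.trans_le h.le, by rw [hne a ha, h2]⟩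
  · obtain ⟨h1, a, ha, h2⟩ := h.started e he
    exact ⟨h1, a, ha, by rw [hne a ha, h2]⟩
  · rw [hne a ha] at hea
    rw [hold i (by omega)] at hei
    rcases hlt j hj with hj | rfl
    · obtain ⟨b, hb, hab, f, hf, h1, h2⟩ := h.near i j hij hj a ha e he hei hea
      exact ⟨b, hb, hab, f, hf, by rw [hold j hj, h1], by rw [hne b hb, h2]⟩
    · obtain ⟨b, hb, hab, f, hf, h1, h2⟩ := hnear a ha
      exact ⟨b, hb, hab, f, hf, by rw [Function.update_self, h1], by rw [hne b hb, h2]⟩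
  · obtain ⟨a, ha, h1, ⟨e, he, h2, h3⟩, h4⟩ := h.tail_pos x hx
    refine ⟨a, ha, by rw [hne a ha, h1], ⟨e, he, by rw [hne a ha, h2], h3⟩,
      fun f hf hfx b hb hfb => ?_⟩
    rw [hne b hb] at hfb
    exact h4 f hf hfx b hb hfb

lemma exempt (h : Sorting n m src dst X J q z qt indeg tail) {Y : ℕ → Prop}
    (hXY : ∀ w < n, indeg w = 0 → X w → Y w) : Sorting n m src dst Y J q z qt indeg tail where
  __ := h
  queued w hw hw0 := (h.queued w hw hw0).imp_left (hXY w hw hw0)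

/-- The next item of the queue is taken up. -/
lemma start (h : Sorting n m src dst X J q z qt indeg tail) (hz : z < qt) :
    Sorting n m src dst X J q (z + 1) qt indeg tail where
  lt := h.lt
  inj := h.inj
  le := hz
  indeg_eq := h.indeg_eq
  queued := h.queued
  preds i hi e he hei := by
    obtain ⟨h1, a, ha, h2⟩ := h.preds i hi e he hei
    exact ⟨h1, a, by omega, h2⟩
  started e he := by
    obtain ⟨h1, a, ha, h2⟩ := h.started e he
    exact ⟨h1, a, by omega, h2⟩
  near i j hij hj a ha e he hei hea := by
    obtain ⟨-, a', ha', -, h1⟩ := h.preds i (hij.trans hj) e he hei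
    obtain rfl := h.inj a (by omega) a' (by omega) (hea.symm.trans h1)
    obtain ⟨b, hb, h2⟩ := h.near i j hij hj a ha' e he hei hea
    exact ⟨b, by omega, h2⟩
  tail_zero := h.tail_zero
  tail_pos w hw := by
    obtain ⟨a, ha, h1, h2, h3⟩ := h.tail_pos w hw
    refine ⟨a, by omega, h1, h2, fun e he hew b hb heb => ?_⟩
    obtain ⟨-, b', hb', h4⟩ := h.started e he
    obtain rfl := h.inj b (by omega) b' (by omega) (heb.symm.trans h4)
    exact h3 e he hew b hb' heb

/-- The arc `e` is processed. -/
lemma advance (h : Sorting n m src dst X J q (z + 1) qt indeg tail) {e : ℕ} (he : e < m)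
    (heJ : e ∉ J) (hsrc : src e = q z) :
    Sorting n m src dst (fun x => X x ∨ x = dst e) (insert e J) q (z + 1) qt
      (Function.update indeg (dst e) (indeg (dst e) - 1))
      (if tail (dst e) = 0 then Function.update tail (dst e) (q z + 1) else tail) := by
  have hz := h.le
  have hdeg : ∀ w, w ≠ dst e → ((Finset.range m).filter fun f => dst f = w ∧ f ∉ insert e J) =
      (Finset.range m).filter fun f => dst f = w ∧ f ∉ J := by
    refine fun w hw => Finset.filter_congr fun f _ => ?_
    rw [Finset.mem_insert, not_or]
    exact ⟨fun h1 => ⟨h1.1, h1.2.2⟩, fun h1 => ⟨h1.1, fun h2 => hw (by rw [← h1.1, h2]), h1.2⟩⟩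
  have hdege : ((Finset.range m).filter fun f => dst f = dst e ∧ f ∉ insert e J) =
      ((Finset.range m).filter fun f => dst f = dst e ∧ f ∉ J).erase e := by
    ext f
    simp only [Finset.mem_filter, Finset.mem_erase, Finset.mem_insert, not_or]
    tauto
  have hsub : ∀ f, f ∈ J → f ∈ insert e J := fun f => Finset.mem_insert_of_mem
  -- The new arc starts at the latest item taken up, so it cannot lower the position of a first
  -- predecessor.
  have tail_pos' : ∀ w, tail w ≠ 0 → ∃ a < z + 1, tail w = q a + 1 ∧
      (∃ f ∈ insert e J, src f = q a ∧ dst f = w) ∧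
      ∀ f ∈ insert e J, dst f = w → ∀ b < z + 1, src f = q b → a ≤ b := by
    intro w hw
    obtain ⟨a, ha, h1, ⟨f, hf, h2⟩, h3⟩ := h.tail_pos w hw
    refine ⟨a, ha, h1, ⟨f, hsub f hf, h2⟩, fun g hg hgw b hb hgb => ?_⟩
    rcases Finset.mem_insert.1 hg with rfl | hg
    · obtain rfl := h.inj b (by omega) z (by omega) (hgb.symm.trans hsrc)
      omega
    · exact h3 g hg hgw b hb hgb
  refine ⟨h.lt, h.inj, h.le, fun w => ?_, fun w hw hw0 => ?_, fun i hi f hf hfi => ?_,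
    fun f hf => ?_, h.near, fun w hw f hf hfw => ?_, fun w hw => ?_⟩
  · rcases eq_or_ne w (dst e) with rfl | hwe
    · rw [Function.update_self, hdege, Finset.card_erase_of_mem (by simp [he, heJ]), h.indeg_eq]
    · rw [Function.update_of_ne hwe, hdeg w hwe, h.indeg_eq]
  · rcases eq_or_ne w (dst e) with rfl | hwe
    -- The end of the processed arc is exempt until it has been decided whether it enters the queue.
    · exact .inl (.inr rfl)
    · rw [Function.update_of_ne hwe] at hw0
      exact (h.queued w hw hw0).imp_left .inl
  · obtain ⟨h1, h2⟩ := h.preds i hi f hf hfi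
    exact ⟨hsub f h1, h2⟩
  · rcases Finset.mem_insert.1 hf with rfl | hf
    exacts [⟨he, z, by omega, hsrc⟩, h.started f hf]
  · split_ifs at hw with h0
    · rcases eq_or_ne w (dst e) with rfl | hwe
      · rw [Function.update_self] at hw
        omega
      · rw [Function.update_of_ne hwe] at hw
        rcases Finset.mem_insert.1 hf with rfl | hf
        exacts [hwe hfw.symm, h.tail_zero w hw f hf hfw]
    · rcases Finset.mem_insert.1 hf with rfl | hf
      exacts [h0 (hfw ▸ hw), h.tail_zero w hw f hf hfw]
  · split_ifs at hw ⊢ with h0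
    · rcases eq_or_ne w (dst e) with rfl | hwe
      · rw [Function.update_self]
        refine ⟨z, by omega, rfl, ⟨e, Finset.mem_insert_self _ _, hsrc, rfl⟩,
          fun f hf hfw b hb hfb => ?_⟩
        rcases Finset.mem_insert.1 hf with rfl | hf
        · exact (h.inj b (by omega) z (by omega) (hfb.symm.trans hsrc)).ge
        · exact absurd hfw (h.tail_zero _ h0 f hf)
      · rw [Function.update_of_ne hwe] at hw ⊢
        exact tail_pos' w hw
    · exact tail_pos' w hw

lemma notMem_queue (h : Sorting n m src dst X J q z qt indeg tail) {e : ℕ} (he : e < m)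
    (heJ : e ∉ J) : ∀ i < qt, q i ≠ dst e := fun i hi hie => heJ (h.preds i hi e he hie.symm).1

/-- When all queued items have been processed, then these are all items. -/
lemma complete (h : Sorting n m src dst (fun _ => False) J q qt qt indeg tail)
    (hsrc : ∀ e < m, src e < n) {r : ℕ → ℕ} (hr : ∀ e < m, r (src e) < r (dst e))
    (hJ : ∀ e < m, (∃ a < qt, src e = q a) → e ∈ J) : ∀ w < n, ∃ i < qt, q i = w := by
  intro w
  induction hk : r w using Nat.strong_induction_on generalizing w with
  | _ k ih =>
    intro hw
    refine (h.queued w hw ?_).resolve_left id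
    rw [h.indeg_eq, Finset.card_eq_zero, Finset.filter_eq_empty_iff]
    rintro e he ⟨rfl, heJ⟩
    have he := Finset.mem_range.1 he
    obtain ⟨i, hi, h1⟩ := ih _ (hk ▸ hr e he) (src e) rfl (hsrc e he)
    exact heJ (hJ e he ⟨i, hi, h1.symm⟩)

lemma qt_eq (h : Sorting n m src dst X J q z qt indeg tail) (hq : ∀ w < n, ∃ i < qt, q i = w) :
    qt = n := by
  refine le_antisymm h.qt_le ?_
  have h1 : Finset.range n ⊆ (Finset.range qt).image q := by
    intro w hw
    obtain ⟨i, hi, h1⟩ := hq w (Finset.mem_range.1 hw)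
    exact Finset.mem_image.2 ⟨i, Finset.mem_range.2 hi, h1⟩
  simpa using (Finset.card_le_card h1).trans Finset.card_image_le

section Final

variable {tl hd head : ℕ → ℕ}
  (h : Sorting n m src dst X J q n n indeg tail)
  (hJ : ∀ e < m, e ∈ J) (hq : ∀ w < n, ∃ i < n, q i = w)
  (hdst : ∀ e < m, dst e < n)
  (hline : ∀ u < n, ∀ v < n, (∃ e < m, src e = u ∧ dst e = v) ↔ hd u = tl v)
  (hhead : ∀ u < n, (∀ e < m, src e ≠ u) ∧ head u = n + 1 ∨
    ∃ e < m, src e = u ∧ head u = tail (dst e))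

-- Items with equal tails in a line digraph have the same predecessors, hence the same first
-- predecessor in the queue.
include h hJ hline in
lemma tail_congr : ∀ v < n, ∀ w < n, tl v = tl w → tail v = tail w := by
  have key : ∀ v < n, ∀ w < n, tl v = tl w → tail v ≠ 0 → ∃ a < n, ∃ b < n, b ≤ a ∧
      tail v = q a + 1 ∧ tail w = q b + 1 := by
    intro v hv w hw hvw h0
    obtain ⟨a, ha, h1, ⟨e, he, hea, hev⟩, -⟩ := h.tail_pos v h0
    obtain ⟨f, hf, hfa, hfw⟩ := (hline (q a) (h.lt a ha) w hw).2
      (((hline _ (h.lt a ha) v hv).1 ⟨e, (h.started e he).1, hea, hev⟩).trans hvw)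
    have h0' : tail w ≠ 0 := fun h0' => h.tail_zero w h0' f (hJ f hf) hfw
    obtain ⟨b, hb, h2, -, h3⟩ := h.tail_pos w h0'
    exact ⟨a, ha, b, hb, h3 f (hJ f hf) hfw a ha hfa, h1, h2⟩
  intro v hv w hw hvw
  by_cases h0 : tail v = 0
  · by_cases h0' : tail w = 0
    · rw [h0, h0']
    · obtain ⟨a, ha, b, hb, -, h1, h2⟩ := key w hw v hv hvw.symm h0'
      omega
  · obtain ⟨a, ha, b, hb, hab, h1, h2⟩ := key v hv w hw hvw h0
    obtain ⟨a', ha', b', hb', hab', h1', h2'⟩ := key w hw v hv hvw.symm (by omega)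
    obtain rfl := h.inj a ha b' hb' (by omega)
    obtain rfl := h.inj b hb a' ha' (by omega)
    obtain rfl : a = b := by omega
    rw [h1, h2]

-- All successors of an item have the same `tl`, so the head label does not depend on the successor
-- chosen. Conversely, equal nonzero tail labels name a common predecessor, which makes the `tl`
-- values equal.
include h hJ hdst hline hhead in
lemma labelling : Labelling n (fun u v => ∃ e < m, src e = u ∧ dst e = v) tail head := by
  have hcongr := tail_congr h hJ hline
  have htail : ∀ v < n, tail v ≤ n := by
    intro v hv
    by_cases h0 : tail v = 0
    · omega
    · obtain ⟨a, ha, h1, -⟩ := h.tail_pos v h0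
      have := h.lt a ha
      omega
  have hne : ∀ u < n, ∀ v < n, (∃ e < m, src e = u ∧ dst e = v) → tail v ≠ 0 := by
    rintro u - v - ⟨e, he, -, hev⟩ h0
    exact h.tail_zero v h0 e (hJ e he) hev
  refine ⟨fun u hu v hv => ⟨fun huv => ?_, fun huv => ?_⟩, htail, fun v hv hno => ?_, hne,
    fun u hu hno => ?_⟩
  · obtain ⟨e, he, heu, hev⟩ := id huv
    rcases hhead u hu with ⟨h1, -⟩ | ⟨f, hf, hfu, h1⟩
    · exact absurd heu (h1 e he)
    · rw [h1]
      refine hcongr _ (hdst f hf) v hv ?_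
      rw [← (hline u hu v hv).1 huv, (hline u hu _ (hdst f hf)).1 ⟨f, hf, hfu, rfl⟩]
  · rcases hhead u hu with ⟨-, h1⟩ | ⟨f, hf, hfu, h1⟩
    · have := htail v hv
      omega
    · have h0 := hne u hu _ (hdst f hf) ⟨f, hf, hfu, rfl⟩
      obtain ⟨a, ha, h2, ⟨e, he, hea, hef⟩, -⟩ := h.tail_pos _ h0
      obtain ⟨b, hb, h3, ⟨g, hg, hgb, hgv⟩, -⟩ := h.tail_pos v (by omega)
      obtain rfl := h.inj a ha b hb (by omega)
      have h4 := (hline _ (h.lt a ha) _ (hdst f hf)).1 ⟨e, (h.started e he).1, hea, hef⟩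
      have h5 := (hline _ (h.lt a ha) v hv).1 ⟨g, (h.started g hg).1, hgb, hgv⟩
      rw [hline u hu v hv, ← h5, h4]
      exact (hline u hu _ (hdst f hf)).1 ⟨f, hf, hfu, rfl⟩
  · by_contra h0
    obtain ⟨a, ha, -, ⟨e, he, hea, hev⟩, -⟩ := h.tail_pos v h0
    exact hno _ (h.lt a ha) ⟨e, (h.started e he).1, hea, hev⟩
  · rcases hhead u hu with ⟨-, h1⟩ | ⟨f, hf, hfu, -⟩
    · exact h1
    · exact absurd ⟨f, hf, hfu, rfl⟩ (hno _ (hdst f hf))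

-- By `near`, the position of the last predecessor does not decrease along the queue, and sources
-- come first. Items between two with the same tail therefore have the same last predecessor as
-- these; sharing a predecessor, they share the tail.
include h hJ hq hdst hline hhead in
lemma itemOrder : ItemOrder n q tail head := by
  have hlab := labelling h hJ hdst hline hhead
  refine ⟨h.lt, h.inj, fun i hi j hj hij => ?_, fun i j l hij hjl hl hil => ?_, hlab.tail_le,
    hlab.head_le⟩
  · obtain ⟨e, he, hei, hej⟩ := (hlab.arc_iff _ (h.lt i hi) _ (h.lt j hj)).2 hij
    obtain ⟨-, a, ha, haj, h1⟩ := h.preds j hj e he hej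
    obtain rfl := h.inj i hi a ha (hei.symm.trans h1)
    exact haj
  · have hi : i < n := by omega
    have hj : j < n := by omega
    have harc := fun a (ha : a < n) b (hb : b < n) => hlab.arc_iff _ (h.lt a ha) _ (h.lt b hb)
    by_cases h0 : tail (q i) = 0
    · rw [h0]
      refine hlab.tail_eq_zero _ (h.lt j hj) ?_
      rintro u hu ⟨e, he, rfl, hej⟩
      obtain ⟨a, ha, h1⟩ := hq _ hu
      obtain ⟨b, hb, -, f, hf, hfl, hfb⟩ := h.near j l hjl hl a ha e he hej h1.symm
      exact hlab.tail_ne_zero _ (h.lt b hb) _ (h.lt l hl) ⟨f, hf, hfb, hfl⟩ (hil ▸ h0)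
    · obtain ⟨a, ha, hmax⟩ : ∃ a, (a < n ∧ head (q a) = tail (q i)) ∧
          ∀ b < n, head (q b) = tail (q i) → b ≤ a := by
        obtain ⟨b, hb, -, ⟨e, he, heb, hei⟩, -⟩ := h.tail_pos _ h0
        let s := (Finset.range n).filter fun b => head (q b) = tail (q i)
        have hs : s.Nonempty := ⟨b, Finset.mem_filter.2 ⟨Finset.mem_range.2 hb,
          (harc b hb i hi).1 ⟨e, (h.started e he).1, heb, hei⟩⟩⟩
        have hm := s.max'_mem hs
        refine ⟨s.max' hs, ?_, fun b hb h1 => s.le_max' b ?_⟩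
        · simpa [s] using hm
        · simpa [s] using ⟨hb, h1⟩
      obtain ⟨e, he, hea, hei⟩ := (harc a ha.1 i hi).2 ha.2
      obtain ⟨b, hb, hab, f, hf, hfj, hfb⟩ := h.near i j hij hj a ha.1 e he hei hea
      obtain ⟨c, hc, hbc, g, hg, hgl, hgc⟩ := h.near j l hjl hl b hb f hf hfj hfb
      have h1 := hmax c hc (((harc c hc l hl).1 ⟨g, hg, hgc, hgl⟩).trans hil.symm)
      obtain rfl : a = b := by omega
      rw [← ha.2, (harc a ha.1 j hj).1 ⟨f, hf, hfb, hfj⟩]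

end Final

end Sorting

/-! ### Reading the digraph, the tables of single items, and the topological sort as programs. -/

namespace RAM

open Op Layout

/-- The input array of `C` describes `n` items with sizes `sz` and `m` arcs `(src e, dst e)`, where
the arcs from `v` have the numbers from `offs v` to `offs (v + 1) - 1`. -/
structure GraphInput (C : Layout) (n m : ℕ) (sz offs src dst : ℕ → ℕ) : Prop where
  size : ∀ v < n, C.inp.getD (2 + v) 0 = sz v
  offset : ∀ k ≤ n, C.inp.getD (2 + n + k) 0 = offs k
  target : ∀ e < m, C.inp.getD (2 * n + 3 + e) 0 = dst e
  offs_last : offs n = m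
  offs_le : ∀ v < n, offs v ≤ offs (v + 1) ∧ offs (v + 1) ≤ m
  src_eq : ∀ e < m, ∀ v < n, src e = v ↔ offs v ≤ e ∧ e < offs (v + 1)
  src_lt : ∀ e < m, src e < n
  dst_lt : ∀ e < m, dst e < n
  le_B : 2 * n + m + 4 ≤ C.B

/-- Compute the indegrees. -/
def scan : Prog :=
  ops [.add .off .two .n, .add .arc .off .n, .add .arc .arc .one, .add .t .n .one,
    .add .a .off .n, .inp .pe .a, .add .pe .pe .arc, .cp .p .arc] ;;
  loop .p .pe (
    ops [.inp .w .p, .ld .a .indeg .w, .add .a .a .one, .st .indeg .w .a, .add .p .p .one])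

/-- Put the sources into the queue and write the tables of the single items. -/
def enter : Prog :=
  loop .v .n (
    ops [.ld .a .indeg .v] ;;
    ite .a .one (ops [.st .queue .qt .v, .add .qt .qt .one]) skip ;;
    ops [.add .a .two .v, .inp .a .a, .st .wt .v .a, .stt .v .zero .one] ;;
    ite .c .a skip (ops [.stt .v .a .one]) ;;
    ops [.add .v .v .one])

/-- Process one arc from the item `v`. -/
def relax : Prog :=
  ops [.inp .w .p, .ld .a .indeg .w, .sub .a .a .one, .st .indeg .w .a, .ld .h .tail .w] ;;
  ite .zero .h skip (ops [.add .h .v .one, .st .tail .w .h]) ;;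
  ite .a .one (ops [.st .queue .qt .w, .add .qt .qt .one]) skip ;;
  ops [.add .p .p .one]

/-- Sort the items topologically and label them by their tails and heads. -/
def topsort : Prog :=
  loop .qh .qt (
    ops [.ld .v .queue .qh, .add .a .off .v, .inp .p .a, .add .a .a .one, .inp .pe .a,
      .add .p .p .arc, .add .pe .pe .arc, .cp .h .t] ;;
    loop .p .pe relax ;;
    ops [.st .head .v .h, .ld .a .cnt .h, .add .a .a .one, .st .cnt .h .a, .add .qh .qh .one])

lemma card_filter_range_succ {p : ℕ → Prop} [DecidablePred p] {i : ℕ} :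
    ((Finset.range (i + 1)).filter p).card =
      ((Finset.range i).filter p).card + if p i then 1 else 0 := by
  rw [Finset.range_add_one, Finset.filter_insert]
  split_ifs with h
  · rw [Finset.card_insert_of_notMem (by simp)]
  · rfl

namespace Layout

variable {C : Layout} {s : Store} {Q : ℕ → Store → Prop} {P : Problem} {m : ℕ}
  {offs src dst : ℕ → ℕ}

lemma wp_scan (hC : Fits P C) (hG : GraphInput C P.n m P.sz offs src dst)
    (hQ : ∀ t a pe p w indeg, t ≤ 20 * m + 20 →
      (∀ w, indeg w = ((Finset.range m).filter fun e => dst e = w).card) →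
      Q t { Store.start P.n P.c with
        off := 2 + P.n, arc := 2 * P.n + 3, t := P.n + 1, a := a, pe := pe, p := p, w := w
        indeg := indeg }) :
    C.wp scan (Store.start P.n P.c) Q := by
  have hB := hC.le_B
  have hN := hC.N_eq
  have hmB := hG.le_B
  have hm : C.inp.getD (2 + P.n + P.n) 0 = m := by rw [hG.offset _ le_rfl, hG.offs_last]
  refine wp_seq (wp_ops _ ?_ ?_)
  · simp only [okList, ok, act, Store.get, Store.set, Store.start, and_true, true_and, hm]
    omega
  simp only [actList, act, Store.get, Store.set, Store.start, hm]
  refine wp_while (fun φ s' => ∃ a i w indeg, s' = { Store.start P.n P.c with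
      off := 2 + P.n, arc := 2 + P.n + P.n + 1, t := P.n + 1, a := a,
      pe := m + (2 + P.n + P.n + 1), p := 2 + P.n + P.n + 1 + i, w := w, indeg := indeg } ∧ i ≤ m ∧
      (∀ w, indeg w = ((Finset.range i).filter fun e => dst e = w).card) ∧ φ = 15 * (m - i))
    (15 * m) ⟨2 + P.n + P.n, 0, 0, fun _ => 0, rfl, m.zero_le, fun _ => rfl, rfl⟩ ?_ ?_
  · rintro φ _ ⟨a, i, w, indeg, rfl, hi, hdeg, rfl⟩ hlt
    simp only [Store.get] at hlt
    have him : i < m := by omega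
    have hw := hG.target i him
    rw [show 2 * P.n + 3 + i = 2 + P.n + P.n + 1 + i by omega] at hw
    have hdn := hG.dst_lt i him
    have hdi : indeg (dst i) ≤ m := by
      rw [hdeg]
      exact (Finset.card_filter_le _ _).trans (by rw [Finset.card_range]; exact hi)
    refine wp_ops _ ?_ ?_
    · simp only [okList, ok, act, Store.get, Store.set, Store.start, Store.arr, Store.setArr,
        and_true, true_and, hw]
      omega
    simp only [actList, act, Store.get, Store.set, Store.start, Store.arr, Store.setArr, hw]
    refine ⟨_, ⟨indeg (dst i) + 1, i + 1, dst i, Function.update indeg (dst i) (indeg (dst i) + 1),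
      rfl, him, fun w => ?_, rfl⟩, ?_⟩
    · rw [card_filter_range_succ, ← hdeg]
      rcases eq_or_ne w (dst i) with rfl | h1
      · rw [Function.update_self, if_pos rfl]
      · rw [Function.update_of_ne h1, if_neg h1.symm, add_zero]
    · simp only [costList, cost]
      omega
  · rintro t φ _ ⟨a, i, w, indeg, rfl, hi, hdeg, rfl⟩ hge ht
    simp only [Store.get] at hge
    obtain rfl : i = m := by omega
    rw [show 2 + P.n + P.n + 1 = 2 * P.n + 3 by omega]
    refine hQ _ _ _ _ _ _ ?_ hdeg
    simp only [costList, cost]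
    omega

/-- Sources enter the queue before any arc is processed, so the condition on last predecessors is
empty for them. -/
lemma wp_enter (hC : Fits P C) (hG : GraphInput C P.n m P.sz offs src dst) (hconst : Consts P s)
    (hdeg : ∀ w, s.indeg w = ((Finset.range m).filter fun e => dst e = w).card)
    (hv : s.v = 0) (hqt : s.qt = 0) (htab : s.tab = fun _ _ => 0)
    (hQ : ∀ t v a qt queue wt tab, t ≤ 40 * P.n + 1 →
      Sorting P.n m src dst (fun _ => False) ∅ queue 0 qt s.indeg (fun _ => 0) →
      (∀ v < P.n, wt v = P.sz v ∧ ∀ j ≤ P.c, tab v j ≠ 0 ↔ j = 0 ∨ j = P.sz v) →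
      (∀ v, P.n ≤ v → tab v = fun _ => 0) →
      Q t { s with v := v, a := a, qt := qt, queue := queue, wt := wt, tab := tab }) :
    C.wp enter s Q := by
  obtain ⟨hzero, hone, htwo, hsn, hsc, hst⟩ := id hconst
  have hB := hC.le_B
  have hN := hC.N_eq
  have hR := hC.R_eq
  refine wp_while (fun φ s' => ∃ v a qt queue wt tab, s' = { s with
      v := v, a := a, qt := qt, queue := queue, wt := wt, tab := tab } ∧ v ≤ P.n ∧
      Sorting P.n m src dst (fun w => v ≤ w) ∅ queue 0 qt s.indeg (fun _ => 0) ∧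
      (∀ i < qt, queue i < v) ∧
      (∀ u < v, wt u = P.sz u ∧ ∀ j ≤ P.c, tab u j ≠ 0 ↔ j = 0 ∨ j = P.sz u) ∧
      (∀ u, v ≤ u → tab u = fun _ => 0) ∧ φ = 40 * (P.n - v)) (40 * P.n)
    ⟨s.v, s.a, s.qt, s.queue, s.wt, s.tab, rfl, by omega,
      by rw [hqt, hv]; exact Sorting.init hdeg s.queue,
      fun i hi => by omega, fun u hu => by omega, fun u _ => by rw [htab], by rw [hv]; rfl⟩ ?_ ?_
  · rintro φ _ ⟨v, a, qt, queue, wt, tab, rfl, hv, hS, hqv, hold, hnew, rfl⟩ hlt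
    simp only [Store.get, hsn] at hlt
    have hqt := hS.qt_le
    have hqv' : qt ≤ v := by
      have h1 : (Finset.range qt).image queue ⊆ Finset.range v := by
        intro x hx
        obtain ⟨i, hi, rfl⟩ := Finset.mem_image.1 hx
        exact Finset.mem_range.2 (hqv i (Finset.mem_range.1 hi))
      have h2 := Finset.card_le_card h1
      rwa [Finset.card_image_of_injOn, Finset.card_range, Finset.card_range] at h2
      intro i hi j hj hij
      exact hS.inj i (by simpa using hi) j (by simpa using hj) hij
    have hsz := hG.size v hlt
    refine wp_seq (wp_ops _ ?_ ?_)
    · simp only [okList, ok, Store.get, and_true]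
      omega
    simp only [actList, act, Store.get, Store.set, Store.arr]
    refine wp_seq (wp_mono (Q := fun t s' => t ≤ 10 ∧ ∃ qt queue, s' = { s with
      v := v, a := s.indeg v, qt := qt, queue := queue, wt := wt, tab := tab } ∧
      Sorting P.n m src dst (fun w => v + 1 ≤ w) ∅ queue 0 qt s.indeg (fun _ => 0) ∧
      (∀ i < qt, queue i < v + 1)) (wp_if (fun h0 => wp_ops _ ?_ ?_) fun h0 => wp_skip ?_) ?_)
    · simp only [okList, ok, act, Store.get, Store.setArr, and_true]
      omega
    · simp only [Store.get, hone] at h0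
      simp only [actList, act, Store.get, Store.set, Store.setArr, Store.arr, hone]
      refine ⟨by simp only [costList, cost]; omega, _, _, rfl,
        (hS.push hlt (by omega) (fun i hi => (hqv i hi).ne) (fun a ha => by omega)).exempt
          fun w _ _ h1 => by omega, fun i hi => ?_⟩
      rcases Nat.lt_succ_iff_lt_or_eq.1 hi with h1 | rfl
      · rw [Function.update_of_ne h1.ne]
        exact (hqv i h1).trans v.lt_succ_self
      · rw [Function.update_self]
        exact v.lt_succ_self
    · simp only [Store.get, hone] at h0
      refine ⟨by omega, qt, queue, rfl, hS.exempt fun w _ hw0 h1 => ?_,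
        fun i hi => (hqv i hi).trans v.lt_succ_self⟩
      rcases h1.eq_or_lt with rfl | h1
      exacts [absurd (by omega) h0, h1]
    rintro t₁ _ ⟨ht₁, qt, queue, rfl, hS, hqv⟩
    refine wp_seq (wp_ops _ ?_ ?_)
    · simp only [okList, ok, act, Store.get, Store.set, Store.setArr, and_true, true_and, htwo,
        hzero]
      omega
    simp only [actList, act, Store.get, Store.set, Store.setArr, Store.arr, htwo, hzero, hone, hsz]
    refine wp_seq (wp_mono (Q := fun t s' => t ≤ 10 ∧ ∃ T, s' = { s with
      zero := 0, one := 1, two := 2, v := v, a := P.sz v, qt := qt, queue := queue,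
      wt := Function.update wt v (P.sz v), tab := Function.update tab v T } ∧
      ∀ j ≤ P.c, T j ≠ 0 ↔ j = 0 ∨ j = P.sz v)
      (wp_if (fun h0 => wp_skip ?_) fun h0 => wp_ops _ ?_ ?_) ?_)
    · simp only [Store.get, hsc] at h0
      -- The size exceeds `c`, so no admissible index equals it and the row keeps its entry at `0`
      -- only.
      refine ⟨by omega, _, rfl, fun j hj => ?_⟩
      rw [hnew v le_rfl, Function.update_apply]
      split_ifs <;> simp <;> omega
    · simp only [Store.get, hsc] at h0
      simp only [okList, ok, Store.get, and_true]
      omega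
    · simp only [actList, act, Store.get, Function.update_self, Function.update_idem]
      refine ⟨by simp only [costList, cost]; omega, _, rfl, fun j hj => ?_⟩
      rw [hnew v le_rfl, Function.update_apply, Function.update_apply]
      split_ifs <;> simp <;> omega
    rintro t₂ _ ⟨ht₂, T, rfl, hT⟩
    refine wp_ops _ ?_ ?_
    · simp only [okList, ok, Store.get, and_true]
      omega
    simp only [actList, act, Store.get, Store.set]
    refine ⟨_, ⟨v + 1, P.sz v, qt, queue, _, _, by rw [← hzero, ← hone, ← htwo], hlt, hS, hqv,
      fun u hu => ?_, fun u hu => ?_, rfl⟩, ?_⟩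
    · rcases Nat.lt_succ_iff_lt_or_eq.1 hu with h1 | rfl
      · rw [Function.update_of_ne h1.ne, Function.update_of_ne h1.ne]
        exact hold u h1
      · rw [Function.update_self, Function.update_self]
        exact ⟨rfl, hT⟩
    · rw [Function.update_of_ne (by omega)]
      exact hnew u (by omega)
    · simp only [costList, cost]
      omega
  · rintro t φ _ ⟨v, a, qt, queue, wt, tab, rfl, hv, hS, hqv, hold, hnew, rfl⟩ hge ht
    simp only [Store.get, hsn] at hge
    obtain rfl : v = P.n := by omega
    exact hQ _ _ _ _ _ _ _ (by omega) (hS.exempt fun w hw _ h1 => by omega) hold hnew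

end Layout

end RAM

namespace RAM.Layout

open Op

variable {C : Layout} {s : Store} {Q : ℕ → Store → Prop} {P : Problem} {m : ℕ}
  {offs src dst : ℕ → ℕ}

/-- The first processed arc into an item fixes its tail label, and later arcs leave it alone; the
same label is handed to `h` as the head of `v`. -/
lemma wp_relax (hC : Fits P C) (hG : GraphInput C P.n m P.sz offs src dst) (hconst : Consts P s)
    {J : Finset ℕ} {z e : ℕ}
    (hS : Sorting P.n m src dst (fun _ => False) J s.queue (z + 1) s.qt s.indeg s.tail)
    (he : e < m) (heJ : e ∉ J) (hv : s.v = s.queue z) (hsrc : src e = s.v)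
    (hp : s.p = 2 * P.n + 3 + e)
    (hQ : ∀ t a w h qt indeg tail queue, t ≤ 40 →
      Sorting P.n m src dst (fun _ => False) (insert e J) queue (z + 1) qt indeg tail →
      (∀ x, s.tail x ≠ 0 → tail x = s.tail x) → h = tail (dst e) →
      (∀ a < s.qt, queue a = s.queue a) → s.qt ≤ qt →
      Q t { s with a := a, w := w, h := h, qt := qt, indeg := indeg, tail := tail, queue := queue
                   p := s.p + 1 }) :
    C.wp relax s Q := by
  obtain ⟨hzero, hone, htwo, hsn, hsc, hst⟩ := id hconst
  have hB := hC.le_B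
  have hmB := hG.le_B
  have hN := hC.N_eq
  have hw : C.inp.getD s.p 0 = dst e := by rw [hp, hG.target e he]
  have hwn := hG.dst_lt e he
  have hz : z < s.qt := hS.le
  have hvn : s.v < P.n := hv ▸ hS.lt z hz
  have hqn := hS.qt_le
  have hadv := hS.advance he heJ (hsrc.trans hv)
  have hnq := hS.notMem_queue he heJ
  rw [← hv] at hadv
  refine wp_seq (wp_ops _ ?_ ?_)
  · simp only [okList, ok, act, Store.get, Store.set, Store.arr, Store.setArr, and_true, true_and,
      hw]
    omega
  simp only [actList, act, Store.get, Store.set, Store.arr, Store.setArr, hw, hone]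
  refine wp_seq (wp_mono (Q := fun t s' => t ≤ 10 ∧ s' = { s with
    one := 1, w := dst e, a := s.indeg (dst e) - 1
    h := (if s.tail (dst e) = 0 then Function.update s.tail (dst e) (s.v + 1) else s.tail) (dst e)
    indeg := Function.update s.indeg (dst e) (s.indeg (dst e) - 1)
    tail := if s.tail (dst e) = 0 then Function.update s.tail (dst e) (s.v + 1) else s.tail })
    (wp_if (fun h0 => wp_skip ?_) fun h0 => wp_ops _ ?_ ?_) ?_)
  · simp only [Store.get, hzero] at h0
    simp only [if_neg h0.ne', and_true]
    omega
  · simp only [okList, ok, act, Store.get, Store.set, and_true]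
    omega
  · simp only [Store.get, hzero, not_lt, Nat.le_zero] at h0
    simp only [actList, act, Store.get, Store.set, Store.setArr, Store.arr, if_pos h0,
      Function.update_self, costList, cost, and_true]
    omega
  rintro t₁ _ ⟨ht₁, rfl⟩
  generalize htail : (if s.tail (dst e) = 0 then Function.update s.tail (dst e) (s.v + 1) else
    s.tail) = tail at hadv ⊢
  have hold : ∀ x, s.tail x ≠ 0 → tail x = s.tail x := by
    intro x hx
    rw [← htail]
    split_ifs with h0
    · rw [Function.update_of_ne]
      rintro rfl
      exact hx h0
    · rfl
  refine wp_seq (wp_mono (Q := fun t s' => t ≤ 10 ∧ ∃ qt queue, s' = { s with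
    one := 1, w := dst e, a := s.indeg (dst e) - 1, h := tail (dst e), qt := qt, queue := queue
    indeg := Function.update s.indeg (dst e) (s.indeg (dst e) - 1), tail := tail } ∧
    Sorting P.n m src dst (fun _ => False) (insert e J) queue (z + 1) qt
      (Function.update s.indeg (dst e) (s.indeg (dst e) - 1)) tail ∧
    (∀ a < s.qt, queue a = s.queue a) ∧ s.qt ≤ qt)
    (wp_if (fun h0 => wp_ops _ ?_ ?_) fun h0 => wp_skip ?_) ?_)
  · simp only [okList, ok, act, Store.get, Store.setArr, and_true]
    omega
  · simp only [Store.get] at h0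
    simp only [actList, act, Store.get, Store.set, Store.setArr, Store.arr]
    -- The item is pushed while the arcs from position `z` are processed. That position is the
    -- latest one so far, so `z` witnesses the condition on last predecessors.
    refine ⟨by simp only [costList, cost]; omega, _, _, rfl, (hadv.push hwn (by
      rw [Function.update_self]; omega) hnq fun a ha => ⟨z, by omega, by omega, e, he, rfl,
        hsrc.trans hv⟩).exempt fun w _ _ h1 => h1.2 (h1.1.resolve_left id), fun a ha => ?_,
      by omega⟩
    exact Function.update_of_ne ha.ne _ _
  · simp only [Store.get] at h0
    refine ⟨by omega, _, _, rfl, hadv.exempt fun w _ hw0 h1 => ?_, fun _ _ => rfl, le_rfl⟩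
    rw [h1.resolve_left id, Function.update_self] at hw0
    omega
  rintro t₂ _ ⟨ht₂, qt, queue, rfl, hS', hqueue, hqt⟩
  refine wp_ops _ ?_ ?_
  · simp only [okList, ok, Store.get, and_true]
    omega
  simp only [actList, act, Store.get, Store.set]
  have := hQ (costList [.inp .w .p, .ld .a .indeg .w, .sub .a .a .one, .st .indeg .w .a,
    .ld .h .tail .w] + (t₁ + (t₂ + costList [.add .p .p .one])))
    (s.indeg (dst e) - 1) (dst e) (tail (dst e)) qt _ tail queue
    (by simp only [costList, cost]; omega) hS' hold rfl hqueue hqt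
  rwa [hone] at this

/-- The invariant of the topological sorting as a property of the store: `D` is the set of the
items whose outgoing arcs have all been processed. -/
structure TopInv (P : Problem) (m : ℕ) (src dst : ℕ → ℕ) (J D : Finset ℕ) (s : Store) : Prop where
  sorting : Sorting P.n m src dst (fun _ => False) J s.queue s.qh s.qt s.indeg s.tail
  mem_iff : ∀ e, e ∈ J ↔ e < m ∧ src e ∈ D
  done_iff : ∀ u, u ∈ D ↔ ∃ a < s.qh, s.queue a = u
  head : ∀ u ∈ D, (∀ e < m, src e ≠ u) ∧ s.head u = P.n + 1 ∨
    ∃ e ∈ J, src e = u ∧ s.head u = s.tail (dst e)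
  cnt : ∀ x, s.cnt x = (D.filter fun u => s.head u = x).card

/-- The remaining time is measured by the items not yet taken up and the arcs not yet in `J`, so
arcs are paid for once over all rounds. -/
lemma wp_topsort (hC : Fits P C) (hG : GraphInput C P.n m P.sz offs src dst) (hconst : Consts P s)
    (hoff : s.off = 2 + P.n) (harc : s.arc = 2 * P.n + 3) (hqh : s.qh = 0)
    (hS : Sorting P.n m src dst (fun _ => False) ∅ s.queue 0 s.qt s.indeg s.tail)
    (hcnt : s.cnt = fun _ => 0) {r : ℕ → ℕ} (hr : ∀ e < m, r (src e) < r (dst e))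
    (hQ : ∀ t v a p pe w h qh qt indeg head tail cnt queue J, t ≤ 50 * m + 60 * P.n + 10 →
      Sorting P.n m src dst (fun _ => False) J queue P.n P.n indeg tail → (∀ e < m, e ∈ J) →
      (∀ w < P.n, ∃ i < P.n, queue i = w) →
      (∀ u < P.n, (∀ e < m, src e ≠ u) ∧ head u = P.n + 1 ∨
        ∃ e < m, src e = u ∧ head u = tail (dst e)) →
      (∀ x, cnt x = ((Finset.range P.n).filter fun u => head u = x).card) →
      Q t { s with
        v := v, a := a, p := p, pe := pe, w := w, h := h, qh := qh, qt := qt, indeg := indeg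
        head := head, tail := tail, cnt := cnt, queue := queue }) :
    C.wp topsort s Q := by
  obtain ⟨hzero, hone, htwo, hsn, hsc, hst⟩ := id hconst
  have hB := hC.le_B
  have hmB := hG.le_B
  have hN := hC.N_eq
  refine wp_while (fun φ s' => ∃ v a p pe w h qh qt indeg head tail cnt queue J D, s' = { s with
      v := v, a := a, p := p, pe := pe, w := w, h := h, qh := qh, qt := qt, indeg := indeg
      head := head, tail := tail, cnt := cnt, queue := queue } ∧ TopInv P m src dst J D s' ∧
      φ = 60 * (P.n - qh) + 50 * (m - J.card)) (60 * P.n + 50 * m)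
    ⟨s.v, s.a, s.p, s.pe, s.w, s.h, s.qh, s.qt, s.indeg, s.head, s.tail, s.cnt, s.queue, ∅, ∅, rfl,
      ⟨by rwa [hqh], by simp, by simp [hqh], by simp, by simp [hcnt]⟩, by simp [hqh]⟩ ?_ ?_
  · rintro φ _ ⟨v, a, p, pe, w, h, qh, qt, indeg, head, tail, cnt, queue, J, D, rfl,
      ⟨hS, hJ, hD, hhead, hcnt⟩, rfl⟩ hlt
    simp only [Store.get] at hlt
    simp only at hS hJ hD hhead hcnt
    have hqn := hS.qt_le
    have hvn := hS.lt qh hlt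
    have ho1 := hG.offset (queue qh) hvn.le
    have ho2 := hG.offset (queue qh + 1) hvn
    have hole := hG.offs_le _ hvn
    have hDv : queue qh ∉ D := by
      intro h1
      obtain ⟨b, hb, h2⟩ := (hD _).1 h1
      have := hS.inj b (by omega) qh hlt h2
      omega
    have hDn : ∀ u ∈ D, u < P.n := by
      intro u hu
      obtain ⟨b, hb, rfl⟩ := (hD _).1 hu
      exact hS.lt b (by omega)
    have hDc : D.card ≤ P.n := by
      simpa using Finset.card_le_card fun u hu => Finset.mem_range.2 (hDn u hu)
    refine wp_seq (wp_ops _ ?_ ?_)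
    · simp only [okList, ok, act, Store.get, Store.set, Store.arr, and_true, true_and, hoff, harc,
        hone, add_assoc] at *
      rw [ho2]
      omega
    simp only [actList, act, Store.get, Store.set, Store.arr, hoff, harc, hone, hst, ho1]
    rw [show 2 + P.n + queue qh + 1 = 2 + P.n + (queue qh + 1) by omega, ho2]
    have hstart := hS.start hlt
    -- `h` starts as `n + 1`, which remains the head label precisely when no arc leaves the item.
    refine wp_seq (wp_while (fun φ s' => ∃ i a w h qt' indeg tail queue' J', s' = { s with
        one := 1, off := 2 + P.n, arc := 2 * P.n + 3, t := P.n + 1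
        v := queue qh, a := a, p := 2 * P.n + 3 + i
        pe := offs (queue qh + 1) + (2 * P.n + 3), w := w, h := h, qh := qh, qt := qt'
        indeg := indeg, head := head, tail := tail, cnt := cnt, queue := queue' } ∧
        offs (queue qh) ≤ i ∧ i ≤ offs (queue qh + 1) ∧
        Sorting P.n m src dst (fun _ => False) J' queue' (qh + 1) qt' indeg tail ∧
        (∀ e, e ∈ J' ↔ e < m ∧ (src e ∈ D ∨ src e = queue qh ∧ e < i)) ∧
        (∀ u ∈ D, (∀ e < m, src e ≠ u) ∧ head u = P.n + 1 ∨
          ∃ e ∈ J', src e = u ∧ head u = tail (dst e)) ∧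
        (i = offs (queue qh) ∧ h = P.n + 1 ∨
          ∃ e ∈ J', src e = queue qh ∧ h = tail (dst e)) ∧
        (∀ b < qt, queue' b = queue b) ∧ qt ≤ qt' ∧
        J'.card = J.card + (i - offs (queue qh)) ∧ φ = 50 * (offs (queue qh + 1) - i))
      (50 * (offs (queue qh + 1) - offs (queue qh)))
      ⟨offs (queue qh), _, w, P.n + 1, qt, indeg, tail, queue, J, by
        rw [add_comm (2 * P.n + 3) (offs (queue qh))], le_rfl, hole.1, hstart,
        fun e => ?_, hhead, .inl ⟨rfl, rfl⟩, fun _ _ => rfl, le_rfl, by omega, rfl⟩ ?_ ?_)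
    · rw [hJ]
      refine and_congr_right fun he => ⟨.inl, fun h1 => h1.resolve_right ?_⟩
      rintro ⟨h2, h3⟩
      have := (hG.src_eq e he _ hvn).1 h2
      omega
    · rintro φ _ ⟨i, a', w', h', qt', indeg', tail', queue', J', rfl, hi1, hi2, hS', hJ', hhead',
        hh', hqueue', hqt', hcard', rfl⟩ hlt'
      simp only [Store.get] at hlt'
      have hilt : i < offs (queue qh + 1) := by omega
      have him : i < m := by omega
      have hsrc : src i = queue qh := (hG.src_eq i him _ hvn).2 ⟨hi1, hilt⟩
      have hiJ : i ∉ J' := by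
        intro h1
        rcases ((hJ' i).1 h1).2 with h2 | ⟨-, h2⟩
        · exact hDv (hsrc ▸ h2)
        · omega
      refine wp_relax hC hG ⟨hzero, rfl, htwo, hsn, hsc, rfl⟩ (e := i) (z := qh) hS' him hiJ
        (hqueue' qh hlt).symm hsrc rfl ?_
      intro t a₂ w₂ h₂ qt₂ indeg₂ tail₂ queue₂ ht hS₂ htail₂ hh₂ hqueue₂ hqt₂
      simp only at htail₂ hqueue₂ hqt₂
      refine ⟨_, ⟨i + 1, a₂, w₂, h₂, qt₂, indeg₂, tail₂, queue₂, insert i J', rfl, by omega, hilt,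
        hS₂, fun e => ?_, fun u hu => ?_, .inr ⟨i, Finset.mem_insert_self _ _, hsrc, hh₂⟩,
        fun b hb => ?_, hqt'.trans hqt₂, ?_, rfl⟩, by omega⟩
      · rw [Finset.mem_insert, hJ']
        constructor
        · rintro (rfl | ⟨h1, h2 | h2⟩)
          exacts [⟨him, .inr ⟨hsrc, by omega⟩⟩, ⟨h1, .inl h2⟩, ⟨h1, .inr ⟨h2.1, by omega⟩⟩]
        · rintro ⟨h1, h2 | ⟨h2, h3⟩⟩
          · exact .inr ⟨h1, .inl h2⟩
          · rcases Nat.lt_succ_iff_lt_or_eq.1 h3 with h3 | rfl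
            exacts [.inr ⟨h1, .inr ⟨h2, h3⟩⟩, .inl rfl]
      · refine (hhead' u hu).imp_right ?_
        rintro ⟨e, he, heu, h1⟩
        refine ⟨e, Finset.mem_insert_of_mem he, heu, ?_⟩
        rw [h1, htail₂]
        exact fun h2 => hS'.tail_zero _ h2 e he rfl
      · rw [hqueue₂ b (by omega), hqueue' b hb]
      · rw [Finset.card_insert_of_notMem hiJ, hcard']
        omega
    · rintro t φ _ ⟨i, a', w', h', qt', indeg', tail', queue', J', rfl, hi1, hi2, hS', hJ', hhead',
        hh', hqueue', hqt', hcard', rfl⟩ hge ht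
      simp only [Store.get] at hge
      obtain rfl : i = offs (queue qh + 1) := by omega
      have hh'n : h' ≤ P.n + 1 := by
        rcases hh' with ⟨-, h1⟩ | ⟨e, he, -, h1⟩
        · exact h1.le
        · obtain ⟨b, hb, h2, -⟩ := hS'.tail_pos (dst e) fun h2 => hS'.tail_zero _ h2 e he rfl
          have := hS'.lt b (by have := hS'.le; omega)
          omega
      have hcb : cnt h' ≤ P.n := by
        rw [hcnt]
        exact (Finset.card_filter_le _ _).trans hDc
      refine wp_ops _ ?_ ?_
      · simp only [okList, ok, act, Store.get, Store.set, Store.arr, Store.setArr, and_true]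
        omega
      simp only [actList, act, Store.get, Store.set, Store.arr, Store.setArr]
      have hJm : J'.card ≤ m := by
        have : J' ⊆ Finset.range m := fun e he => Finset.mem_range.2 ((hJ' e).1 he).1
        simpa using Finset.card_le_card this
      refine ⟨_, ⟨queue qh, cnt h' + 1, _, _, w', h', qh + 1, qt', indeg',
        Function.update head (queue qh) h', tail', Function.update cnt h' (cnt h' + 1), queue', J',
        insert (queue qh) D, by rw [← hst, ← harc, ← hoff, ← hone],
        ⟨hS', fun e => ?_, fun u => ?_, fun u hu => ?_, fun x => ?_⟩, rfl⟩, ?_⟩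
      · rw [hJ', Finset.mem_insert]
        refine and_congr_right fun he => ⟨fun h1 => ?_, fun h1 => ?_⟩
        · exact h1.elim .inr fun h2 => .inl h2.1
        · exact h1.elim (fun h2 => .inr ⟨h2, ((hG.src_eq e he _ hvn).1 h2).2⟩) .inl
      · simp only
        rw [Finset.mem_insert, hD]
        constructor
        · rintro (rfl | ⟨b, hb, rfl⟩)
          · exact ⟨qh, by omega, hqueue' _ hlt⟩
          · exact ⟨b, by omega, hqueue' _ (by omega)⟩
        · rintro ⟨b, hb, rfl⟩
          rw [hqueue' b (by omega)]
          rcases Nat.lt_succ_iff_lt_or_eq.1 hb with hb | rfl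
          exacts [.inr ⟨b, hb, rfl⟩, .inl rfl]
      · simp only
        rcases Finset.mem_insert.1 hu with rfl | hu
        · rw [Function.update_self]
          rcases hh' with ⟨h1, h2⟩ | h1
          · refine .inl ⟨fun e he heu => ?_, h2⟩
            have := (hG.src_eq e he _ hvn).1 heu
            omega
          · exact .inr h1
        · rw [Function.update_of_ne (ne_of_mem_of_not_mem hu hDv)]
          exact hhead' u hu
      · simp only
        have h1 : (D.filter fun u => Function.update head (queue qh) h' u = x) =
            D.filter fun u => head u = x := Finset.filter_congr fun u hu => by
          rw [Function.update_of_ne (ne_of_mem_of_not_mem hu hDv)]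
        rw [Finset.filter_insert, Function.update_self, h1]
        rcases eq_or_ne x h' with rfl | h2
        · rw [Function.update_self, if_pos rfl, Finset.card_insert_of_notMem (by simp [hDv]), hcnt]
        · rw [Function.update_of_ne h2, if_neg h2.symm, hcnt]
      · simp only [costList, cost]
        omega
  · rintro t φ _ ⟨v, a, p, pe, w, h, qh, qt, indeg, head, tail, cnt, queue, J, D, rfl,
      ⟨hS, hJ, hD, hhead, hcnt⟩, rfl⟩ hge ht
    simp only [Store.get] at hge
    simp only at hS hJ hD hhead hcnt
    have hqt := hS.le
    obtain rfl : qh = qt := by omega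
    -- The queue has run empty; by acyclicity it has then contained all items.
    have hq := hS.complete hG.src_lt hr fun e he ⟨b, hb, h1⟩ =>
      (hJ e).2 ⟨he, (hD _).2 ⟨b, hb, h1.symm⟩⟩
    obtain rfl := hS.qt_eq hq
    have hDr : D = Finset.range P.n := by
      ext u
      rw [hD, Finset.mem_range]
      exact ⟨fun ⟨b, hb, h1⟩ => h1 ▸ hS.lt b hb, hq u⟩
    subst hDr
    have hJm : ∀ e < m, e ∈ J := fun e he => (hJ e).2 ⟨he, Finset.mem_range.2 (hG.src_lt e he)⟩
    refine hQ _ _ _ _ _ _ _ _ _ _ _ _ _ _ J (by omega) hS hJm hq (fun u hu => ?_) hcnt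
    refine (hhead u (Finset.mem_range.2 hu)).imp_right ?_
    rintro ⟨e, he, h1⟩
    exact ⟨e, ((hJ e).1 he).1, h1⟩

end RAM.Layout

/-! ### The encoding of the instances -/

namespace SSGInstance

variable {n : ℕ}

/-- Its positions are the numbers of the arcs; the offsets in the input refer to the same numbering.
-/
def arcList (adj : Fin n → List (Fin n)) : List (Fin n × Fin n) :=
  (List.finRange n).flatMap fun v => (adj v).map fun w => (v, w)

def offset (adj : Fin n → List (Fin n)) (k : ℕ) : ℕ :=
  (((List.finRange n).take k).map fun v => (adj v).length).sum

def arcSource (adj : Fin n → List (Fin n)) (e : ℕ) : ℕ :=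
  ((arcList adj).map fun a => (a.1 : ℕ)).getD e 0

def arcTarget (adj : Fin n → List (Fin n)) (e : ℕ) : ℕ :=
  ((arcList adj).map fun a => (a.2 : ℕ)).getD e 0

variable {I : SSGInstance n} {adj : Fin n → List (Fin n)}

lemma encode_eq : I.encode adj = [n, I.cap] ++ List.ofFn I.size
    ++ (List.range (n + 1)).map (offset adj) ++ (arcList adj).map fun a => (a.2 : ℕ) := by
  rw [encode, arcList, List.map_flatMap]
  congr 1
  refine congrArg (fun f => (List.finRange n).flatMap f) (funext fun v => ?_)
  simp [Function.comp_def, ← List.map_eq_flatMap]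

lemma mem_arcList (h : I.IsAdjacencyList adj) {a : Fin n × Fin n} :
    a ∈ arcList adj ↔ a ∈ I.graph.arcs := by
  obtain ⟨u, v⟩ := a
  simp [arcList, (h u).2]

lemma length_arcList (h : I.IsAdjacencyList adj) :
    (arcList adj).length = I.graph.arcs.card := by
  have h1 : (arcList adj).Nodup := by
    rw [arcList, List.nodup_flatMap]
    refine ⟨fun v _ => (h v).1.map fun a b hab => (Prod.ext_iff.1 hab).2, ?_⟩
    refine (List.nodup_finRange n).pairwise_of_forall_ne fun u _ v _ huv => ?_
    refine List.disjoint_left.2 fun a ha ha' => huv ?_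
    obtain ⟨w, -, rfl⟩ := List.mem_map.1 ha
    obtain ⟨w', -, hw'⟩ := List.mem_map.1 ha'
    exact (Prod.ext_iff.1 hw').1.symm
  rw [← List.toFinset_card_of_nodup h1]
  congr 1
  ext a
  rw [List.mem_toFinset, mem_arcList h]

lemma arcSource_eq {e : ℕ} (he : e < (arcList adj).length) :
    arcSource adj e = (arcList adj)[e].1 := by
  rw [arcSource, List.getD_eq_getElem _ _ (by simpa using he), List.getElem_map]

lemma arcTarget_eq {e : ℕ} (he : e < (arcList adj).length) :
    arcTarget adj e = (arcList adj)[e].2 := by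
  rw [arcTarget, List.getD_eq_getElem _ _ (by simpa using he), List.getElem_map]

lemma exists_arc_iff (h : I.IsAdjacencyList adj) (u v : Fin n) :
    (∃ e < (arcList adj).length, arcSource adj e = u ∧ arcTarget adj e = v) ↔
      (u, v) ∈ I.graph.arcs := by
  rw [← mem_arcList h, List.mem_iff_getElem]
  constructor
  · rintro ⟨e, he, h1, h2⟩
    rw [arcSource_eq he] at h1
    rw [arcTarget_eq he] at h2
    exact ⟨e, he, Prod.ext (Fin.ext h1) (Fin.ext h2)⟩
  · rintro ⟨e, he, h1⟩
    exact ⟨e, he, by rw [arcSource_eq he, h1], by rw [arcTarget_eq he, h1]⟩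

lemma offset_succ (v : Fin n) : offset adj (v + 1) = offset adj v + (adj v).length := by
  have h1 : (v : ℕ) < (List.finRange n).length := by simp
  rw [offset, List.take_succ_eq_append_getElem h1]
  simp [offset]

lemma offset_last : offset adj n = (arcList adj).length := by
  rw [offset, List.take_of_length_le (by simp), arcList, List.length_flatMap]
  simp

lemma offset_mono : Monotone (offset adj) := by
  intro k l hkl
  obtain ⟨d, rfl⟩ := Nat.exists_eq_add_of_le hkl
  rw [offset, offset, List.take_add, List.map_append, List.sum_append]
  exact Nat.le_add_right _ _

lemma arcSource_eq_of_offset {e : ℕ} {v : Fin n} (h1 : offset adj v ≤ e)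
    (h2 : e < offset adj (v + 1)) : arcSource adj e = v := by
  have hv : (v : ℕ) < (List.finRange n).length := by simp
  have hlen : (((List.finRange n).take v).flatMap fun v => (adj v).map fun w => (v, w)).length =
      offset adj v := by
    rw [List.length_flatMap, offset]
    simp
  -- The list is cut before and after the arcs leaving `v`; the first piece has as many entries as
  -- the offset of `v`.
  have hsplit : arcList adj =
      (((List.finRange n).take v).flatMap fun v => (adj v).map fun w => (v, w)) ++
      ((adj v).map (fun w => (v, w)) ++
        ((List.finRange n).drop (v + 1)).flatMap fun v => (adj v).map fun w => (v, w)) := by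
    conv_lhs => rw [arcList, ← List.take_append_drop v (List.finRange n), List.flatMap_append,
      List.drop_eq_getElem_cons hv, List.flatMap_cons]
    simp
  rw [offset_succ] at h2
  have he : e < (arcList adj).length := by
    rw [hsplit, List.length_append, List.length_append, hlen, List.length_map]
    omega
  rw [arcSource_eq he]
  have h3 : (arcList adj)[e]? = some (v, (adj v)[e - offset adj v]) := by
    rw [hsplit, List.getElem?_append_right (by omega), hlen, List.getElem?_append_left
      (by rw [List.length_map]; omega), List.getElem?_map, List.getElem?_eq_getElem (by omega)]
    rfl
  rw [List.getElem?_eq_getElem he, Option.some_inj] at h3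
  rw [h3]

/-- Some interval between consecutive offsets contains `e`, and the arc leaves the vertex of that
interval. -/
lemma arcSource_eq_iff {e v : ℕ} (he : e < (arcList adj).length) (hv : v < n) :
    arcSource adj e = v ↔ offset adj v ≤ e ∧ e < offset adj (v + 1) := by
  refine ⟨?_, fun h => arcSource_eq_of_offset (v := ⟨v, hv⟩) h.1 h.2⟩
  have h1 : ∀ k ≤ n, e < offset adj k → ∃ u < k, offset adj u ≤ e ∧ e < offset adj (u + 1) := by
    intro k
    induction k with
    | zero => exact fun _ h => absurd h (Nat.not_lt_zero e)
    | succ k ih =>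
      intro hk hek
      by_cases h2 : e < offset adj k
      · obtain ⟨u, hu, h3⟩ := ih (by omega) h2
        exact ⟨u, by omega, h3⟩
      · exact ⟨k, by omega, by omega, hek⟩
  obtain ⟨u, hu, h2, h3⟩ := h1 n le_rfl (by rwa [offset_last])
  rw [arcSource_eq_of_offset (v := ⟨u, hu⟩) h2 h3]
  rintro rfl
  exact ⟨h2, h3⟩

lemma encode_zero : (I.encode adj).getD 0 0 = n := rfl

lemma encode_one : (I.encode adj).getD 1 0 = I.cap := rfl

lemma encode_size (v : Fin n) : (I.encode adj).getD (2 + v) 0 = I.size v := by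
  rw [encode_eq, List.append_assoc, List.getD_append _ _ _ _ (by simp; omega),
    List.getD_append_right _ _ _ _ (by simp), List.getD_eq_getElem _ _ (by simp)]
  simp

lemma encode_offset {k : ℕ} (hk : k ≤ n) :
    (I.encode adj).getD (2 + n + k) 0 = offset adj k := by
  rw [encode_eq, List.getD_append _ _ _ _ (by simp; omega),
    List.getD_append_right _ _ _ _ (by simp; omega), List.getD_eq_getElem _ _ (by simp; omega)]
  simp only [List.getElem_map, List.getElem_range]
  congr 1
  simp
  omega

lemma encode_target (e : ℕ) :
    (I.encode adj).getD (2 * n + 3 + e) 0 = arcTarget adj e := by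
  rw [encode_eq, List.getD_append_right _ _ _ _ (by simp; omega), arcTarget]
  congr 1
  simp
  omega

/-- Every input word, including the zeros read beyond the end, has to fit into a machine word. -/
lemma encode_le (i : ℕ) : (I.encode adj).getD i 0 ≤
    n + I.cap + ∑ v, I.size v + (arcList adj).length := by
  rcases lt_or_ge i 2 with h0 | h0
  · interval_cases i
    · rw [encode_zero]
      omega
    · rw [encode_one]
      omega
  rcases lt_or_ge i (2 + n) with h1 | h1
  · have h2 := encode_size (I := I) (adj := adj) ⟨i - 2, by omega⟩
    rw [show 2 + (i - 2) = i by omega] at h2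
    rw [h2]
    have := Finset.single_le_sum (f := I.size) (fun v _ => Nat.zero_le _)
      (Finset.mem_univ (⟨i - 2, by omega⟩ : Fin n))
    omega
  rcases lt_or_ge i (2 * n + 3) with h2 | h2
  · have h3 := encode_offset (I := I) (adj := adj) (k := i - (2 + n)) (by omega)
    rw [show 2 + n + (i - (2 + n)) = i by omega] at h3
    rw [h3]
    have := offset_mono (adj := adj) (show i - (2 + n) ≤ n by omega)
    rw [offset_last] at this
    omega
  · obtain ⟨e, rfl⟩ := Nat.exists_eq_add_of_le h2
    rw [encode_target]
    by_cases he : e < (arcList adj).length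
    · rw [arcTarget_eq he]
      have := (arcList adj)[e].2.2
      omega
    · rw [arcTarget, List.getD_eq_default _ _ (by simpa using he)]
      exact Nat.zero_le _

end SSGInstance

/-! ### The algorithm -/

namespace RAM

open Op Layout

/-- The part of the algorithm between the setup of the memory and the output. -/
def solve : Prog := scan ;; enter ;; topsort ;; reduce ;; extract

namespace Layout

variable {C : Layout} {Q : ℕ → Store → Prop} {P : Problem} {m : ℕ} {offs src dst : ℕ → ℕ}

/-- The representation by `tl` and `hd` is only known to exist. The program works with its own
labels, to which the series-parallel structure is transferred by `Labelling.ttsp`. -/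
lemma wp_solve (hC : Fits P C) (hG : GraphInput C P.n m P.sz offs src dst)
    (hup : ∀ A, P.Up A ↔ ∀ e < m, src e ∈ A → dst e ∈ A) {r : ℕ → ℕ}
    (hr : ∀ e < m, r (src e) < r (dst e)) {tl hd : ℕ → ℕ} {a b : ℕ}
    (hT : TTSP (blockArcs (Finset.range P.n) tl hd) a b)
    (hline : ∀ u < P.n, ∀ v < P.n, (∃ e < m, src e = u ∧ dst e = v) ↔ hd u = tl v)
    (hQ : ∀ t s' A, t ≤ mergeCost P * P.n + 70 * m + 250 * P.n + 20 * P.c + 231 → Consts P s' →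
      P.Optimal A → (∀ v < P.n, 0 < s'.tgt v ↔ v ∈ A) → Q t s') :
    C.wp solve (Store.start P.n P.c) Q := by
  refine wp_seq (wp_scan hC hG ?_)
  intro t₁ a₁ pe₁ p₁ w₁ indeg₁ ht₁ hdeg
  refine wp_seq (wp_enter hC hG ⟨rfl, rfl, rfl, rfl, rfl, rfl⟩ hdeg rfl rfl rfl ?_)
  intro t₂ v₂ a₂ qt₂ queue₂ wt₂ tab₂ ht₂ hS₂ hleaf htab₂
  refine wp_seq (wp_topsort hC hG ⟨rfl, rfl, rfl, rfl, rfl, rfl⟩ rfl rfl rfl hS₂ rfl hr ?_)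
  intro t₃ v₃ a₃ p₃ pe₃ w₃ h₃ qh₃ qt₃ indeg₃ head₃ tail₃ cnt₃ queue₃ J₃ ht₃ hS₃ hJ₃ hq₃ hhead₃ hcnt₃
  have hlab := hS₃.labelling hJ₃ hG.dst_lt hline hhead₃
  refine wp_seq (wp_reduce hC ⟨rfl, rfl, rfl, rfl, rfl, rfl⟩
    (hS₃.itemOrder hJ₃ hq₃ hG.dst_lt hline hhead₃) (hlab.ttsp hline hT) (fun A => ?_)
    hcnt₃ rfl rfl ?_ ?_)
  · rw [hup]
    constructor
    · intro h u hu v hv huv hA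
      obtain ⟨e, he, rfl, rfl⟩ := (hlab.arc_iff u hu v hv).2 huv
      exact h e he hA
    · intro h e he hA
      exact h _ (hG.src_lt e he) _ (hG.dst_lt e he)
        ((hlab.arc_iff _ (hG.src_lt e he) _ (hG.dst_lt e he)).1 ⟨e, he, rfl, rfl⟩) hA
  · refine ⟨fun _ _ => rfl, fun d h1 h2 => absurd h2 (by omega), fun d e h1 h2 => absurd h2 (by omega),
      fun d hd => ?_, fun d hd j hj => ?_, htab₂⟩
    · rw [SPTree.items, Finset.sum_singleton]
      exact (hleaf d hd).1
    · rw [(hleaf d hd).2 j hj]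
      simp only [SPTree.items, SPTree.Adm, true_and]
      constructor
      · rintro (rfl | rfl)
        · exact ⟨∅, by simp⟩
        · exact ⟨{d}, by simp⟩
      · rintro ⟨A, rfl⟩
        by_cases hA : d ∈ A
        · right
          rw [Finset.inter_singleton_of_mem hA, Finset.sum_singleton]
        · left
          rw [Finset.inter_singleton_of_notMem hA, Finset.sum_empty]
  intro t₄ s₄ tr₄ ht₄ hc₄ hforest₄ hup₄ hitems₄ hroot₄ hn₄ hfresh₄ htgt₄
  refine wp_extract hC hc₄ hforest₄ hup₄ hitems₄ hroot₄ hn₄ hfresh₄ htgt₄ ?_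
  intro t₅ s₅ A ht₅ hc₅ hA hA'
  exact hQ _ s₅ A (by omega) hc₅ hA hA'

end Layout

end RAM

/-! ### Translating an instance to natural numbers. -/

namespace SSGInstance

variable {n : ℕ}

/-- The problem on natural numbers that corresponds to an instance. -/
def problem (I : SSGInstance n) (adj : Fin n → List (Fin n)) (hn : 0 < n) : RAM.Problem where
  n := n
  c := I.cap
  -- The default `1` keeps all sizes positive.
  sz v := if h : v < n then I.size ⟨v, h⟩ else 1
  Up A := ∀ e < (arcList adj).length, arcSource adj e ∈ A → arcTarget adj e ∈ A
  n_pos := hn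
  sz_pos v := by
    split_ifs
    exacts [I.size_pos _, one_pos]

variable {I : SSGInstance n} {adj : Fin n → List (Fin n)} {hn : 0 < n}

lemma sum_problem_sz (B : Finset (Fin n)) :
    ∑ v ∈ B.map Fin.valEmbedding, (I.problem adj hn).sz v = I.weight B := by
  rw [Finset.sum_map, weight]
  refine Finset.sum_congr rfl fun v _ => ?_
  simp [problem]

lemma range_eq_map : Finset.range n = Finset.univ.map (Fin.valEmbedding (n := n)) := by
  ext v
  simp only [Finset.mem_range, Finset.mem_map, Finset.mem_univ, true_and, Fin.valEmbedding_apply]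
  exact ⟨fun h => ⟨⟨v, h⟩, rfl⟩, fun ⟨u, hu⟩ => hu ▸ u.2⟩

lemma problem_up_iff (h : I.IsAdjacencyList adj) (B : Finset (Fin n)) :
    (I.problem adj hn).Up (B.map Fin.valEmbedding) ↔
      ∀ y : Fin n, (I.graph.preds y ∩ B).Nonempty → y ∈ B := by
  have hB : ∀ v : Fin n, (v : ℕ) ∈ B.map Fin.valEmbedding ↔ v ∈ B := fun v =>
    Finset.mem_map' Fin.valEmbedding
  constructor
  · rintro hup y ⟨x, hx⟩
    obtain ⟨hx, hxB⟩ := Finset.mem_inter.1 hx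
    obtain ⟨e, he, h1, h2⟩ := (exists_arc_iff h x y).2 (Finset.mem_filter.1 hx).2
    have := hup e he (by rwa [h1, hB])
    rwa [h2, hB] at this
  · intro hup e he hA
    rw [arcSource_eq he, hB] at hA
    rw [arcTarget_eq he, hB]
    refine hup _ ⟨_, Finset.mem_inter.2 ⟨Finset.mem_filter.2 ⟨?_, ?_⟩, hA⟩⟩
    · rw [I.verts_eq]
      exact Finset.mem_univ _
    · exact (mem_arcList h).1 (List.getElem_mem he)

lemma isOptimal_of_problem (h : I.IsAdjacencyList adj) {B : Finset (Fin n)}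
    (hB : (I.problem adj hn).Optimal (B.map Fin.valEmbedding)) : I.IsOptimal B := by
  refine ⟨⟨?_, (problem_up_iff h B).1 hB.up⟩, fun D hD => ?_⟩
  · rw [← sum_problem_sz (adj := adj) (hn := hn)]
    exact hB.le
  · rw [← sum_problem_sz (adj := adj) (hn := hn), ← sum_problem_sz (adj := adj) (hn := hn)]
    refine hB.max _ ?_ ((problem_up_iff h D).2 hD.2) ?_
    · change _ ⊆ Finset.range n
      rw [range_eq_map]
      exact Finset.map_subset_map.2 (Finset.subset_univ D)
    · rw [sum_problem_sz]
      exact hD.1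

lemma exists_line (hG : I.graph.IsMSP) (h : I.IsAdjacencyList adj) :
    ∃ (tl hd : ℕ → ℕ) (a b : ℕ), TTSP (blockArcs (Finset.range n) tl hd) a b ∧
      ∀ u < n, ∀ v < n, (∃ e < (arcList adj).length, arcSource adj e = u ∧ arcTarget adj e = v) ↔
        hd u = tl v := by
  obtain ⟨tl, hd, a, b, hl⟩ := hG.exists_isLineOf
  refine ⟨fun v => if h : v < n then tl ⟨v, h⟩ else 0, fun v => if h : v < n then hd ⟨v, h⟩ else 0,
    a, b, ?_, fun u hu v hv => ?_⟩
  · have := hl.ttsp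
    rw [I.verts_eq] at this
    rw [blockArcs, range_eq_map, Finset.map_val, Multiset.map_map]
    convert this using 2
    ext <;> simp
  · rw [exists_arc_iff h ⟨u, hu⟩ ⟨v, hv⟩, hl.mem_arcs _ (by rw [I.verts_eq]; exact Finset.mem_univ _) _
      (by rw [I.verts_eq]; exact Finset.mem_univ _)]
    simp only [dif_pos hu, dif_pos hv]

lemma exists_rank (hG : I.graph.IsMSP) (h : I.IsAdjacencyList adj) :
    ∃ r : ℕ → ℕ, ∀ e < (arcList adj).length, r (arcSource adj e) < r (arcTarget adj e) := by
  obtain ⟨r, hr⟩ := hG.exists_rank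
  refine ⟨fun v => if h : v < n then r ⟨v, h⟩ else 0, fun e he => ?_⟩
  rw [arcSource_eq he, arcTarget_eq he]
  simp only [Fin.is_lt, dif_pos]
  exact hr _ _ ((mem_arcList h).1 (List.getElem_mem he))

lemma n_pos (hG : I.graph.IsMSP) : 0 < n := by
  obtain ⟨tl, hd, a, b, hl⟩ := hG.exists_isLineOf
  obtain ⟨e, he, -⟩ := hl.ttsp.exists_out_in.1
  obtain ⟨v, -, -⟩ := Multiset.mem_map.1 he
  exact v.pos

lemma graphInput {C : RAM.Layout} (hinp : C.inp = I.encode adj)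
    (hB : 2 * n + (arcList adj).length + 4 ≤ C.B) :
    RAM.GraphInput C n (arcList adj).length (I.problem adj hn).sz (offset adj) (arcSource adj)
      (arcTarget adj) where
  size v hv := by
    rw [hinp, encode_size ⟨v, hv⟩]
    simp [problem, hv]
  offset k hk := by rw [hinp, encode_offset hk]
  target e _ := by rw [hinp, encode_target]
  offs_last := offset_last
  offs_le v hv := ⟨offset_mono v.le_succ, offset_last (adj := adj) ▸ offset_mono hv⟩
  src_eq e he v hv := arcSource_eq_iff he hv
  src_lt e he := by
    rw [arcSource_eq he]
    exact Fin.is_lt _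
  dst_lt e he := by
    rw [arcTarget_eq he]
    exact Fin.is_lt _
  le_B := hB

end SSGInstance

/-! ### Numerical bounds and the conclusion. -/

lemma word_bound {n c σ : ℕ} (hn : 0 < n) (hc : 0 < c) (hσ : n ≤ σ) :
    2 * n + 2 + (2 * n + 2) * (c + 17) + (8 * n + 2 * c + 20) + (n + c + σ + n * n) +
      (2 * n + n * n + 4) ≤ (n + c + σ) ^ 2000 := by
  have h1 : 2 * n + 2 + (2 * n + 2) * (c + 17) + (8 * n + 2 * c + 20) + (n + c + σ + n * n) +
      (2 * n + n * n + 4) ≤ 3 ^ 5 * (n + c + σ) ^ 2 := by nlinarith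
  -- The base is at least `3`, so the constant factor is absorbed by further powers of it; exponent
  -- `7` would suffice.
  have h2 : 3 ^ 5 ≤ (n + c + σ) ^ 5 := Nat.pow_le_pow_left (by omega) 5
  refine h1.trans ((Nat.mul_le_mul_right _ h2).trans ?_)
  rw [← pow_add]
  exact Nat.pow_le_pow_right (by omega) (Nat.le_of_ble_eq_true rfl)

lemma time_bound {n c m t₁ t₂ t₃ : ℕ} (hn : 0 < n) (hc : 0 < c) (h₁ : t₁ ≤ 20 * n + 30)
    (h₂ : t₂ ≤ (80 * (c + 2) ^ 2 + 200) * n + 70 * m + 250 * n + 20 * c + 231)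
    (h₃ : t₃ ≤ 20 * n + 10) : t₁ + (t₂ + t₃) ≤ 2000 * (n * c ^ 2 + m) := by
  have h4 : (c + 2) ^ 2 ≤ 9 * c ^ 2 := by nlinarith
  have h5 : c ≤ c ^ 2 := Nat.le_self_pow two_ne_zero _
  have h6 : c ^ 2 ≤ n * c ^ 2 := Nat.le_mul_of_pos_left _ hn
  have h7 : n ≤ n * c ^ 2 := Nat.le_mul_of_pos_right _ (by positivity)
  have h8 : (80 * (c + 2) ^ 2 + 200) * n ≤ 720 * (n * c ^ 2) + 200 * n := by
    calc (80 * (c + 2) ^ 2 + 200) * n ≤ (80 * (9 * c ^ 2) + 200) * n := by gcongr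
      _ = 720 * (n * c ^ 2) + 200 * n := by ring
  generalize n * c ^ 2 = x at *
  generalize (80 * (c + 2) ^ 2 + 200) * n = y at *
  omega

theorem theorem4p5 :
    ∃ (P : RAM.Prog) (K : ℕ), ∀ (n : ℕ) (I : SSGInstance n) (adj : Fin n → List (Fin n)),
      I.graph.IsMSP → I.IsAdjacencyList adj →
      ∃ (t : ℕ) (τ : RAM.State),
        RAM.Run (I.encode adj) (K * (n * I.cap)) ((n + I.cap + ∑ i, I.size i) ^ K)
          P RAM.State.init t τ ∧
        t ≤ K * (n * I.cap ^ 2 + I.graph.arcs.card) ∧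
        ∃ B : Finset (Fin n), I.IsOptimal B ∧
          ∀ i : Fin n, τ.mem i = if i ∈ B then 1 else 0 := by
  refine ⟨RAM.setup ;; RAM.solve ;; RAM.output, 2000, fun n I adj hG hadj => ?_⟩
  have hn := SSGInstance.n_pos hG
  have hcap := I.cap_pos
  obtain ⟨tl, hd, a, b, hT, hline⟩ := SSGInstance.exists_line hG hadj
  obtain ⟨r, hr⟩ := SSGInstance.exists_rank hG hadj
  have hm := SSGInstance.length_arcList hadj
  -- The word size does not mention the number of arcs; it is controlled through `n * n`.
  have hmn : (SSGInstance.arcList adj).length ≤ n * n := by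
    rw [hm]
    exact (Finset.card_le_univ _).trans_eq (by simp)
  have hsum : n ≤ ∑ i, I.size i := by
    have := Finset.card_nsmul_le_sum Finset.univ I.size 1 fun i _ => I.size_pos i
    simpa using this
  generalize hσ : ∑ i, I.size i = σ at *
  -- The left side is `(2n + 2)(c + 18)`, and the factors are at most `4n` and `19c`.
  have hspace : 2 * n + 2 + (2 * n + 2) * (I.cap + 17) ≤ 76 * (n * I.cap) := by nlinarith
  have hword := word_bound hn hcap hsum
  generalize (n + I.cap + σ) ^ 2000 = W at *
  let C : RAM.Layout := {
    inp := I.encode adj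
    S := 2000 * (n * I.cap)
    W := W
    N := 2 * n + 2
    R := I.cap + 17
    -- The sum of all requirements on stored values: addresses, `Fits`, the input words and
    -- `GraphInput`, with `n * n` in place of the number of arcs.
    B := 2 * n + 2 + (2 * n + 2) * (I.cap + 17) + (8 * n + 2 * I.cap + 20) +
      (n + I.cap + σ + n * n) + (2 * n + n * n + 4)
    le_S := by omega
    le_W := by omega
    B_le := hword
    lt_R := by omega
    R_le := Nat.le_mul_of_pos_left _ (by omega)
    inp_le := fun i => (SSGInstance.encode_le i).trans (by omega) }
  have hC : RAM.Fits (I.problem adj hn) C := by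
    refine ⟨rfl, rfl, ?_, ?_⟩
    · change 8 * n + 2 * I.cap + 20 ≤ _
      simp only [C]
      omega
    · change ∑ v ∈ Finset.range n, _ ≤ _
      rw [SSGInstance.range_eq_map, SSGInstance.sum_problem_sz, SSGInstance.weight, hσ]
      simp only [C]
      omega
  have hin : RAM.GraphInput C n (SSGInstance.arcList adj).length
      (I.problem adj hn).sz (SSGInstance.offset adj) (SSGInstance.arcSource adj)
      (SSGInstance.arcTarget adj) := by
    refine SSGInstance.graphInput rfl ?_
    simp only [C]
    omega
  have hrun : RAM.Reaches C.inp C.S C.W (RAM.setup ;; RAM.solve ;; RAM.output) .init fun t τ =>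
      t ≤ 2000 * (n * I.cap ^ 2 + I.graph.arcs.card) ∧
        ∃ B : Finset (Fin n), I.IsOptimal B ∧ ∀ i : Fin n, τ.mem i = if i ∈ B then 1 else 0 := by
    refine .seq ((RAM.reaches_setup (n := n) (c := I.cap) (C := C) rfl rfl rfl rfl
      (by simp only [C]; omega)).mono ?_)
    rintro t₁ σ₁ ⟨ht₁, hσ₁⟩
    obtain ⟨t₂, σ₂, s₂, h1, h2, ht₂, hc₂, A, hA, htgt⟩ := RAM.Layout.wp_solve
      (Q := fun t s => t ≤ RAM.mergeCost (I.problem adj hn) * n +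
        70 * (SSGInstance.arcList adj).length + 250 * n + 20 * I.cap + 231 ∧
        RAM.Consts (I.problem adj hn) s ∧ ∃ A, (I.problem adj hn).Optimal A ∧
        ∀ v < n, 0 < s.tgt v ↔ v ∈ A) hC hin (fun _ => Iff.rfl) hr hT hline
      (fun t s A h1 h2 h3 h4 => ⟨h1, h2, A, h3, h4⟩) σ₁ hσ₁
    refine .seq ⟨t₂, σ₂, h1, ?_⟩
    refine (RAM.reaches_output h2 hc₂.1 hc₂.2.1 ?_).mono ?_
    · rw [hc₂.2.2.2.1]
      change n < 2 * n + 2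
      omega
    rintro t₃ σ₃ ⟨ht₃, hmem⟩
    rw [hc₂.2.2.2.1] at ht₃ hmem
    change t₃ ≤ 20 * n + 10 at ht₃
    refine ⟨?_, Finset.univ.filter fun i : Fin n => (i : ℕ) ∈ A,
      SSGInstance.isOptimal_of_problem (hn := hn) hadj ?_, fun i => ?_⟩
    · rw [← hm]
      exact time_bound hn hcap ht₁ ht₂ ht₃
    · convert hA using 1
      ext v
      simp only [Finset.mem_map, Finset.mem_filter, Finset.mem_univ, true_and,
        Fin.valEmbedding_apply]
      exact ⟨fun ⟨u, hu, huv⟩ => huv ▸ hu, fun hv => ⟨⟨v, Finset.mem_range.1 (hA.subset hv)⟩, hv, rfl⟩⟩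
    · rw [hmem i i.2]
      simp only [Finset.mem_filter, Finset.mem_univ, true_and, htgt i i.2]
  exact hrun
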